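/- **Setting.** For $c\in\mathbb R^d$ let the linear classifier $c$ label $x$ by $c(x)=1$ if $\langle c,x\rangle\ge 1$ and $c(x)=0$ otherwise; it is $s$-sparse if $c$ has at most $s$ nonzero coordinates. For $w\in\mathbb R^d$ let $h_w=\{x:\langle x,w\rangle\ge 0\}$. For a distribution $D$ on $\mathbb R^d\times\{0,1\}$ write $\mathrm{err}_D(c,w)=\Pr_{(x,y)\sim D}[x\in h_w,\ c(x)\ne y]$. **Algorithms.** *SparseList$(D,m)$* with margin parameter $\nu$: draw $m$ examples $(x^{(j)},y^{(j)})$ from $D$, with the labels coded as $y^{(j)}\in\{-1,1\}$. For all $(i_1,\dots,i_s)\in[d]^s$ and $(j_1,\dots,j_s)\in[m]^s$ for which the $s\times s$ matrix $\big(y^{(j_a)}x^{(j_a)}_{i_b}\big)_{a,b}$ is invertible, apply its inverse to the vector $(y^{(j_a)}-\nu)_a$, and put the resulting vector, placed on the coordinates $i_1,\dots,i_s$ (zeros elsewhere), into the list. *Psgd$(D,T,N,w_0)$*: $\beta=\sqrt{1/(Td)}$; for $i=1,\dots,T$, draw $N$ fresh examples, let $u_i=w_{i-1}-\beta\,\hat{\mathbb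 E}[\,y\,(x-\mathrm{proj}_{w_{i-1}}x)\,1[x\in h_{w_{i-1}}]\,]$ (empirical mean over these examples) and $w_i=u_i/\|u_i\|_2$; return $w_1,\dots,w_T$. *Algorithm 1, Ccfc$(D,C,\epsilon,\delta)$* for a finite list $C$ and a unit vector $w_0$: let $T=\lceil(4d+\ln(8|C|/\delta))/\epsilon^4\rceil$, $N=\lceil1600\ln^2(16T|C|/\delta)/\epsilon^2\rceil$, and draw a validation sample of $\lceil\ln(4|C|T/\delta)/(2\epsilon)\rceil$ examples. For each $c\in C$ run Psgd from $w_0$ and from $-w_0$ on examples $(x,1[c(x)\ne y])$, $(x,y)\sim D$, and let $w(c)$ be the iterate $w$ with the smallest fraction of validation examples with $x\in h_w$, $c(x)\ne y$. Return the pair $(c,w(c))$ for which this fraction is smallest. *Algorithm 3, Ccslc$(D,\epsilon,\delta,m)$*: run SparseList$(D,m)$, then Ccfc on the resulting list, with fresh examples. Running time is counted on a real random access machine: exact arithmetic operations, square roots, logarithms, comparisons and loop steps cost one step each, reading an example costs $d+1$ steps, and rounding a number $z$ up to a natural number costs $\lceil z\rceil+1$ steps. **Theorem.** For every $s\in\mathbb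 N$ there are $\epsilon_0\in(0,1/e]$, $a>0$ and $K\in\mathbb N$, depending only on $s$, such that the following holds for all $d\ge\max(1,s)$, $\epsilon\in(0,\epsilon_0]$, $\delta\in(0,1)$, with $$m=\left\lceil \frac{a\,(s\ln d+\ln(1/\delta)+1)\,\ln(1/\epsilon)}{\epsilon}\right\rceil .$$ 1. On every sequence of examples (and for all $\nu$ and $w_0$), Algorithm 3 draws at most $K(d\cdot\frac1\epsilon\cdot\frac1\delta)^K$ examples and makes at most $K(d\cdot\frac1\epsilon\cdot\frac1\delta)^K$ steps. 2. There is $\nu_0>0$, depending only on $s,d,\epsilon,\delta$, such that for every $\nu\in[0,\nu_0]$, every unit vector $w_0$ and every distribution $D$ on $\mathbb R^d\times\{0,1\}$ with standard normal $x$-marginal: if there are a unit vector $v$ and an $s$-sparse linear classifier $c$ with $\mathrm{err}_D(c,v)\le\epsilon$, then with probability at least $1-\delta$ over i.i.d. examples from $D$, Algorithm 3 returns an $s$-sparse classifier $c'$ and a unit vector $w$ with $$\mathrm{err}_D(c',w)\le K\sqrt\epsilon\,\ln^K(1/\epsilon)=\tilde O(\sqrt\epsilon).$$ -/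

import Mathlib

open MeasureTheory ProbabilityTheory

noncomputable section

namespace CondClass

/-! ### Classifiers, selectors, examples -/

/-- Vectors of `ℝ^d`, stored as arrays of coordinates. The inner product is `x ⬝ᵥ y`, and
`v` is a unit vector for the Euclidean norm iff `v ⬝ᵥ v = 1`. -/
abbrev Vec (d : ℕ) : Type := Fin d → ℝ

/-- A labelled example `(x, y)`; the label `1` is `true`, the label `0` (or `-1`) is `false`. -/
abbrev LabeledPoint (d : ℕ) : Type := Vec d × Bool

/-- The linear classifier with weight vector `c` and the standard threshold `1`:
the label of `x` is `1` iff `⟨c, x⟩ ≥ 1`. -/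
def classify {d : ℕ} (c x : Vec d) : Bool := decide (1 ≤ c ⬝ᵥ x)

/-- The (weight vectors of the) linear classifiers with at most `s` nonzero coefficients. -/
def sparseClassifiers (d s : ℕ) : Set (Vec d) := {c | (Function.support c).ncard ≤ s}

/-- The homogeneous halfspace `h(w) = {x | ⟨x, w⟩ ≥ 0}`. -/
def halfspace {d : ℕ} (w : Vec d) : Set (Vec d) := {x | 0 ≤ x ⬝ᵥ w}

/-- The standard normal distribution on `ℝ^d`. -/
def stdNormal (d : ℕ) : Measure (Vec d) := Measure.pi fun _ => gaussianReal 0 1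

/-- The error `P_{(x,y) ∼ D} [x ∈ h(w) and c(x) ≠ y]` of the classifier-selector pair `(c, w)`. -/
def condError {d : ℕ} (D : Measure (LabeledPoint d)) (c w : Vec d) : ℝ :=
  D.real {z | z.1 ∈ halfspace w ∧ classify c z.1 ≠ z.2}

/-! ### Programs on a real random access machine with an example oracle -/

/-- The arithmetic instructions (`sqrt` and `log` ignore their second argument). -/
inductive ArithOp : Type
  | plus | minus | times | divide | sqrt | log

/-- The result of an arithmetic instruction. -/
def ArithOp.eval : ArithOp → ℝ → ℝ → ℝ
  | .plus, x, y => x + y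
  | .minus, x, y => x - y
  | .times, x, y => x * y
  | .divide, x, y => x / y
  | .sqrt, x, _ => Real.sqrt x
  | .log, x, _ => Real.log x

/-- Programs returning a value of type `α`: they perform exact real arithmetic, compare reals,
round reals up to natural numbers, draw examples from an oracle, and spend steps on loop control
and data movement (`tick`). -/
inductive Prog (d : ℕ) (α : Type) : Type
  | ret (a : α) : Prog d α
  | arith (op : ArithOp) (x y : ℝ) (k : ℝ → Prog d α) : Prog d α
  | compare (x y : ℝ) (k : Bool → Prog d α) : Prog d α
  | ceil (x : ℝ) (k : ℕ → Prog d α) : Prog d α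
  | draw (k : LabeledPoint d → Prog d α) : Prog d α
  | tick (k : Prog d α) : Prog d α

/-- What an execution produces: the returned value, the number of examples drawn and the number
of steps. -/
structure Outcome (α : Type) : Type where
  value : α
  samples : ℕ
  steps : ℕ

namespace Prog

variable {d : ℕ} {α β σ : Type}

/-- Execution on the stream `ω` of examples. Arithmetic instructions, comparisons and ticks cost
one step, reading an example costs `d + 1` steps (one per coordinate and one for the label), and
computing `⌈x⌉` costs `⌈x⌉ + 1` steps (counting upwards). -/
def run : Prog d α → (ℕ → LabeledPoint d) → Outcome α
  | .ret a, _ => ⟨a, 0, 0⟩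
  | .arith op x y k, ω =>
      let r := (k (op.eval x y)).run ω
      ⟨r.value, r.samples, r.steps + 1⟩
  | .compare x y k, ω =>
      let r := (k (decide (x ≤ y))).run ω
      ⟨r.value, r.samples, r.steps + 1⟩
  | .ceil x k, ω =>
      let r := (k ⌈x⌉₊).run ω
      ⟨r.value, r.samples, r.steps + (⌈x⌉₊ + 1)⟩
  | .draw k, ω =>
      let r := (k (ω 0)).run (fun i => ω (i + 1))
      ⟨r.value, r.samples + 1, r.steps + (d + 1)⟩
  | .tick k, ω =>
      let r := k.run ω
      ⟨r.value, r.samples, r.steps + 1⟩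

/-- Sequential composition. -/
def bind : Prog d α → (α → Prog d β) → Prog d β
  | .ret a, f => f a
  | .arith op x y k, f => .arith op x y fun r => (k r).bind f
  | .compare x y k, f => .compare x y fun r => (k r).bind f
  | .ceil x k, f => .ceil x fun r => (k r).bind f
  | .draw k, f => .draw fun z => (k z).bind f
  | .tick k, f => .tick (k.bind f)

instance instMonad : Monad (Prog d) where
  pure := Prog.ret
  bind := Prog.bind

/-- The instructions as programs. -/
def rAdd (x y : ℝ) : Prog d ℝ := .arith .plus x y .ret
def rSub (x y : ℝ) : Prog d ℝ := .arith .minus x y .ret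
def rMul (x y : ℝ) : Prog d ℝ := .arith .times x y .ret
def rDiv (x y : ℝ) : Prog d ℝ := .arith .divide x y .ret
def rSqrt (x : ℝ) : Prog d ℝ := .arith .sqrt x 0 .ret
def rLog (x : ℝ) : Prog d ℝ := .arith .log x 0 .ret
/-- Decides `x ≤ y`. -/
def rLe (x y : ℝ) : Prog d Bool := .compare x y .ret
def rCeil (x : ℝ) : Prog d ℕ := .ceil x .ret
def example1 : Prog d (LabeledPoint d) := .draw .ret

/-- `for b in l` with loop state in `σ`; each iteration costs one extra step. -/
def forFold (l : List β) (init : σ) (f : σ → β → Prog d σ) : Prog d σ :=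
  match l with
  | [] => .ret init
  | b :: l => .tick ((f init b).bind fun st => forFold l st f)

/-- Fill an array of length `n`; each entry costs one extra step. -/
def mkArray : (n : ℕ) → (Fin n → Prog d β) → Prog d (Fin n → β)
  | 0, _ => .ret Fin.elim0
  | n + 1, f => .tick do
      let a ← f 0
      let v ← mkArray n fun i => f i.succ
      return (Fin.cons (α := fun _ => β) a v)

/-- An element of the list with the smallest score, together with its score. -/
def argmin (score : β → Prog d ℝ) (l : List β) : Prog d (Option (β × ℝ)) :=
  forFold l none fun best b => do
    let v ← score b
    match best with
    | none => return some (b, v)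
    | some (b', v') => do
        let keep ← rLe v' v
        return if keep then some (b', v') else some (b, v)

/-- The inner product. -/
def dot {n : ℕ} (x y : Fin n → ℝ) : Prog d ℝ :=
  forFold (List.finRange n) 0 fun acc i => do
    let p ← rMul (x i) (y i)
    rAdd acc p

/-- The zero vector. -/
def zeroVec : Prog d (Vec d) := mkArray d fun _ => .ret 0

/-! ### Linear systems by Cramer's rule -/

/-- The determinant by expansion along the first row. -/
def detProg : (n : ℕ) → (Fin n → Fin n → ℝ) → Prog d ℝ
  | 0, _ => .ret 1
  | n + 1, A =>
      forFold (List.finRange (n + 1)) 0 fun acc i => do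
        let B ← mkArray n fun a => mkArray n fun b => .ret (A a.succ (i.succAbove b))
        let D ← detProg n B
        let t ← rMul (A 0 i) D
        if Even (i : ℕ) then rAdd acc t else rSub acc t

/-- The solution `A⁻¹ b` of the linear system, or `none` if `A` is singular. -/
def solve (n : ℕ) (A : Fin n → Fin n → ℝ) (b : Fin n → ℝ) : Prog d (Option (Fin n → ℝ)) := do
  let D ← detProg n A
  let p ← rLe D 0
  let q ← rLe 0 D
  if p && q then
    return none
  else do
    let u ← mkArray n fun k => do
      let B ← mkArray n fun i => mkArray n fun j => .ret (if j = k then b i else A i j)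
      let Dk ← detProg n B
      rDiv Dk D
    return some u

/-! ### Robust list learning of sparse linear classifiers -/

/-- The label as an element of `{-1, 1}`. -/
def sgn (y : Bool) : ℝ := if y then 1 else -1

/-- All `s`-tuples of elements of `{0, …, n-1}`. -/
def allTuples (n : ℕ) : (s : ℕ) → List (Fin s → Fin n)
  | 0 => [Fin.elim0]
  | s + 1 => (List.finRange n).flatMap fun i =>
      (allTuples n s).map fun t => Fin.cons (α := fun _ => Fin n) i t

/-- The vector of `ℝ^d` with entry `u b` at the coordinate `I b` and zeros elsewhere. -/
def scatter {s : ℕ} (I : Fin s → Fin d) (u : Fin s → ℝ) : Prog d (Vec d) := do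
  let z ← zeroVec
  forFold (List.finRange s) z fun w b => .ret (Function.update w (I b) (u b))

/-- `SparseList`, with margin parameter `ν`: draw `m` examples; for all `i₁, …, i_s ∈ [d]` and
`j₁, …, j_s ∈ [m]` solve the `s × s` linear system with rows
`(y^(j_a) x_{i_1}^(j_a), …, y^(j_a) x_{i_s}^(j_a))` and right-hand sides `y^(j_a) - ν`, and put the
solution, as a vector supported on the coordinates `i₁, …, i_s`, into the list. Tuples whose matrix
is not invertible are skipped. -/
def sparseList (s m : ℕ) (ν : ℝ) : Prog d (List (Vec d)) := do
  let S ← mkArray m fun _ => example1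
  forFold (allTuples d s) [] fun L I =>
    forFold (allTuples m s) L fun L J => do
      let A ← mkArray s fun a => mkArray s fun b => rMul (sgn (S (J a)).2) ((S (J a)).1 (I b))
      let rhs ← mkArray s fun a => rSub (sgn (S (J a)).2) ν
      let sol ← solve s A rhs
      match sol with
      | none => return L
      | some u => do
          let w ← scatter I u
          return w :: L

/-! ### Projected stochastic gradient descent -/

/-- Evaluation of the classifier `c` at `x`. -/
def evalClassifier (c x : Vec d) : Prog d Bool := do
  let t ← dot c x
  rLe 1 t

/-- The projected gradient `g_w(x, y) = y · x_{w^⊥} · 1[x ∈ h(w)]`, where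
`x_{w^⊥} = x - (⟨x, w⟩ / ⟨w, w⟩) w` and `y ∈ {0, 1}`. -/
def gradTerm (w x : Vec d) (y : Bool) : Prog d (Vec d) := do
  let t ← dot x w
  let inside ← rLe 0 t
  if y && inside then do
    let r ← dot w w
    let q ← rDiv t r
    mkArray d fun j => do
      let p ← rMul q (w j)
      rSub (x j) p
  else
    zeroVec

/-- One iteration: the average gradient `g` over `N` fresh examples, `u = w - β g`, and the
result `u / ‖u‖₂`. -/
def psgdStep (sampler : Prog d (LabeledPoint d)) (β : ℝ) (N : ℕ) (w : Vec d) : Prog d (Vec d) := do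
  let z ← zeroVec
  let g ← forFold (List.range N) z fun acc _ => do
    let e ← sampler
    let h ← gradTerm w e.1 e.2
    mkArray d fun j => rAdd (acc j) (h j)
  let u ← mkArray d fun j => do
    let a ← rDiv (g j) N
    let b ← rMul β a
    rSub (w j) b
  let r2 ← dot u u
  let r ← rSqrt r2
  mkArray d fun j => rDiv (u j) r

/-- The iterates of the first `T` iterations started at `w`. -/
def psgdLoop (sampler : Prog d (LabeledPoint d)) (β : ℝ) (N : ℕ) :
    ℕ → Vec d → Prog d (List (Vec d))
  | 0, _ => .ret []
  | T + 1, w => .tick do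
      let w' ← psgdStep sampler β N w
      let rest ← psgdLoop sampler β N T w'
      return w' :: rest

/-- `Psgd(D, T, N, w₀)` with step size `β = √(1 / (T d))`; the distribution `D` is given by a
program that draws one example from it. -/
def psgd (sampler : Prog d (LabeledPoint d)) (T N : ℕ) (w₀ : Vec d) : Prog d (List (Vec d)) := do
  let p ← rMul T d
  let q ← rDiv 1 p
  let β ← rSqrt q
  psgdLoop sampler β N T w₀

/-! ### Conditional classification for a finite list, and for sparse linear classifiers -/

/-- One example `(x, 1[c(x) ≠ y])`. -/
def relabel (c : Vec d) : Prog d (LabeledPoint d) := do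
  let e ← example1
  let b ← evalClassifier c e.1
  return (e.1, b != e.2)

/-- The fraction of the examples `(x, y)` in `S` with `x ∈ h(w)` and `c(x) ≠ y`. -/
def empError {n : ℕ} (S : Fin n → LabeledPoint d) (c w : Vec d) : Prog d ℝ := do
  let k ← forFold (List.finRange n) (0 : ℝ) fun acc i => do
    let t ← dot (S i).1 w
    let inside ← rLe 0 t
    let b ← evalClassifier c (S i).1
    if inside && (b != (S i).2) then rAdd acc 1 else return acc
  rDiv k n

/-- `⌈(4d + ln(8 L / δ)) / ε⁴⌉`, for a list of length `L`. -/
def numIterations (L : ℕ) (ε δ : ℝ) : Prog d ℕ := do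
  let a ← rMul 8 L
  let a ← rDiv a δ
  let a ← rLog a
  let b ← rMul 4 d
  let a ← rAdd b a
  let e2 ← rMul ε ε
  let e4 ← rMul e2 e2
  let a ← rDiv a e4
  rCeil a

/-- `⌈1600 ln²(16 T L / δ) / ε²⌉`. -/
def batchSize (L T : ℕ) (ε δ : ℝ) : Prog d ℕ := do
  let a ← rMul 16 T
  let a ← rMul a L
  let a ← rDiv a δ
  let a ← rLog a
  let a ← rMul a a
  let a ← rMul 1600 a
  let e2 ← rMul ε ε
  let a ← rDiv a e2
  rCeil a

/-- `⌈ln(4 L T / δ) / (2 ε)⌉`. -/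
def validationSize (L T : ℕ) (ε δ : ℝ) : Prog d ℕ := do
  let a ← rMul 4 L
  let a ← rMul a T
  let a ← rDiv a δ
  let a ← rLog a
  let b ← rMul 2 ε
  let a ← rDiv a b
  rCeil a

/-- `Ccfc(D, C, ε, δ)`, with initial vector `w₀`: for each `c` in the list run `Psgd` from `w₀` and
from `-w₀` on the examples relabelled by `1[c(x) ≠ y]`, keep the iterate `w(c)` with the smallest
empirical error on the validation sample, and return the best pair `(c, w(c))` (`none` if the list
is empty). -/
def ccfc (w₀ : Vec d) (C : List (Vec d)) (ε δ : ℝ) : Prog d (Option (Vec d × Vec d)) := do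
  let T ← numIterations C.length ε δ
  let N ← batchSize C.length T ε δ
  let n ← validationSize C.length T ε δ
  let S ← mkArray n fun _ => example1
  let w₁ ← mkArray d fun j => rSub 0 (w₀ j)
  let pairs ← forFold C ([] : List (Vec d × Vec d)) fun acc c => do
    let W₀ ← psgd (relabel c) T N w₀
    let W₁ ← psgd (relabel c) T N w₁
    let best ← argmin (empError S c) (W₀ ++ W₁)
    match best with
    | none => return acc
    | some (w, _) => return (c, w) :: acc
  let best ← argmin (fun p => empError S p.1 p.2) pairs
  return best.map Prod.fst

/-- Conditional classification for `s`-sparse linear classifiers, `Ccslc(D, ε, δ, m)`: run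
`SparseList(D, m)` and then `Ccfc` on the resulting list. -/
def ccslc (s m : ℕ) (ν : ℝ) (w₀ : Vec d) (ε δ : ℝ) : Prog d (Option (Vec d × Vec d)) := do
  let C ← sparseList s m ν
  ccfc w₀ C ε δ

end Prog

/-- The number of examples given to the list learner,
`⌈a (s ln d + ln(1/δ) + 1) ln(1/ε) / ε⌉`. -/
def listSampleSize (a : ℝ) (s d : ℕ) (ε δ : ℝ) : ℕ :=
  ⌈a * (s * Real.log d + Real.log (1 / δ) + 1) * Real.log (1 / ε) / ε⌉₊

end CondClass

end

noncomputable section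

namespace CondClass

/-! ### Execution of programs: values, sample counts and step counts. -/

section

variable {d : ℕ}

/-! Resources. `Exec` records the value, the sample count and a step bound of a program on a stream.
`exec_ccslc` evaluates the algorithm in these terms. The cost is monotone in the list length and in
the parameters T, N, n, and each of these is polynomial because ln z ≤ z (`exists_polynomial_cost`).

List learning. Fix an s-sparse c and a unit v with error at most ε. The correctly labelled examples
in h(v) impose linear inequalities on s coordinates, and c is feasible. Almost surely any s examples
are in general position, so once s of them are good the feasible polyhedron has a vertex
(`exists_vertex`). It solves s tight equations, hence it is on the list. This vertex fits every good
example but is determined by only s of them, so sample compression (`pi_compression_le`) and a union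
over m^s tuples bound the mass of violated inequalities by ε. An example that satisfies its
inequality is misclassified only if ⟨x,c'⟩ is within ν of 1, a band of mass at most 2ν whatever the
length of c'. So some listed c' has error at most 3ε on h(v) (`pi_list_le`).

Descent. For this c' let w be a unit vector with ⟨w,v⟩ ≥ -ε, and let p be the mass of the errors in
h(w) outside h(v). Errors inside h(v) are rare, and Gaussian tails keep their contribution to the
gradient of order ε ln(1/ε). Errors outside push w towards v with strength |⟨x,v⟩|, and a set of
mass p cannot crowd around a hyperplane, so they contribute at most -p²/4 (`drift_le`). While the
error exceeds 24√ε ln(1/ε), each step therefore raises ⟨w,v⟩ by at least βε. This cannot go on for T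
steps, as ⟨w,v⟩ ≤ 1 (`exists_good_iterate`). One of w₀, -w₀ has a nonnegative starting correlation.

Selection. A multiplicative Chernoff bound on the validation sample separates errors at most p from
errors above 12p, so the selected pair has error at most 12 · 24√ε ln(1/ε).

Independence is used through `measurePreserving_split`: a block of the stream is independent of the
rest, and the bounds for it are uniform in whatever is computed from the other examples. -/

/-- The stream without its first `n` entries. -/
def shift {Z : Type*} (n : ℕ) (ω : ℕ → Z) : ℕ → Z := fun i => ω (i + n)

/-- The first `n` entries of a stream. -/
def first {Z : Type*} (n : ℕ) (ω : ℕ → Z) : Fin n → Z := fun i => ω i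

lemma shift_zero {Z : Type*} (ω : ℕ → Z) : shift 0 ω = ω := rfl

lemma shift_shift {Z : Type*} (m n : ℕ) (ω : ℕ → Z) : shift n (shift m ω) = shift (m + n) ω := by
  funext i; simp only [shift]; congr 1; omega

namespace Prog

variable {α β σ : Type}

/-- A program reads its stream from the front, so the continuation sees exactly the stream with the
consumed examples removed. -/
lemma run_bind (p : Prog d α) (f : α → Prog d β) (ω : ℕ → LabeledPoint d) :
    (p >>= f).run ω =
      ⟨((f (p.run ω).value).run (shift (p.run ω).samples ω)).value,
       (p.run ω).samples + ((f (p.run ω).value).run (shift (p.run ω).samples ω)).samples,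
       (p.run ω).steps + ((f (p.run ω).value).run (shift (p.run ω).samples ω)).steps⟩ := by
  change (p.bind f).run ω = _
  induction p generalizing ω with
  | ret a => simp [Prog.bind, run, shift_zero]
  | arith op x y k ih => simp only [Prog.bind, run, ih, add_right_comm]
  | compare x y k ih => simp only [Prog.bind, run, ih, add_right_comm]
  | ceil x k ih => simp only [Prog.bind, run, ih, add_right_comm]
  | draw k ih =>
    have h : ∀ n, shift n (fun i => ω (i + 1)) = shift (n + 1) ω := fun n => by
      funext i; simp only [shift]; congr 1
    simp only [Prog.bind, run, ih, add_right_comm, h]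
  | tick k ih => simp only [Prog.bind, run, ih, add_right_comm]

/-- On the stream `ω` the program returns `v`, draws `n` examples and makes at most `c` steps. -/
structure Exec (p : Prog d α) (ω : ℕ → LabeledPoint d) (v : α) (n c : ℕ) : Prop where
  value : (p.run ω).value = v
  samples : (p.run ω).samples = n
  steps : (p.run ω).steps ≤ c

/-- The program draws no examples, returns `v` and makes at most `c` steps. -/
def Det (p : Prog d α) (v : α) (c : ℕ) : Prop := ∀ ω, Exec p ω v 0 c

lemma Exec.bind {p : Prog d α} {f : α → Prog d β} {ω : ℕ → LabeledPoint d} {v : α} {v' : β}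
    {n n' c c' : ℕ} (h : Exec p ω v n c) (h' : Exec (f v) (shift n ω) v' n' c') :
    Exec (p >>= f) ω v' (n + n') (c + c') := by
  obtain ⟨rfl, rfl, h⟩ := h
  obtain ⟨rfl, rfl, h'⟩ := h'
  constructor <;> rw [run_bind]
  exact add_le_add h h'

lemma Exec.mono {p : Prog d α} {ω : ℕ → LabeledPoint d} {v v' : α} {n n' c c' : ℕ}
    (h : Exec p ω v n c) (hv : v = v') (hn : n = n') (hc : c ≤ c') : Exec p ω v' n' c' := by
  subst hv hn
  exact ⟨h.1, h.2, h.3.trans hc⟩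

lemma Exec.tick {p : Prog d α} {ω : ℕ → LabeledPoint d} {v : α} {n c : ℕ}
    (h : Exec p ω v n c) : Exec (.tick p) ω v n (c + 1) :=
  ⟨h.1, h.2, Nat.succ_le_succ h.3⟩

lemma Exec.ret (a : α) (ω : ℕ → LabeledPoint d) : Exec (.ret a) ω a 0 0 := ⟨rfl, rfl, le_rfl⟩

lemma Det.mono {p : Prog d α} {v v' : α} {c c' : ℕ} (h : Det p v c) (hv : v = v') (hc : c ≤ c') :
    Det p v' c' := fun ω => (h ω).mono hv rfl hc

lemma Det.ret (a : α) : Det (d := d) (.ret a) a 0 := fun ω => Exec.ret a ω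

lemma Det.pure (a : α) : Det (d := d) (Pure.pure a) a 0 := fun ω => Exec.ret a ω

lemma Det.bind {p : Prog d α} {f : α → Prog d β} {v : α} {v' : β} {c c' : ℕ}
    (h : Det p v c) (h' : Det (f v) v' c') : Det (p >>= f) v' (c + c') :=
  fun ω => (h ω).bind (h' _)

lemma Det.exec_bind {p : Prog d α} {f : α → Prog d β} {ω : ℕ → LabeledPoint d} {v : α} {v' : β}
    {n' c c' : ℕ} (h : Det p v c) (h' : Exec (f v) ω v' n' c') :
    Exec (p >>= f) ω v' n' (c + c') :=
  ((h ω).bind h').mono rfl (zero_add _) le_rfl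

lemma Det.tick {p : Prog d α} {v : α} {c : ℕ} (h : Det p v c) : Det (.tick p) v (c + 1) :=
  fun ω => (h ω).tick

lemma det_rAdd (x y : ℝ) : Det (d := d) (rAdd x y) (x + y) 1 := fun _ => ⟨rfl, rfl, le_rfl⟩
lemma det_rSub (x y : ℝ) : Det (d := d) (rSub x y) (x - y) 1 := fun _ => ⟨rfl, rfl, le_rfl⟩
lemma det_rMul (x y : ℝ) : Det (d := d) (rMul x y) (x * y) 1 := fun _ => ⟨rfl, rfl, le_rfl⟩
lemma det_rDiv (x y : ℝ) : Det (d := d) (rDiv x y) (x / y) 1 := fun _ => ⟨rfl, rfl, le_rfl⟩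
lemma det_rSqrt (x : ℝ) : Det (d := d) (rSqrt x) (Real.sqrt x) 1 := fun _ => ⟨rfl, rfl, le_rfl⟩
lemma det_rLog (x : ℝ) : Det (d := d) (rLog x) (Real.log x) 1 := fun _ => ⟨rfl, rfl, le_rfl⟩
lemma det_rLe (x y : ℝ) : Det (d := d) (rLe x y) (decide (x ≤ y)) 1 := fun _ => ⟨rfl, rfl, le_rfl⟩
lemma det_rCeil (x : ℝ) : Det (d := d) (rCeil x) ⌈x⌉₊ (⌈x⌉₊ + 1) :=
  fun _ => ⟨rfl, rfl, by simp [rCeil, run]⟩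

lemma exec_example1 (ω : ℕ → LabeledPoint d) : Exec example1 ω (ω 0) 1 (d + 1) :=
  ⟨rfl, rfl, by simp [example1, run]⟩

lemma Det.forFold {l : List β} {f : σ → β → Prog d σ} {g : σ → β → σ} {c : ℕ}
    (h : ∀ st, ∀ b, Det (f st b) (g st b) c) (init : σ) :
    Det (Prog.forFold l init f) (l.foldl g init) (l.length * (c + 1)) := by
  induction l generalizing init with
  | nil => exact (Det.ret init).mono rfl (by simp)
  | cons b l ih =>
    refine (Det.tick (Det.bind (h init b) (ih _))).mono rfl ?_
    simp only [List.length_cons]; ring_nf; rfl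

lemma Det.mkArray {n : ℕ} {f : Fin n → Prog d β} {v : Fin n → β} {c : ℕ}
    (h : ∀ i, Det (f i) (v i) c) : Det (Prog.mkArray n f) v (n * (c + 1)) := by
  induction n with
  | zero => exact (Det.ret _).mono (Subsingleton.elim _ _) (by simp)
  | succ n ih =>
    rw [Prog.mkArray]
    apply Det.mono
    · apply Det.tick
      apply Det.bind (h 0)
      exact Det.bind (ih fun i => h i.succ) (Det.pure _)
    · funext i; refine Fin.cases rfl (fun j => rfl) i
    · ring_nf; rfl

lemma exec_mkArray_example1 (n : ℕ) (ω : ℕ → LabeledPoint d) :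
    Exec (mkArray n fun _ => example1) ω (first n ω) n (n * (d + 2)) := by
  induction n generalizing ω with
  | zero => exact (Exec.ret _ ω).mono (Subsingleton.elim _ _) rfl (by simp)
  | succ n ih =>
    rw [Prog.mkArray]
    apply Exec.mono
    · apply Exec.tick
      apply Exec.bind (exec_example1 ω)
      exact Exec.bind (ih (shift 1 ω)) (Exec.ret _ _)
    · funext i
      refine Fin.cases ?_ (fun j => ?_) i
      · simp [first]
      · simp [first, shift]
    · omega
    · ring_nf; rfl

/-- Folding a function that reads `n` entries of a stream in each iteration. -/
def streamFold {Z : Type*} (n : ℕ) (g : σ → β → (ℕ → Z) → σ) : List β → σ → (ℕ → Z) → σ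
  | [], st, _ => st
  | b :: l, st, ω => streamFold n g l (g st b ω) (shift n ω)

/-- Every iteration consumes the same number n of examples, so the count is exact and the block read
by each iteration sits at a position known in advance. -/
lemma Exec.forFold {l : List β} {f : σ → β → Prog d σ} {g : σ → β → (ℕ → LabeledPoint d) → σ}
    {n c : ℕ} (h : ∀ st b ω, Exec (f st b) ω (g st b ω) n c) (init : σ)
    (ω : ℕ → LabeledPoint d) :
    Exec (Prog.forFold l init f) ω (streamFold n g l init ω) (l.length * n) (l.length * (c + 1)) := by
  induction l generalizing init ω with
  | nil => exact (Exec.ret init ω).mono rfl (by simp) (by simp)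
  | cons b l ih =>
    refine (Exec.tick (Exec.bind (h init b ω) (ih _ _))).mono rfl ?_ ?_
    · simp only [List.length_cons]; ring
    · simp only [List.length_cons]; ring_nf; rfl

/-- In a loop that only prepends one element per iteration, the k-th element depends on the stream
from position k * n on. This lets the probabilistic arguments address a single candidate. -/
lemma mem_streamFold {Z : Type*} {n : ℕ} {g : List σ → β → (ℕ → Z) → List σ}
    {h : β → (ℕ → Z) → σ} (hg : ∀ st b ω, g st b ω = h b ω :: st) (l : List β) (init : List σ)
    (ω : ℕ → Z) (x : σ) :
    x ∈ streamFold n g l init ω ↔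
      x ∈ init ∨ ∃ k, ∃ hk : k < l.length, x = h l[k] (shift (k * n) ω) := by
  induction l generalizing init ω with
  | nil => simp [streamFold]
  | cons b l ih =>
    rw [streamFold, ih, hg, List.mem_cons]
    constructor
    · rintro ((rfl | hx) | ⟨k, hk, rfl⟩)
      · exact Or.inr ⟨0, by simp, by simp [shift_zero]⟩
      · exact Or.inl hx
      · refine Or.inr ⟨k + 1, by simpa using hk, ?_⟩
        rw [shift_shift]
        simp only [List.getElem_cons_succ]
        congr 2; ring
    · rintro (hx | ⟨k, hk, rfl⟩)
      · exact Or.inl (Or.inr hx)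
      · rcases k with _ | k
        · exact Or.inl (Or.inl (by simp [shift_zero]))
        · refine Or.inr ⟨k, by simpa using hk, ?_⟩
          rw [shift_shift]
          simp only [List.getElem_cons_succ]
          congr 2; ring

/-! ### Minimal elements -/

/-- The value of `argmin`. -/
def argminVal (f : β → ℝ) (l : List β) : Option (β × ℝ) :=
  l.foldl (fun best b => match best with
    | none => some (b, f b)
    | some (b', v') => if v' ≤ f b then some (b', v') else some (b, f b)) none

lemma det_argmin {score : β → Prog d ℝ} {f : β → ℝ} {c : ℕ} (h : ∀ b, Det (score b) (f b) c)
    (l : List β) : Det (argmin score l) (argminVal f l) (l.length * (c + 2)) := by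
  unfold argmin argminVal
  refine Det.forFold (c := c + 1) (fun st b => ?_) none
  rcases st with _ | ⟨b', v'⟩
  · exact Det.mono (Det.bind (h b) (f := fun v => Pure.pure (some (b, v))) (Det.pure _)) rfl
      (Nat.le_succ c)
  · refine Det.bind (h b) ?_
    refine Det.mono (Det.bind (det_rLe v' (f b))
      (f := fun keep => Pure.pure (if keep then some (b', v') else some (b, f b))) (Det.pure _))
      ?_ le_rfl
    simp

lemma argminVal_append_singleton (f : β → ℝ) (l : List β) (b : β) :
    argminVal f (l ++ [b]) = match argminVal f l with
      | none => some (b, f b)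
      | some (b', v') => if v' ≤ f b then some (b', v') else some (b, f b) := by
  simp [argminVal, List.foldl_append]

lemma exists_argminVal (f : β → ℝ) (l : List β) (hl : l ≠ []) :
    ∃ b ∈ l, argminVal f l = some (b, f b) ∧ ∀ b' ∈ l, f b ≤ f b' := by
  induction l using List.reverseRecOn with
  | nil => exact absurd rfl hl
  | append_singleton l b ih =>
    rcases eq_or_ne l [] with rfl | hne
    · exact ⟨b, by simp, by simp [argminVal], by simp⟩
    · obtain ⟨b₀, hb₀, hv, hmin⟩ := ih hne
      rw [argminVal_append_singleton, hv]
      by_cases hle : f b₀ ≤ f b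
      · refine ⟨b₀, by simp [hb₀], by simp [hle], fun b' hb' => ?_⟩
        rcases List.mem_append.1 hb' with hb' | hb'
        · exact hmin b' hb'
        · rw [List.mem_singleton.1 hb']; exact hle
      · refine ⟨b, by simp, by simp [hle], fun b' hb' => ?_⟩
        rcases List.mem_append.1 hb' with hb' | hb'
        · exact (not_le.1 hle).le.trans (hmin b' hb')
        · rw [List.mem_singleton.1 hb']

/-! ### Linear algebra -/

lemma foldl_add_eq_sum {n : ℕ} (f : Fin n → ℝ) (a : ℝ) :
    (List.finRange n).foldl (fun acc i => acc + f i) a = a + ∑ i, f i := by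
  induction n generalizing a with
  | zero => simp
  | succ n ih =>
    rw [List.finRange_succ, List.foldl_cons, List.foldl_map, ih (fun i => f i.succ), Fin.sum_univ_succ,
      add_assoc]

lemma det_dot {n : ℕ} (x y : Fin n → ℝ) : Det (d := d) (dot x y) (x ⬝ᵥ y) (n * 3) := by
  refine (Det.forFold (g := fun acc i => acc + x i * y i) (c := 2) (fun st i => ?_) 0).mono ?_ ?_
  · exact Det.bind (det_rMul _ _) (det_rAdd _ _)
  · rw [foldl_add_eq_sum, zero_add]; rfl
  · simp

lemma det_zeroVec : Det (d := d) zeroVec 0 d :=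
  (Det.mkArray (c := 0) fun _ => Det.ret 0).mono rfl (by simp)

/-- A bound for the number of steps of `detProg`. -/
def detCost : ℕ → ℕ
  | 0 => 0
  | n + 1 => (n + 1) * (n * (n + 1) + detCost n + 3)

lemma det_detProg (n : ℕ) (A : Fin n → Fin n → ℝ) :
    Det (d := d) (detProg n A) (Matrix.of A).det (detCost n) := by
  induction n with
  | zero => exact (Det.ret _).mono (by simp) le_rfl
  | succ n ih =>
    rw [detProg]
    refine (Det.forFold (g := fun acc (i : Fin (n + 1)) => acc + (-1) ^ (i : ℕ) * A 0 i *
      (Matrix.of fun a b : Fin n => A a.succ (i.succAbove b)).det)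
      (c := n * (n + 1) + detCost n + 2) (fun st i => ?_) 0).mono ?_ ?_
    · refine (Det.bind (Det.mkArray fun a => Det.mkArray fun b => Det.ret _)
        (Det.bind (ih _) (Det.bind (det_rMul _ _)
        (v' := st + (-1) ^ (i : ℕ) * A 0 i *
          (Matrix.of fun a b : Fin n => A a.succ (i.succAbove b)).det) (c' := 1) ?_))).mono rfl ?_
      · split_ifs with h
        · exact (det_rAdd _ _).mono (by simp [h.neg_one_pow]) le_rfl
        · exact (det_rSub _ _).mono (by simp [(Nat.not_even_iff_odd.1 h).neg_one_pow, sub_eq_add_neg])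
            le_rfl
      · exact le_of_eq (by ring)
    · rw [foldl_add_eq_sum, zero_add, Matrix.det_succ_row_zero]
      rfl
    · simp [detCost]

/-- The value of `solve`, by Cramer's rule. -/
def cramerSol {n : ℕ} (A : Fin n → Fin n → ℝ) (b : Fin n → ℝ) : Fin n → ℝ := fun k =>
  (Matrix.of fun i j => if j = k then b i else A i j).det / (Matrix.of A).det

/-- A bound for the number of steps of `solve`. -/
def solveCost (n : ℕ) : ℕ := detCost n + 2 + n * (n * (n + 1) + detCost n + 2)

lemma det_solve (n : ℕ) (A : Fin n → Fin n → ℝ) (b : Fin n → ℝ) :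
    Det (d := d) (solve n A b) (if (Matrix.of A).det = 0 then none else some (cramerSol A b))
      (solveCost n) := by
  refine (Det.bind (det_detProg n A) (Det.bind (det_rLe _ _) (Det.bind (det_rLe _ _)
    (c' := n * (n * (n + 1) + detCost n + 2)) ?_))).mono rfl
    (le_of_eq ?_)
  · by_cases h : (Matrix.of A).det = 0
    · simp only [h, le_refl, decide_true, Bool.and_self, if_true]
      exact (Det.pure _).mono rfl (by simp)
    · have : ¬ ((Matrix.of A).det ≤ 0 ∧ 0 ≤ (Matrix.of A).det) := fun h' => h (le_antisymm h'.1 h'.2)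
      simp only [h, ← Bool.decide_and, this, decide_false, if_false]
      have h1 : ∀ k, Det (d := d) (do
          let B ← mkArray n fun i => mkArray n fun j => .ret (if j = k then b i else A i j)
          let Dk ← detProg n B
          rDiv Dk (Matrix.of A).det) (cramerSol A b k) (n * (n + 1) + detCost n + 1) := fun k => by
        apply Det.mono
        · apply Det.bind (Det.mkArray fun i => Det.mkArray fun j => Det.ret _)
          exact Det.bind (det_detProg n _) (det_rDiv _ _)
        · rfl
        · exact le_of_eq (by ring)
      exact Det.mono (Det.bind (Det.mkArray h1) (f := fun u => Pure.pure (some u)) (Det.pure _)) rfl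
        (le_of_eq (by ring))
  · rw [solveCost]; ring

end Prog

end

/-! ### Values and costs of the algorithms. -/

section

variable {d : ℕ}

namespace Prog

variable {α β σ : Type}

/-! ### The list learner -/

lemma length_allTuples (n s : ℕ) : (allTuples n s).length = n ^ s := by
  induction s with
  | zero => simp [allTuples]
  | succ s ih => simp [allTuples, ih, pow_succ, mul_comm]

lemma mem_allTuples {n s : ℕ} (t : Fin s → Fin n) : t ∈ allTuples n s := by
  induction s with
  | zero => simp [allTuples, Subsingleton.elim t Fin.elim0]
  | succ s ih =>
    simp only [allTuples, List.mem_flatMap, List.mem_finRange, true_and, List.mem_map]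
    exact ⟨t 0, fun i => t i.succ, ih _, by
      funext i; refine Fin.cases rfl (fun j => rfl) i⟩

/-- The vector with entry `u b` at the coordinate `I b` and zeros elsewhere. -/
def scatterVec {s : ℕ} (I : Fin s → Fin d) (u : Fin s → ℝ) : Vec d :=
  (List.finRange s).foldl (fun w b => Function.update w (I b) (u b)) 0

lemma det_scatter {s : ℕ} (I : Fin s → Fin d) (u : Fin s → ℝ) :
    Det (scatter I u) (scatterVec I u) (d + s) := by
  refine Det.bind det_zeroVec ?_
  refine (Det.forFold (c := 0) (fun w b => Det.ret _) 0).mono rfl (by simp)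

/-- The matrix of the linear system given by coordinates `I` and examples `J`. -/
def sysMatrix {s m : ℕ} (S : Fin m → LabeledPoint d) (I : Fin s → Fin d) (J : Fin s → Fin m) :
    Fin s → Fin s → ℝ := fun a b => sgn (S (J a)).2 * (S (J a)).1 (I b)

/-- The right-hand side of the linear system given by the examples `J`. -/
def sysRhs {s m : ℕ} (ν : ℝ) (S : Fin m → LabeledPoint d) (J : Fin s → Fin m) : Fin s → ℝ :=
  fun a => sgn (S (J a)).2 - ν

/-- The candidate classifier given by coordinates `I` and examples `J`. -/
def candidate {s m : ℕ} (ν : ℝ) (S : Fin m → LabeledPoint d)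
    (q : (Fin s → Fin d) × (Fin s → Fin m)) : Vec d :=
  scatterVec q.1 (cramerSol (sysMatrix S q.1 q.2) (sysRhs ν S q.2))

/-- All pairs of an `s`-tuple of coordinates and an `s`-tuple of examples. -/
def tuplePairs (d m s : ℕ) : List ((Fin s → Fin d) × (Fin s → Fin m)) :=
  (allTuples d s).flatMap fun I => (allTuples m s).map fun J => (I, J)

lemma mem_tuplePairs {m s : ℕ} (q : (Fin s → Fin d) × (Fin s → Fin m)) :
    q ∈ tuplePairs d m s := by
  simp only [tuplePairs, List.mem_flatMap, List.mem_map]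
  exact ⟨q.1, mem_allTuples _, q.2, mem_allTuples _, rfl⟩

lemma length_tuplePairs (m s : ℕ) : (tuplePairs d m s).length = d ^ s * m ^ s := by
  simp [tuplePairs, length_allTuples]

open Classical in
/-- The tuples with an invertible linear system. -/
def regularPairs (s : ℕ) {m : ℕ} (S : Fin m → LabeledPoint d) :
    List ((Fin s → Fin d) × (Fin s → Fin m)) :=
  (tuplePairs d m s).filter fun q => (Matrix.of (sysMatrix S q.1 q.2)).det ≠ 0

/-- The value of `sparseList`. -/
def sparseListVal (s : ℕ) {m : ℕ} (ν : ℝ) (S : Fin m → LabeledPoint d) : List (Vec d) :=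
  ((regularPairs s S).map (candidate ν S)).reverse

lemma length_sparseListVal_le (s : ℕ) {m : ℕ} (ν : ℝ) (S : Fin m → LabeledPoint d) :
    (sparseListVal s ν S).length ≤ d ^ s * m ^ s := by
  rw [sparseListVal, List.length_reverse, List.length_map, ← length_tuplePairs, regularPairs]
  exact List.length_filter_le _ _

/-- Prepending reverses the order, which is why `sparseListVal` contains a `reverse`. -/
lemma foldl_filter_cons {γ : Type} (l : List β) (p : β → Prop) [DecidablePred p] (f : β → γ)
    (L : List γ) :
    l.foldl (fun L x => if p x then L else f x :: L) L
      = ((l.filter fun x => ¬ p x).map f).reverse ++ L := by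
  induction l generalizing L with
  | nil => simp
  | cons b l ih =>
    rw [List.foldl_cons, ih]
    by_cases h : p b <;> simp [h]

/-- A bound for the number of steps of `sparseList`. -/
def sparseListCost (d s m : ℕ) : ℕ :=
  m * (d + 2) + d ^ s * (m ^ s * (s * (s * 2 + 1) + s * 2 + solveCost s + d + s + 1) + 1)

lemma exec_sparseList (s m : ℕ) (ν : ℝ) (ω : ℕ → LabeledPoint d) :
    Exec (sparseList s m ν) ω (sparseListVal s ν (first m ω)) m (sparseListCost d s m) := by
  classical
  unfold sparseList
  refine (Exec.bind (exec_mkArray_example1 m ω) (n' := 0)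
    (c' := d ^ s * (m ^ s * (s * (s * 2 + 1) + s * 2 + solveCost s + d + s + 1) + 1)) ?_).mono rfl
    (add_zero m) le_rfl
  generalize first m ω = S
  set C := s * (s * 2 + 1) + s * 2 + solveCost s + d + s with hC
  have hinner : ∀ (L : List (Vec d)) (I : Fin s → Fin d) (J : Fin s → Fin m), Det (do
      let A ← mkArray s fun a => mkArray s fun b => rMul (sgn (S (J a)).2) ((S (J a)).1 (I b))
      let rhs ← mkArray s fun a => rSub (sgn (S (J a)).2) ν
      let sol ← solve s A rhs
      match sol with
      | none => return L
      | some u => do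
          let w ← scatter I u
          return w :: L)
      (if (Matrix.of (sysMatrix S I J)).det = 0 then L else candidate ν S (I, J) :: L) C := by
    intro L I J
    apply Det.mono
    · apply Det.bind (Det.mkArray fun a => Det.mkArray fun b => det_rMul _ _)
      apply Det.bind (Det.mkArray fun a => det_rSub _ _)
      apply Det.bind (det_solve _ _ _)
      change Det _ (if (Matrix.of (sysMatrix S I J)).det = 0 then L else candidate ν S (I, J) :: L)
        (d + s)
      change Det (match (if (Matrix.of (sysMatrix S I J)).det = 0 then none else
        some (cramerSol (sysMatrix S I J) (sysRhs ν S J))) with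
        | none => Pure.pure L
        | some u => do
          let w ← scatter I u
          Pure.pure (w :: L)) _ _
      by_cases h : (Matrix.of (sysMatrix S I J)).det = 0
      · rw [if_pos h, if_pos h]
        exact (Det.pure L).mono rfl (by omega)
      · rw [if_neg h, if_neg h]
        exact Det.mono (Det.bind (det_scatter I _) (f := fun w => Pure.pure (w :: L)) (Det.pure _))
          rfl le_rfl
    · rfl
    · rw [hC]; exact le_of_eq (by ring)
  have houter := Det.forFold (l := allTuples d s) (d := d) (fun (L : List (Vec d)) I =>
    Det.forFold (l := allTuples m s) (fun L J => hinner L I J) L) []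
  refine (houter _).mono ?_ rfl (by rw [length_allTuples, length_allTuples])
  -- The nested loops over coordinates and examples are a single fold over `tuplePairs`.
  have h := List.foldl_flatMap (l := allTuples d s)
    (f := fun I => (allTuples m s).map fun J => (I, J))
    (g := fun (L : List (Vec d)) q => if (Matrix.of (sysMatrix S q.1 q.2)).det = 0 then L
      else candidate ν S q :: L) (init := [])
  simp only [List.foldl_map] at h
  rw [← h, foldl_filter_cons, List.append_nil]
  simp only [sparseListVal, regularPairs, tuplePairs]

/-! ### Projected stochastic gradient descent -/

lemma det_evalClassifier (c x : Vec d) : Det (evalClassifier c x) (classify c x) (d * 3 + 1) :=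
  Det.bind (det_dot c x) (det_rLe _ _)

/-- The value of `gradTerm`. -/
def gradVal (w x : Vec d) (y : Bool) : Vec d :=
  if y = true ∧ 0 ≤ x ⬝ᵥ w then fun j => x j - x ⬝ᵥ w / (w ⬝ᵥ w) * w j else 0

lemma det_gradTerm (w x : Vec d) (y : Bool) : Det (gradTerm w x y) (gradVal w x y) (d * 9 + 2) := by
  unfold gradTerm
  apply Det.mono
  · apply Det.bind (det_dot x w)
    apply Det.bind (det_rLe _ _)
    change Det _ (gradVal w x y) (d * 6 + 1)
    unfold gradVal
    by_cases h : y = true ∧ 0 ≤ x ⬝ᵥ w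
    · rw [if_pos h, if_pos (by simp [h.1, h.2])]
      apply Det.mono
      · apply Det.bind (det_dot w w)
        apply Det.bind (det_rDiv _ _)
        apply Det.mkArray (c := 2)
        intro j
        exact Det.bind (det_rMul _ _) (det_rSub _ _)
      · rfl
      · exact le_of_eq (by ring)
    · rw [if_neg h, if_neg (by simpa using h)]
      exact det_zeroVec.mono rfl (by omega)
  · rfl
  · omega

/-- The label given to `PSGD`: it marks the errors of `c`. -/
def mistake (c : Vec d) (z : LabeledPoint d) : Bool := classify c z.1 != z.2

lemma exec_relabel (c : Vec d) (ω : ℕ → LabeledPoint d) :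
    Exec (relabel c) ω ((ω 0).1, mistake c (ω 0)) 1 (d * 4 + 2) := by
  apply Exec.mono
  · apply Exec.bind (exec_example1 ω)
    apply Exec.bind (det_evalClassifier c _ _)
    exact Exec.ret _ _
  · rfl
  · rfl
  · omega

/-- The average gradient over a batch of examples. -/
def batchGrad {N : ℕ} (c w : Vec d) (b : Fin N → LabeledPoint d) : Vec d :=
  fun j => (∑ i, gradVal w (b i).1 (mistake c (b i)) j) / N

/-- The value of one iteration of `PSGD`. -/
def psgdUpdate {N : ℕ} (β : ℝ) (c w : Vec d) (b : Fin N → LabeledPoint d) : Vec d :=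
  fun j => (w j - β * batchGrad c w b j) /
    Real.sqrt ((fun j => w j - β * batchGrad c w b j) ⬝ᵥ (fun j => w j - β * batchGrad c w b j))

/-- A bound for the number of steps of `psgdStep`. -/
def stepCost (d N : ℕ) : ℕ := N * (d * 15 + 5) + d * 10 + 1

lemma streamFold_range_add {n : ℕ} {Z : Type*} (f : Z → Vec d) (k : ℕ) (a : Vec d) (ω : ℕ → Z) :
    streamFold 1 (fun acc (_ : ℕ) (ω : ℕ → Z) => fun j => acc j + f (ω 0) j) (List.range' k n) a ω
      = fun j => a j + ∑ i : Fin n, f (ω i) j := by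
  induction n generalizing a ω k with
  | zero => simp [streamFold]
  | succ n ih =>
    rw [List.range'_succ, streamFold, ih]
    funext j
    rw [Fin.sum_univ_succ, add_assoc]
    rfl

lemma exec_psgdStep (β : ℝ) (N : ℕ) (c w : Vec d) (ω : ℕ → LabeledPoint d) :
    Exec (psgdStep (relabel c) β N w) ω (psgdUpdate β c w (first N ω)) N (stepCost d N) := by
  unfold psgdStep
  apply Exec.mono
  · apply Det.exec_bind det_zeroVec
    apply Exec.bind
    · apply Exec.forFold (n := 1) (c := d * 15 + 4)
        (g := fun acc (_ : ℕ) ω => fun j => acc j + gradVal w (ω 0).1 (mistake c (ω 0)) j)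
      intro acc _ ω
      apply Exec.mono
      · apply Exec.bind (exec_relabel c ω)
        apply Det.exec_bind (det_gradTerm _ _ _)
        exact Det.mkArray (fun j => det_rAdd _ _) _
      · rfl
      · rfl
      · omega
    rw [List.range_eq_range', streamFold_range_add (n := N) fun z => gradVal w z.1 (mistake c z)]
    apply Det.exec_bind
    · apply Det.mkArray (c := 1 + (1 + 1))
      intro j
      apply Det.bind (det_rDiv _ _)
      apply Det.bind (det_rMul _ _)
      apply det_rSub
    apply Det.exec_bind (det_dot _ _)
    apply Det.exec_bind (det_rSqrt _)
    exact Det.mkArray (fun j => det_rDiv _ _) _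
  · simp only [Pi.zero_apply, zero_add]
    rfl
  · simp
  · rw [stepCost]
    simp only [List.length_range]
    exact le_of_eq (by ring)

/-- The iterates of `PSGD`. -/
def iterates (β : ℝ) (N : ℕ) (c : Vec d) : ℕ → Vec d → (ℕ → LabeledPoint d) → List (Vec d)
  | 0, _, _ => []
  | T + 1, w, ω =>
      psgdUpdate β c w (first N ω) :: iterates β N c T (psgdUpdate β c w (first N ω)) (shift N ω)

lemma exec_psgdLoop (β : ℝ) (N T : ℕ) (c w : Vec d) (ω : ℕ → LabeledPoint d) :
    Exec (psgdLoop (relabel c) β N T w) ω (iterates β N c T w ω) (T * N)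
      (T * (stepCost d N + 1)) := by
  induction T generalizing w ω with
  | zero => exact (Exec.ret _ _).mono rfl (by simp) (by simp)
  | succ T ih =>
    apply Exec.mono
    · apply Exec.tick
      apply Exec.bind (exec_psgdStep β N c w ω)
      apply Exec.bind (ih _ _)
      exact Exec.ret _ _
    · rfl
    · ring
    · exact le_of_eq (by ring)

/-- The step size of `PSGD`. -/
def stepSize (d T : ℕ) : ℝ := Real.sqrt (1 / ((T : ℝ) * d))

lemma exec_psgd (T N : ℕ) (c w : Vec d) (ω : ℕ → LabeledPoint d) :
    Exec (psgd (relabel c) T N w) ω (iterates (stepSize d T) N c T w ω) (T * N)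
      (T * (stepCost d N + 1) + 3) := by
  apply Exec.mono
  · apply Det.exec_bind (det_rMul _ _)
    apply Det.exec_bind (det_rDiv _ _)
    apply Det.exec_bind (det_rSqrt _)
    exact exec_psgdLoop _ N T c w ω
  · rfl
  · rfl
  · omega

/-! ### Conditional classification -/

open Classical in
/-- The value of `empError`. -/
def empErr {n : ℕ} (S : Fin n → LabeledPoint d) (c w : Vec d) : ℝ :=
  (∑ i, if (S i).1 ∈ halfspace w ∧ classify c (S i).1 ≠ (S i).2 then (1 : ℝ) else 0) / n

lemma det_empError {n : ℕ} (S : Fin n → LabeledPoint d) (c w : Vec d) :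
    Det (empError S c w) (empErr S c w) (n * (d * 6 + 4) + 1) := by
  classical
  unfold empError
  apply Det.mono
  · apply Det.bind
    · apply Det.forFold (c := d * 6 + 3) (g := fun acc i => acc +
        if (S i).1 ∈ halfspace w ∧ classify c (S i).1 ≠ (S i).2 then (1 : ℝ) else 0)
      intro acc i
      apply Det.mono
      · apply Det.bind (det_dot _ _)
        apply Det.bind (det_rLe _ _)
        apply Det.bind (det_evalClassifier _ _)
        change Det _ (acc +
          if (S i).1 ∈ halfspace w ∧ classify c (S i).1 ≠ (S i).2 then (1 : ℝ) else 0) 1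
        by_cases h : (S i).1 ∈ halfspace w ∧ classify c (S i).1 ≠ (S i).2
        · rw [if_pos h, if_pos (by
            have h1 : 0 ≤ (S i).1 ⬝ᵥ w := h.1
            simp [h1, h.2])]
          exact det_rAdd _ _
        · rw [if_neg h, if_neg (by
            intro h'
            simp only [Bool.and_eq_true, decide_eq_true_eq, bne_iff_ne] at h'
            exact h h')]
          exact (Det.pure _).mono (add_zero _).symm (by omega)
      · rfl
      · omega
    · apply det_rDiv
  · rw [foldl_add_eq_sum, zero_add, empErr]
  · simp

/-- The value of `numIterations`. -/
def numIterationsVal (d L : ℕ) (ε δ : ℝ) : ℕ :=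
  ⌈(4 * d + Real.log (8 * L / δ)) / (ε * ε * (ε * ε))⌉₊

/-- The value of `batchSize`. -/
def batchSizeVal (L T : ℕ) (ε δ : ℝ) : ℕ :=
  ⌈1600 * (Real.log (16 * T * L / δ) * Real.log (16 * T * L / δ)) / (ε * ε)⌉₊

/-- The value of `validationSize`. -/
def validationSizeVal (L T : ℕ) (ε δ : ℝ) : ℕ := ⌈Real.log (4 * L * T / δ) / (2 * ε)⌉₊

lemma det_numIterations (L : ℕ) (ε δ : ℝ) :
    Det (numIterations L ε δ : Prog d ℕ) (numIterationsVal d L ε δ)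
      (numIterationsVal d L ε δ + 9) := by
  apply Det.mono
  · apply Det.bind (det_rMul _ _)
    apply Det.bind (det_rDiv _ _)
    apply Det.bind (det_rLog _)
    apply Det.bind (det_rMul _ _)
    apply Det.bind (det_rAdd _ _)
    apply Det.bind (det_rMul _ _)
    apply Det.bind (det_rMul _ _)
    apply Det.bind (det_rDiv _ _)
    exact det_rCeil _
  · rfl
  · unfold numIterationsVal; omega

lemma det_batchSize (L T : ℕ) (ε δ : ℝ) :
    Det (batchSize L T ε δ : Prog d ℕ) (batchSizeVal L T ε δ) (batchSizeVal L T ε δ + 9) := by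
  apply Det.mono
  · apply Det.bind (det_rMul _ _)
    apply Det.bind (det_rMul _ _)
    apply Det.bind (det_rDiv _ _)
    apply Det.bind (det_rLog _)
    apply Det.bind (det_rMul _ _)
    apply Det.bind (det_rMul _ _)
    apply Det.bind (det_rMul _ _)
    apply Det.bind (det_rDiv _ _)
    exact det_rCeil _
  · rfl
  · unfold batchSizeVal; omega

lemma det_validationSize (L T : ℕ) (ε δ : ℝ) :
    Det (validationSize L T ε δ : Prog d ℕ) (validationSizeVal L T ε δ)
      (validationSizeVal L T ε δ + 7) := by
  apply Det.mono
  · apply Det.bind (det_rMul _ _)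
    apply Det.bind (det_rMul _ _)
    apply Det.bind (det_rDiv _ _)
    apply Det.bind (det_rLog _)
    apply Det.bind (det_rMul _ _)
    apply Det.bind (det_rDiv _ _)
    exact det_rCeil _
  · rfl
  · unfold validationSizeVal; omega

/-- The iterates of both runs of `PSGD`. -/
def bothIterates (T N : ℕ) (w₀ c : Vec d) (ω : ℕ → LabeledPoint d) : List (Vec d) :=
  iterates (stepSize d T) N c T w₀ ω ++ iterates (stepSize d T) N c T (-w₀) (shift (T * N) ω)

/-- One iteration of the loop of `ccfc`. -/
def selectorStep {n : ℕ} (S : Fin n → LabeledPoint d) (T N : ℕ) (w₀ : Vec d)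
    (acc : List (Vec d × Vec d)) (c : Vec d) (ω : ℕ → LabeledPoint d) : List (Vec d × Vec d) :=
  match argminVal (empErr S c) (bothIterates T N w₀ c ω) with
  | none => acc
  | some (w, _) => (c, w) :: acc

/-- The pairs `(c, w(c))` found by `ccfc`, for given parameters. -/
def selectorPairs {n : ℕ} (S : Fin n → LabeledPoint d) (T N : ℕ) (w₀ : Vec d) (C : List (Vec d))
    (ω : ℕ → LabeledPoint d) : List (Vec d × Vec d) :=
  streamFold (2 * (T * N)) (selectorStep S T N w₀) C [] ω

/-- The value of `ccfc`, for given parameters. -/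
def ccfcVal (T N n : ℕ) (w₀ : Vec d) (C : List (Vec d)) (ω : ℕ → LabeledPoint d) :
    Option (Vec d × Vec d) :=
  (argminVal (fun p => empErr (first n ω) p.1 p.2)
    (selectorPairs (first n ω) T N w₀ C (shift n ω))).map Prod.fst

lemma length_iterates (β : ℝ) (N T : ℕ) (c w : Vec d) (ω : ℕ → LabeledPoint d) :
    (iterates β N c T w ω).length = T := by
  induction T generalizing w ω with
  | zero => rfl
  | succ T ih => simp [iterates, ih]

lemma length_bothIterates (T N : ℕ) (w₀ c : Vec d) (ω : ℕ → LabeledPoint d) :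
    (bothIterates T N w₀ c ω).length = 2 * T := by
  simp [bothIterates, length_iterates]; ring

/-- A bound for the number of steps of one iteration of the loop of `ccfc`. -/
def selectorCost (d T N n : ℕ) : ℕ :=
  2 * (T * (stepCost d N + 1) + 3) + 2 * T * (n * (d * 6 + 4) + 3)

lemma exec_selectorStep {n : ℕ} (S : Fin n → LabeledPoint d) (T N : ℕ) (w₀ : Vec d)
    (acc : List (Vec d × Vec d)) (c : Vec d) (ω : ℕ → LabeledPoint d) :
    Exec (do
      let W₀ ← psgd (relabel c) T N w₀
      let W₁ ← psgd (relabel c) T N (-w₀)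
      let best ← argmin (empError S c) (W₀ ++ W₁)
      match best with
      | none => return acc
      | some (w, _) => return (c, w) :: acc) ω (selectorStep S T N w₀ acc c ω) (2 * (T * N))
      (selectorCost d T N n) := by
  apply Exec.mono
  · apply Exec.bind (exec_psgd T N c w₀ ω)
    apply Exec.bind (exec_psgd T N c (-w₀) _)
    apply Det.exec_bind (det_argmin (det_empError S c) _)
    change Exec _ _ (selectorStep S T N w₀ acc c ω) 0 0
    unfold selectorStep
    rw [← bothIterates]
    rcases argminVal (empErr S c) (bothIterates T N w₀ c ω) with _ | ⟨w, e⟩ <;> exact Exec.ret _ _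
  · rfl
  · ring
  · rw [← bothIterates, length_bothIterates, selectorCost]
    exact le_of_eq (by ring)

/-- The number of examples drawn by `ccfc`. -/
def ccfcSamples (L T N n : ℕ) : ℕ := n + L * (2 * (T * N))

/-- A bound for the number of steps of `ccfc`. -/
def ccfcCost (d L T N n : ℕ) : ℕ :=
  T + N + n + 25 + n * (d + 2) + d * 2 + L * (selectorCost d T N n + 1)
    + L * (n * (d * 6 + 4) + 3)

/-- An iteration adds no pair when there are no iterates, so without T > 0 only an inequality holds;
the cost bound needs no more. -/
lemma length_selectorPairs_le {n : ℕ} (S : Fin n → LabeledPoint d) (T N : ℕ) (w₀ : Vec d)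
    (C : List (Vec d)) (ω : ℕ → LabeledPoint d) :
    (selectorPairs S T N w₀ C ω).length ≤ C.length := by
  have key : ∀ (C : List (Vec d)) (init : List (Vec d × Vec d)) (ω : ℕ → LabeledPoint d),
      (streamFold (2 * (T * N)) (selectorStep S T N w₀) C init ω).length
        ≤ init.length + C.length := by
    intro C
    induction C with
    | nil => intro init ω; exact le_rfl
    | cons c C ih =>
      intro init ω
      refine (ih _ _).trans ?_
      have : (selectorStep S T N w₀ init c ω).length ≤ init.length + 1 := by
        unfold selectorStep
        split <;> simp
      simp only [List.length_cons]; omega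
  simpa [selectorPairs] using key C [] ω

lemma exec_ccfc (w₀ : Vec d) (C : List (Vec d)) (ε δ : ℝ) (ω : ℕ → LabeledPoint d) {T N n : ℕ}
    (hT : T = numIterationsVal d C.length ε δ) (hN : N = batchSizeVal C.length T ε δ)
    (hn : n = validationSizeVal C.length T ε δ) :
    Exec (ccfc w₀ C ε δ) ω (ccfcVal T N n w₀ C ω) (ccfcSamples C.length T N n)
      (ccfcCost d C.length T N n) := by
  unfold ccfc
  apply Exec.mono
  · apply Det.exec_bind (det_numIterations _ _ _)
    rw [← hT]
    apply Det.exec_bind (det_batchSize _ _ _ _)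
    rw [← hN]
    apply Det.exec_bind (det_validationSize _ _ _ _)
    rw [← hn]
    apply Exec.bind (exec_mkArray_example1 n ω)
    apply Det.exec_bind (Det.mkArray (v := -w₀) (c := 1) fun j => (det_rSub _ _).mono (by simp) le_rfl)
    apply Exec.bind
    · apply Exec.forFold
      intro acc c ω
      apply exec_selectorStep
    rw [← selectorPairs]
    apply Exec.bind
    · exact ((det_argmin (f := fun p : Vec d × Vec d => empErr (first n ω) p.1 p.2)
        (fun p => det_empError _ _ _) _) _).mono rfl rfl (Nat.mul_le_mul_right _
        (length_selectorPairs_le _ _ _ _ _ _))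
    · exact Exec.ret _ _
  · rfl
  · simp [ccfcSamples]
  · rw [ccfcCost, ← hT, ← hN, ← hn]
    exact le_of_eq (by ring)

end Prog

end

/-! ### Polynomial bounds for samples and steps. -/

section

open Prog

lemma exec_ccslc {d : ℕ} (s m : ℕ) (ν : ℝ) (w₀ : Vec d) (ε δ : ℝ) (ω : ℕ → LabeledPoint d)
    {L T N n : ℕ} (hL : L = (sparseListVal s ν (first m ω)).length)
    (hT : T = numIterationsVal d L ε δ) (hN : N = batchSizeVal L T ε δ)
    (hn : n = validationSizeVal L T ε δ) :
    Exec (ccslc s m ν w₀ ε δ) ω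
      (ccfcVal T N n w₀ (sparseListVal s ν (first m ω)) (shift m ω))
      (m + ccfcSamples L T N n) (sparseListCost d s m + ccfcCost d L T N n) := by
  subst hL
  exact (exec_sparseList s m ν ω).bind (exec_ccfc w₀ _ ε δ _ hT hN hn)

/-! ### Polynomially bounded functions -/

/-- `f d ε δ` is nonnegative and at most a power of `d · 1/ε · 1/δ`. -/
def PolyBdd (f : ℕ → ℝ → ℝ → ℝ) : Prop :=
  ∃ k : ℕ, ∀ (d : ℕ) (ε δ : ℝ), 1 ≤ d → 0 < ε → ε ≤ 1 / 2 → 0 < δ → δ < 1 →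
    0 ≤ f d ε δ ∧ f d ε δ ≤ (d * (1 / ε) * (1 / δ)) ^ k

/-- A base of at least 2, obtained from ε ≤ 1/2, lets constants and sums be absorbed into the
exponent. -/
lemma two_le_base {d : ℕ} {ε δ : ℝ} (hd : 1 ≤ d) (hε : 0 < ε) (hε' : ε ≤ 1 / 2) (hδ : 0 < δ)
    (hδ' : δ < 1) : (2 : ℝ) ≤ d * (1 / ε) * (1 / δ) ∧ (d : ℝ) ≤ d * (1 / ε) * (1 / δ) ∧
      1 / ε ≤ d * (1 / ε) * (1 / δ) ∧ 1 / δ ≤ d * (1 / ε) * (1 / δ) := by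
  have h1 : (1 : ℝ) ≤ d := by exact_mod_cast hd
  have h2 : (2 : ℝ) ≤ 1 / ε := by rw [le_div_iff₀ hε]; linarith
  have h3 : (1 : ℝ) ≤ 1 / δ := by rw [le_div_iff₀ hδ]; linarith
  have h4 : (1 / ε : ℝ) ≤ d * (1 / ε) := le_mul_of_one_le_left (by linarith) h1
  have h5 : (d : ℝ) ≤ d * (1 / ε) := le_mul_of_one_le_right (by linarith) (by linarith)
  have h6 : (d * (1 / ε) : ℝ) ≤ d * (1 / ε) * (1 / δ) := le_mul_of_one_le_right (by linarith) h3
  exact ⟨by linarith, by linarith, by linarith,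
    le_mul_of_one_le_left (by linarith) (by linarith)⟩

namespace PolyBdd

variable {f g : ℕ → ℝ → ℝ → ℝ}

lemma mono (hg : PolyBdd g) (h : ∀ (d : ℕ) (ε δ : ℝ), 1 ≤ d → 0 < ε → ε ≤ 1 / 2 → 0 < δ → δ < 1 →
    0 ≤ f d ε δ ∧ f d ε δ ≤ g d ε δ) : PolyBdd f := by
  obtain ⟨k, hk⟩ := hg
  exact ⟨k, fun d ε δ hd hε hε' hδ hδ' => ⟨(h d ε δ hd hε hε' hδ hδ').1,
    (h d ε δ hd hε hε' hδ hδ').2.trans (hk d ε δ hd hε hε' hδ hδ').2⟩⟩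

lemma add (hf : PolyBdd f) (hg : PolyBdd g) : PolyBdd fun d ε δ => f d ε δ + g d ε δ := by
  obtain ⟨k, hk⟩ := hf
  obtain ⟨l, hl⟩ := hg
  refine ⟨k + l + 1, fun d ε δ hd hε hε' hδ hδ' => ?_⟩
  obtain ⟨h1, h2⟩ := hk d ε δ hd hε hε' hδ hδ'
  obtain ⟨h3, h4⟩ := hl d ε δ hd hε hε' hδ hδ'
  have hX := (two_le_base hd hε hε' hδ hδ').1
  set X := (d : ℝ) * (1 / ε) * (1 / δ)
  have h5 : X ^ k ≤ X ^ (k + l) := pow_le_pow_right₀ (by linarith) (by omega)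
  have h6 : X ^ l ≤ X ^ (k + l) := pow_le_pow_right₀ (by linarith) (by omega)
  have h7 : 2 * X ^ (k + l) ≤ X ^ (k + l + 1) := by
    rw [pow_succ, mul_comm]
    exact mul_le_mul_of_nonneg_left hX (by positivity)
  exact ⟨by linarith, by linarith⟩

lemma mul (hf : PolyBdd f) (hg : PolyBdd g) : PolyBdd fun d ε δ => f d ε δ * g d ε δ := by
  obtain ⟨k, hk⟩ := hf
  obtain ⟨l, hl⟩ := hg
  refine ⟨k + l, fun d ε δ hd hε hε' hδ hδ' => ?_⟩
  obtain ⟨h1, h2⟩ := hk d ε δ hd hε hε' hδ hδ'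
  obtain ⟨h3, h4⟩ := hl d ε δ hd hε hε' hδ hδ'
  exact ⟨mul_nonneg h1 h3, by rw [pow_add]; exact mul_le_mul h2 h4 h3 (h1.trans h2)⟩

lemma const {c : ℝ} (hc : 0 ≤ c) : PolyBdd fun _ _ _ => c := by
  obtain ⟨k, hk⟩ := pow_unbounded_of_one_lt c (one_lt_two : (1 : ℝ) < 2)
  exact ⟨k, fun d ε δ hd hε hε' hδ hδ' => ⟨hc, hk.le.trans
    (pow_le_pow_left₀ zero_le_two (two_le_base hd hε hε' hδ hδ').1 k)⟩⟩

lemma pow (hf : PolyBdd f) (k : ℕ) : PolyBdd fun d ε δ => f d ε δ ^ k := by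
  induction k with
  | zero => simpa using const zero_le_one
  | succ k ih => simpa only [pow_succ] using ih.mul hf

lemma dim : PolyBdd fun d _ _ => (d : ℝ) :=
  ⟨1, fun d ε δ hd hε hε' hδ hδ' => ⟨by positivity, by
    rw [pow_one]; exact (two_le_base hd hε hε' hδ hδ').2.1⟩⟩

lemma inv_eps : PolyBdd fun _ ε _ => 1 / ε :=
  ⟨1, fun d ε δ hd hε hε' hδ hδ' => ⟨by positivity, by
    rw [pow_one]; exact (two_le_base hd hε hε' hδ hδ').2.2.1⟩⟩

lemma inv_delta : PolyBdd fun _ _ δ => 1 / δ :=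
  ⟨1, fun d ε δ hd hε hε' hδ hδ' => ⟨by positivity, by
    rw [pow_one]; exact (two_le_base hd hε hε' hδ hδ').2.2.2⟩⟩

lemma ceil (hf : PolyBdd f) : PolyBdd fun d ε δ => (⌈f d ε δ⌉₊ : ℝ) := by
  refine (hf.add (const zero_le_one)).mono fun d ε δ hd hε hε' hδ hδ' => ⟨by positivity, ?_⟩
  obtain ⟨k, hk⟩ := hf
  exact (Nat.ceil_lt_add_one (hk d ε δ hd hε hε' hδ hδ').1).le

end PolyBdd

/-- The case x = 0 covers an empty list, where `Real.log 0 = 0` makes both bounds trivial. -/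
lemma log_natCast_div_le {x δ : ℝ} (hx : x = 0 ∨ 1 ≤ x) (hδ : 0 < δ) (hδ' : δ < 1) :
    0 ≤ Real.log (x / δ) ∧ Real.log (x / δ) ≤ x * (1 / δ) := by
  rcases hx with rfl | hx
  · simp
  · have h : 1 ≤ x / δ := by rw [le_div_iff₀ hδ]; linarith
    refine ⟨Real.log_nonneg h, ?_⟩
    rw [mul_one_div]
    linarith [Real.log_le_sub_one_of_pos (by linarith : 0 < x / δ)]

/-- An upper bound for the length of the list. -/
def lengthBd (a : ℝ) (s d : ℕ) (ε δ : ℝ) : ℕ := d ^ s * listSampleSize a s d ε δ ^ s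

/-- An upper bound for the number of iterations. -/
def iterBd (a : ℝ) (s d : ℕ) (ε δ : ℝ) : ℕ :=
  ⌈(4 * d + 8 * lengthBd a s d ε δ * (1 / δ)) * ((1 / ε) ^ 4)⌉₊

/-- An upper bound for the batch size. -/
def batchBd (a : ℝ) (s d : ℕ) (ε δ : ℝ) : ℕ :=
  ⌈1600 * (16 * iterBd a s d ε δ * lengthBd a s d ε δ * (1 / δ)) ^ 2 * (1 / ε) ^ 2⌉₊

/-- An upper bound for the size of the validation sample. -/
def validBd (a : ℝ) (s d : ℕ) (ε δ : ℝ) : ℕ :=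
  ⌈4 * lengthBd a s d ε δ * iterBd a s d ε δ * (1 / δ) * (1 / ε)⌉₊

section bounds

variable {a : ℝ} {s d : ℕ} {ε δ : ℝ}

lemma numIterationsVal_le {L : ℕ} (hL : L ≤ lengthBd a s d ε δ) (hδ : 0 < δ) (hδ' : δ < 1) :
    numIterationsVal d L ε δ ≤ iterBd a s d ε δ := by
  refine Nat.ceil_mono ?_
  have hL' : (L : ℝ) ≤ lengthBd a s d ε δ := by exact_mod_cast hL
  have h8 : (8 * L : ℝ) = 0 ∨ (1 : ℝ) ≤ 8 * L := by
    rcases Nat.eq_zero_or_pos L with rfl | h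
    · simp
    · right
      have : (1 : ℝ) ≤ L := by exact_mod_cast h
      linarith
  have h := (log_natCast_div_le h8 hδ hδ').2
  have h2 : 8 * (L : ℝ) * (1 / δ) ≤ 8 * lengthBd a s d ε δ * (1 / δ) := by gcongr
  rw [div_eq_mul_one_div, show 1 / (ε * ε * (ε * ε)) = (1 / ε) ^ 4 by rw [div_pow, one_pow]; ring_nf]
  exact mul_le_mul_of_nonneg_right (by linarith) (by positivity)

lemma batchSizeVal_le {L T : ℕ} (hL : L ≤ lengthBd a s d ε δ) (hT : T ≤ iterBd a s d ε δ)
    (hδ : 0 < δ) (hδ' : δ < 1) : batchSizeVal L T ε δ ≤ batchBd a s d ε δ := by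
  refine Nat.ceil_mono ?_
  have hL' : (L : ℝ) ≤ lengthBd a s d ε δ := by exact_mod_cast hL
  have hT' : (T : ℝ) ≤ iterBd a s d ε δ := by exact_mod_cast hT
  have h8 : (16 * T * L : ℝ) = 0 ∨ (1 : ℝ) ≤ 16 * T * L := by
    rcases Nat.eq_zero_or_pos (16 * T * L) with h | h
    · left; exact_mod_cast h
    · right; exact_mod_cast h
  obtain ⟨h0, h⟩ := log_natCast_div_le h8 hδ hδ'
  have h2 : 16 * (T : ℝ) * L * (1 / δ) ≤
    16 * iterBd a s d ε δ * lengthBd a s d ε δ * (1 / δ) := by gcongr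
  have h3 := h.trans h2
  rw [div_eq_mul_one_div, show 1 / (ε * ε) = (1 / ε) ^ 2 by rw [div_pow, one_pow]; ring_nf, ← sq]
  gcongr

lemma validationSizeVal_le {L T : ℕ} (hL : L ≤ lengthBd a s d ε δ) (hT : T ≤ iterBd a s d ε δ)
    (hε : 0 < ε) (hδ : 0 < δ) (hδ' : δ < 1) : validationSizeVal L T ε δ ≤ validBd a s d ε δ := by
  refine Nat.ceil_mono ?_
  have hL' : (L : ℝ) ≤ lengthBd a s d ε δ := by exact_mod_cast hL
  have hT' : (T : ℝ) ≤ iterBd a s d ε δ := by exact_mod_cast hT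
  have h8 : (4 * L * T : ℝ) = 0 ∨ (1 : ℝ) ≤ 4 * L * T := by
    rcases Nat.eq_zero_or_pos (4 * L * T) with h | h
    · left; exact_mod_cast h
    · right; exact_mod_cast h
  obtain ⟨h0, h⟩ := log_natCast_div_le h8 hδ hδ'
  have h2 : 4 * (L : ℝ) * T * (1 / δ) ≤
    4 * lengthBd a s d ε δ * iterBd a s d ε δ * (1 / δ) := by gcongr
  rw [div_eq_mul_one_div]
  have h4 : 1 / (2 * ε) ≤ 1 / ε := one_div_le_one_div_of_le hε (by linarith)
  exact mul_le_mul (h.trans h2) h4 (by positivity) (by positivity)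

end bounds

lemma polyBdd_sampleSize {a : ℝ} (ha : 0 ≤ a) (s : ℕ) :
    PolyBdd fun d ε δ => (listSampleSize a s d ε δ : ℝ) := by
  refine PolyBdd.mono (g := fun d ε δ => (⌈a * (s * d + 1 / δ + 1) * (1 / ε) * (1 / ε)⌉₊ : ℝ))
    (PolyBdd.ceil ?_) fun d ε δ hd hε hε' hδ hδ' => ⟨by positivity, ?_⟩
  · exact ((((PolyBdd.const ha).mul ((((PolyBdd.const s.cast_nonneg).mul .dim).add .inv_delta).add
      (.const zero_le_one))).mul .inv_eps).mul .inv_eps)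
  · refine Nat.cast_le.2 (Nat.ceil_mono ?_)
    have h1 : (1 : ℝ) ≤ d := by exact_mod_cast hd
    have h2 : (1 : ℝ) ≤ 1 / ε := by rw [le_div_iff₀ hε]; linarith
    have h3 : (1 : ℝ) ≤ 1 / δ := by rw [le_div_iff₀ hδ]; linarith
    have l1 : Real.log d ≤ d := by linarith [Real.log_le_sub_one_of_pos (by linarith : (0 : ℝ) < d)]
    have l2 : Real.log (1 / ε) ≤ 1 / ε := by
      linarith [Real.log_le_sub_one_of_pos (by linarith : (0 : ℝ) < 1 / ε)]
    have l3 : Real.log (1 / δ) ≤ 1 / δ := by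
      linarith [Real.log_le_sub_one_of_pos (by linarith : (0 : ℝ) < 1 / δ)]
    have m1 := Real.log_nonneg h1
    have m2 := Real.log_nonneg h2
    have m3 := Real.log_nonneg h3
    rw [div_eq_mul_one_div]
    gcongr

/-- The algorithm draws polynomially many examples and makes polynomially many steps. -/
theorem exists_polynomial_cost {a : ℝ} (ha : 0 ≤ a) (s : ℕ) :
    ∃ K₀ : ℕ, ∀ K : ℕ, K₀ ≤ K → ∀ (d : ℕ) (ε δ : ℝ), 1 ≤ d → 0 < ε → ε ≤ 1 / 2 → 0 < δ → δ < 1 →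
      ∀ (ν : ℝ) (w₀ : Vec d) (ω : ℕ → LabeledPoint d),
        (((ccslc s (listSampleSize a s d ε δ) ν w₀ ε δ).run ω).samples : ℝ)
          ≤ K * (d * (1 / ε) * (1 / δ)) ^ K ∧
        (((ccslc s (listSampleSize a s d ε δ) ν w₀ ε δ).run ω).steps : ℝ)
          ≤ K * (d * (1 / ε) * (1 / δ)) ^ K := by
  have hm := polyBdd_sampleSize ha s
  have hL : PolyBdd fun d ε δ => (lengthBd a s d ε δ : ℝ) := by
    simp only [lengthBd, Nat.cast_mul, Nat.cast_pow]
    exact (PolyBdd.dim.pow s).mul (hm.pow s)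
  have hT : PolyBdd fun d ε δ => (iterBd a s d ε δ : ℝ) :=
    PolyBdd.ceil ((((PolyBdd.const zero_le_four).mul .dim).add
      (((PolyBdd.const (by norm_num)).mul hL).mul .inv_delta)).mul (PolyBdd.inv_eps.pow 4))
  have hN : PolyBdd fun d ε δ => (batchBd a s d ε δ : ℝ) :=
    PolyBdd.ceil (((PolyBdd.const (by norm_num)).mul (((((PolyBdd.const (by norm_num)).mul hT).mul
      hL).mul .inv_delta).pow 2)).mul (PolyBdd.inv_eps.pow 2))
  have hn : PolyBdd fun d ε δ => (validBd a s d ε δ : ℝ) :=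
    PolyBdd.ceil (((((PolyBdd.const (by norm_num)).mul hL).mul hT).mul .inv_delta).mul .inv_eps)
  have hs : PolyBdd fun d ε δ => ((listSampleSize a s d ε δ + ccfcSamples (lengthBd a s d ε δ)
      (iterBd a s d ε δ) (batchBd a s d ε δ) (validBd a s d ε δ) : ℕ) : ℝ) := by
    simp only [ccfcSamples, Nat.cast_add, Nat.cast_mul, Nat.cast_ofNat]
    repeat first
      | exact hm | exact hL | exact hT | exact hN | exact hn | exact PolyBdd.dim
      | exact PolyBdd.const (by positivity) | apply PolyBdd.add | apply PolyBdd.mul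
  have hc : PolyBdd fun d ε δ => ((sparseListCost d s (listSampleSize a s d ε δ) +
      ccfcCost d (lengthBd a s d ε δ) (iterBd a s d ε δ) (batchBd a s d ε δ)
        (validBd a s d ε δ) : ℕ) : ℝ) := by
    simp only [sparseListCost, ccfcCost, selectorCost, stepCost, Nat.cast_add, Nat.cast_mul,
      Nat.cast_ofNat, Nat.cast_pow]
    repeat first
      | exact hm | exact hL | exact hT | exact hN | exact hn | exact PolyBdd.dim
      | exact PolyBdd.const (by positivity) | apply PolyBdd.add | apply PolyBdd.mul
      | apply PolyBdd.pow
  obtain ⟨k₁, hk₁⟩ := hs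
  obtain ⟨k₂, hk₂⟩ := hc
  -- Every larger K works as well, so that K can later also serve the error bound; the summand 1
  -- ensures K ≥ 1.
  refine ⟨k₁ + k₂ + 1, fun K hK d ε δ hd hε hε' hδ hδ' ν w₀ ω => ?_⟩
  have hex := exec_ccslc s (listSampleSize a s d ε δ) ν w₀ ε δ ω rfl rfl rfl rfl
  -- The cost formulas are monotone in L, T, N and n, so the actual parameters may be replaced by
  -- their upper bounds.
  have hLle : (sparseListVal s ν (first (listSampleSize a s d ε δ) ω)).length
    ≤ lengthBd a s d ε δ := length_sparseListVal_le s ν _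
  have hTle := numIterationsVal_le (d := d) (ε := ε) hLle hδ hδ'
  have hNle := batchSizeVal_le hLle hTle hδ hδ'
  have hnle := validationSizeVal_le hLle hTle hε hδ hδ'
  have h2 := (two_le_base hd hε hε' hδ hδ').1
  have hX : ∀ k, k ≤ k₁ + k₂ → ((d : ℝ) * (1 / ε) * (1 / δ)) ^ k
      ≤ K * ((d : ℝ) * (1 / ε) * (1 / δ)) ^ K := fun k hk => by
    have hK1 : (1 : ℝ) ≤ K := by exact_mod_cast (by omega : 1 ≤ K)
    exact (pow_le_pow_right₀ (by linarith) (by omega)).trans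
      (le_mul_of_one_le_left (by positivity) hK1)
  constructor
  · rw [hex.samples]
    refine le_trans (Nat.cast_le.2 ?_)
      ((hk₁ d ε δ hd hε hε' hδ hδ').2.trans (hX k₁ (by omega)))
    simp only [ccfcSamples]
    gcongr
  · refine le_trans (Nat.cast_le.2 (hex.steps.trans ?_))
      ((hk₂ d ε δ hd hε hε' hδ hδ').2.trans (hX k₂ (by omega)))
    simp only [ccfcCost, selectorCost, stepCost]
    gcongr

end

/-! ### Independent streams, Chernoff bounds and sample compression. -/

section

open scoped ENNReal

section streams

variable {Z : Type*} [MeasurableSpace Z]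

lemma measurable_first (n : ℕ) : Measurable (first n : (ℕ → Z) → Fin n → Z) :=
  measurable_pi_lambda _ fun _ => measurable_pi_apply _

lemma measurable_shift (n : ℕ) : Measurable (shift n : (ℕ → Z) → ℕ → Z) :=
  measurable_pi_lambda _ fun _ => measurable_pi_apply _

variable (D : Measure Z) [IsProbabilityMeasure D]

/-- An i.i.d. stream splits into its first `n` entries and an independent i.i.d. stream. -/
lemma measurePreserving_split (n : ℕ) :
    MeasurePreserving (fun ω : ℕ → Z => (first n ω, shift n ω))
      (Measure.infinitePi fun _ : ℕ => D)
      ((Measure.pi fun _ : Fin n => D).prod (Measure.infinitePi fun _ : ℕ => D)) := by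
  classical
  set P := Measure.infinitePi fun _ : ℕ => D
  -- `comb` glues a block to a stream. Splitting after gluing is the identity, so it is enough that
  -- gluing carries the product measure to the stream measure; this is checked on cylinders.
  set comb : (Fin n → Z) × (ℕ → Z) → ℕ → Z :=
    fun p i => if h : i < n then p.1 ⟨i, h⟩ else p.2 (i - n)
  have hcomb : Measurable comb := by
    refine measurable_pi_lambda _ fun i => ?_
    by_cases h : i < n
    · simp only [comb, h, dif_pos]; fun_prop
    · simp only [comb, h, dite_false]; fun_prop
  have hmap : ((Measure.pi fun _ : Fin n => D).prod P).map comb = P := by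
    refine Measure.eq_infinitePi _ fun s t ht => ?_
    obtain ⟨k, hk⟩ : ∃ k, s ⊆ Finset.range (n + k) := by
      obtain ⟨k, hk⟩ := s.exists_nat_subset_range
      exact ⟨k, hk.trans (Finset.range_mono (by omega))⟩
    -- With the whole space put in at the coordinates outside `s`, the cylinder is indexed by an
    -- initial segment of length n + k, which splits at n.
    set t' : ℕ → Set Z := fun i => if i ∈ s then t i else Set.univ with ht'def
    have ht' : ∀ i, MeasurableSet (t' i) := fun i => by
      by_cases h : i ∈ s <;> simp [t', h, ht]
    have hpre : comb ⁻¹' (Set.pi s t) =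
        (Set.univ.pi fun j : Fin n => t' j) ×ˢ
          (Set.pi (Finset.range k : Set ℕ) fun i => t' (n + i)) := by
      ext ⟨x, y⟩
      simp only [Set.mem_preimage, Set.mem_pi, Finset.mem_coe, Set.mem_prod, Set.mem_univ,
        forall_true_left, Finset.mem_range]
      constructor
      · intro h
        refine ⟨fun j => ?_, fun i _ => ?_⟩
        · by_cases hj : (j : ℕ) ∈ s
          · have := h j hj
            simpa [t', hj, comb] using this
          · simp [t', hj]
        · by_cases hj : n + i ∈ s
          · have := h _ hj
            simpa [t', hj, comb] using this
          · simp [t', hj]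
      · rintro ⟨h1, h2⟩ i hi
        by_cases hin : i < n
        · have := h1 ⟨i, hin⟩
          simpa [t', hi, comb, hin] using this
        · have hik := Finset.mem_range.1 (hk hi)
          have := h2 (i - n) (by omega)
          rw [show n + (i - n) = i by omega] at this
          simpa [t', hi, comb, hin] using this
    rw [Measure.map_apply hcomb (.pi s.countable_toSet fun i _ => ht i), hpre, Measure.prod_prod,
      Measure.pi_pi, Measure.infinitePi_pi _ fun i _ => ht' _,
      Fin.prod_univ_eq_prod_range (fun i => D (t' i)) n, ← Finset.prod_range_add
        (fun i => D (t' i)), ← Finset.prod_subset hk]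
    · exact Finset.prod_congr rfl fun i hi => by simp [t', hi]
    · intro i _ hi
      simp [t', hi]
  have hsplit : Measurable (fun ω : ℕ → Z => (first n ω, shift n ω)) :=
    (measurable_first n).prodMk (measurable_shift n)
  refine ⟨hsplit, ?_⟩
  conv_lhs => rw [← hmap]
  rw [Measure.map_map hsplit hcomb]
  have : (fun ω : ℕ → Z => (first n ω, shift n ω)) ∘ comb = id := by
    funext p
    refine Prod.ext (funext fun i => ?_) (funext fun i => ?_)
    · simp [first, comb]
    · simp [shift, comb]
  rw [this, Measure.map_id]

variable {D}

/-- Fubini with the first block frozen: used when the block determines the list or the iterate with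
which the independent rest is processed. -/
lemma stream_le_of_forall_first {n : ℕ} {E : Set ((Fin n → Z) × (ℕ → Z))} (hE : MeasurableSet E)
    {r : ℝ≥0∞} (h : ∀ S, Measure.infinitePi (fun _ : ℕ => D) {ω | (S, ω) ∈ E} ≤ r) :
    Measure.infinitePi (fun _ : ℕ => D) {ω | (first n ω, shift n ω) ∈ E} ≤ r := by
  have := (measurePreserving_split D n).measure_preimage hE.nullMeasurableSet
  refine (le_of_eq this).trans ?_
  rw [Measure.prod_apply hE]
  refine (lintegral_mono h).trans ?_
  simp

/-- Fubini with the tail frozen: used for the validation sample, which is read first but judged on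
iterates computed from later examples. -/
lemma stream_le_of_forall_shift {n : ℕ} {E : Set ((Fin n → Z) × (ℕ → Z))} (hE : MeasurableSet E)
    {r : ℝ≥0∞} (h : ∀ ω, Measure.pi (fun _ : Fin n => D) {S | (S, ω) ∈ E} ≤ r) :
    Measure.infinitePi (fun _ : ℕ => D) {ω | (first n ω, shift n ω) ∈ E} ≤ r := by
  have := (measurePreserving_split D n).measure_preimage hE.nullMeasurableSet
  refine (le_of_eq this).trans ?_
  rw [Measure.prod_apply_symm hE]
  refine (lintegral_mono h).trans ?_
  simp

lemma stream_first_le {n : ℕ} {E : Set (Fin n → Z)} (hE : MeasurableSet E) :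
    Measure.infinitePi (fun _ : ℕ => D) {ω | first n ω ∈ E} ≤ Measure.pi (fun _ : Fin n => D) E := by
  refine stream_le_of_forall_shift (D := D) (n := n) (E := E ×ˢ Set.univ) (hE.prod .univ) (fun ω => ?_)
    |>.trans' ?_
  · simp
  · simp

lemma stream_shift_le {n : ℕ} {E : Set (ℕ → Z)} (hE : MeasurableSet E) :
    Measure.infinitePi (fun _ : ℕ => D) {ω | shift n ω ∈ E} ≤
      Measure.infinitePi (fun _ : ℕ => D) E := by
  refine stream_le_of_forall_first (D := D) (n := n) (E := Set.univ ×ˢ E) (MeasurableSet.univ.prod hE)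
    (fun ω => ?_) |>.trans' ?_
  · simp
  · simp

/-- Chernoff's bound for sums of independent identically distributed random variables. -/
lemma pi_sum_ge_le {n : ℕ} {g : Z → ℝ} (hg : Measurable g) {M : ℝ}
    (hM : ∫⁻ z, ENNReal.ofReal (Real.exp (g z)) ∂D ≤ ENNReal.ofReal (Real.exp M)) (t : ℝ) :
    Measure.pi (fun _ : Fin n => D) {b | t ≤ ∑ i, g (b i)} ≤
      ENNReal.ofReal (Real.exp (n * M - t)) := by
  set f : Z → ℝ≥0∞ := fun z => ENNReal.ofReal (Real.exp (g z))
  have hf : Measurable f := by fun_prop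
  have hind : iIndepFun (fun (i : Fin n) (b : Fin n → Z) => f (b i))
      (Measure.pi fun _ : Fin n => D) :=
    iIndepFun_pi (X := fun _ => f) fun i => hf.aemeasurable
  have hprod : ∫⁻ b, ∏ i, f (b i) ∂(Measure.pi fun _ : Fin n => D) = (∫⁻ z, f z ∂D) ^ n := by
    rw [lintegral_prod_eq_prod_lintegral_of_indepFun Finset.univ _ hind
      fun i => hf.comp (measurable_pi_apply i)]
    have : ∀ i : Fin n, ∫⁻ b, f (b i) ∂(Measure.pi fun _ : Fin n => D) = ∫⁻ z, f z ∂D := fun i =>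
      (measurePreserving_eval (fun _ : Fin n => D) i).lintegral_comp hf
    simp [this]
  have hsub : {b : Fin n → Z | t ≤ ∑ i, g (b i)} ⊆
      {b | ENNReal.ofReal (Real.exp t) ≤ ∏ i, f (b i)} := fun b hb => by
    simp only [Set.mem_ofPred_eq, f] at hb ⊢
    rw [← ENNReal.ofReal_prod_of_nonneg fun i _ => (Real.exp_pos _).le, ← Real.exp_sum]
    exact ENNReal.ofReal_le_ofReal (Real.exp_le_exp.2 hb)
  refine (measure_mono hsub).trans ((meas_ge_le_lintegral_div
    (f := fun b : Fin n → Z => ∏ i, f (b i))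
    (Finset.measurable_prod _ fun i _ => hf.comp (measurable_pi_apply i)).aemeasurable
    (by simpa using Real.exp_pos t) ENNReal.ofReal_ne_top).trans ?_)
  rw [hprod]
  refine (ENNReal.div_le_div_right (pow_le_pow_left' hM n) _).trans ?_
  rw [← ENNReal.ofReal_pow (Real.exp_pos _).le, ← ENNReal.ofReal_div_of_pos (Real.exp_pos _),
    ← Real.exp_nat_mul, ← Real.exp_sub]

/-- The examples outside of a compression set are independent of it. -/
lemma pi_compression_le {m s : ℕ} (J : Fin s → Fin m) {B : Set ((Fin s → Z) × Z)}
    (hB : MeasurableSet B) {q : ℝ≥0∞} (hq : q ≤ 1) :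
    Measure.pi (fun _ : Fin m => D) {S | D {z | (S ∘ J, z) ∈ B} ≤ q ∧
      ∀ j, j ∉ Set.range J → (S ∘ J, S j) ∈ B} ≤ q ^ (m - s) := by
  classical
  -- Given the examples indexed by the range of `J`, the section of `B` is a fixed set. It has mass
  -- at most q, or else the event is empty. The remaining examples are independent of it, and there
  -- are at least m - s of them, also when `J` repeats indices.
  set p : Fin m → Prop := fun j => j ∈ Set.range J
  have hmp := measurePreserving_piEquivPiSubtypeProd (fun _ : Fin m => D) p
  set restr : ({j // p j} → Z) → (Fin s → Z) := fun x a => x ⟨J a, a, rfl⟩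
  have hrestr : Measurable restr := measurable_pi_lambda _ fun a => measurable_pi_apply _
  set E : Set (({j // p j} → Z) × ({j // ¬ p j} → Z)) := {x | D {z | (restr x.1, z) ∈ B} ≤ q ∧
    ∀ j, (restr x.1, x.2 j) ∈ B}
  have hE : MeasurableSet E := by
    have h1 : MeasurableSet {x : ({j // p j} → Z) × ({j // ¬ p j} → Z) |
        D {z | (restr x.1, z) ∈ B} ≤ q} :=
      measurableSet_le (((measurable_measure_prodMk_left hB).comp hrestr).comp measurable_fst)
        measurable_const
    have h2 : MeasurableSet {x : ({j // p j} → Z) × ({j // ¬ p j} → Z) |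
        ∀ j, (restr x.1, x.2 j) ∈ B} := by
      rw [Set.ofPred_forall]
      exact MeasurableSet.iInter fun j => ((hrestr.comp measurable_fst).prodMk
        ((measurable_pi_apply j).comp measurable_snd)) hB
    exact h1.inter h2
  have hpre : {S : Fin m → Z | D {z | (S ∘ J, z) ∈ B} ≤ q ∧
      ∀ j, j ∉ Set.range J → (S ∘ J, S j) ∈ B} =
      MeasurableEquiv.piEquivPiSubtypeProd (fun _ : Fin m => Z) p ⁻¹' E := by
    ext S
    have : restr ((MeasurableEquiv.piEquivPiSubtypeProd (fun _ : Fin m => Z) p) S).1 = S ∘ J := rfl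
    simp only [E, Set.mem_preimage, Set.mem_ofPred_eq, this]
    refine and_congr_right fun _ => ⟨fun h j => h j.1 j.2, fun h j hj => h ⟨j, hj⟩⟩
  rw [hpre, hmp.measure_preimage hE.nullMeasurableSet, Measure.prod_apply hE]
  have hcard : m - s ≤ Fintype.card {j // ¬ p j} := by
    rw [Fintype.card_subtype_compl, Fintype.card_fin]
    have h1 : Fintype.card {j // p j} ≤ s := by
      simpa using Fintype.card_le_of_surjective (fun a : Fin s => (⟨J a, a, rfl⟩ : {j // p j}))
        (by rintro ⟨_, a, rfl⟩; exact ⟨a, rfl⟩)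
    omega
  refine (lintegral_mono (g := fun _ => q ^ (m - s)) fun x => ?_).trans (by simp)
  by_cases hx : D {z | (restr x, z) ∈ B} ≤ q
  · have : Prod.mk x ⁻¹' E ⊆ Set.univ.pi fun _ => {z | (restr x, z) ∈ B} := fun y hy j _ => hy.2 j
    refine (measure_mono this).trans ?_
    rw [Measure.pi_pi]
    simp only [Finset.prod_const, Finset.card_univ]
    exact (pow_le_pow_left' hx _).trans (pow_le_pow_right_of_le_one' hq hcard)
  · have : Prod.mk x ⁻¹' E = ∅ := Set.eq_empty_of_forall_notMem fun y hy => hx hy.1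
    rw [this]; simp

end streams

end

section

open scoped ENNReal

/-! ### Gaussian estimates -/

variable {d : ℕ}

instance : IsProbabilityMeasure (stdNormal d) := by unfold stdNormal; infer_instance

lemma dotProduct_self_nonneg' (u : Vec d) : 0 ≤ u ⬝ᵥ u :=
  Finset.sum_nonneg fun i _ => mul_self_nonneg (u i)

lemma measurable_dot_left (u : Vec d) : Measurable fun x : Vec d => x ⬝ᵥ u := by
  unfold dotProduct; fun_prop

lemma measurable_dot_example (u : Vec d) : Measurable fun z : LabeledPoint d => z.1 ⬝ᵥ u :=
  (measurable_dot_left u).comp measurable_fst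

/-- A sum of independent centred Gaussians with variances u i ^ 2, identified by its characteristic
function. Variance 0 stands for a point mass, so u = 0 is included. -/
lemma map_dot_stdNormal (u : Vec d) :
    (stdNormal d).map (fun x => x ⬝ᵥ u) = gaussianReal 0 (u ⬝ᵥ u).toNNReal := by
  refine Measure.ext_of_charFun ?_
  have hind : iIndepFun (fun (i : Fin d) (x : Vec d) => x i * u i) (stdNormal d) :=
    iIndepFun_pi (μ := fun _ : Fin d => gaussianReal 0 1) (X := fun i y => y * u i)
      fun i => by fun_prop
  have h1 := hind.charFun_map_fun_sum_eq_prod fun i =>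
    ((measurable_pi_apply i).mul_const _).aemeasurable
  have h2 : ∀ i : Fin d, (stdNormal d).map (fun x => x i * u i) =
      gaussianReal 0 (u i ^ 2).toNNReal := fun i => by
    have h3 : (stdNormal d).map (fun x => x i) = gaussianReal 0 1 :=
      (measurePreserving_eval (fun _ : Fin d => gaussianReal 0 1) i).map_eq
    have h4 := gaussianReal_map_mul_const (μ := 0) (v := 1) (u i)
    rw [← h3, Measure.map_map (by fun_prop) (by fun_prop)] at h4
    refine h4.trans ?_
    rw [mul_zero, mul_one]
    congr 1
    exact (Real.toNNReal_of_nonneg (sq_nonneg _)).symm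
  change charFun ((stdNormal d).map fun x => ∑ i, x i * u i) = _
  rw [h1]
  funext t
  simp only [Finset.prod_apply, h2, charFun_gaussianReal]
  rw [← Complex.exp_sum]
  congr 1
  have h5 : ((u ⬝ᵥ u).toNNReal : ℂ) = ∑ i, ((u i ^ 2).toNNReal : ℂ) := by
    have : ((u ⬝ᵥ u).toNNReal : ℝ) = ∑ i, ((u i ^ 2).toNNReal : ℝ) := by
      rw [Real.coe_toNNReal _ (dotProduct_self_nonneg' u)]
      exact Finset.sum_congr rfl fun i _ => by rw [Real.coe_toNNReal _ (sq_nonneg _), sq]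
    exact_mod_cast congrArg (fun r : ℝ => (r : ℂ)) this
  rw [h5]
  simp [Finset.sum_mul, Finset.sum_div]

variable {D : Measure (LabeledPoint d)}

lemma map_dot_example (hD : D.map Prod.fst = stdNormal d) (u : Vec d) :
    D.map (fun z => z.1 ⬝ᵥ u) = gaussianReal 0 (u ⬝ᵥ u).toNNReal := by
  rw [← map_dot_stdNormal, ← hD, Measure.map_map (measurable_dot_left u) measurable_fst]
  rfl

lemma real_eq_map_real (hD : D.map Prod.fst = stdNormal d) (u : Vec d) {s : Set ℝ}
    (hs : MeasurableSet s) :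
    D {z | z.1 ⬝ᵥ u ∈ s} = gaussianReal 0 (u ⬝ᵥ u).toNNReal s := by
  rw [← map_dot_example hD, Measure.map_apply (measurable_dot_example u) hs]
  rfl

lemma integrable_exp_dot (hD : D.map Prod.fst = stdNormal d) (u : Vec d) (t : ℝ) :
    Integrable (fun z => Real.exp (t * z.1 ⬝ᵥ u)) D := by
  have h := integrable_exp_mul_gaussianReal (μ := 0) (v := (u ⬝ᵥ u).toNNReal) t
  rw [← map_dot_example hD u] at h
  exact h.comp_measurable (measurable_dot_example u)

lemma gaussianReal_le_volume {v : NNReal} (hv : v ≠ 0) (s : Set ℝ) (hs : MeasurableSet s) {C : ℝ}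
    (hC : ∀ x ∈ s, gaussianPDFReal 0 v x ≤ C) :
    gaussianReal 0 v s ≤ ENNReal.ofReal C * volume s := by
  rw [gaussianReal_apply 0 hv]
  calc ∫⁻ x in s, gaussianPDF 0 v x ≤ ∫⁻ _ in s, ENNReal.ofReal C :=
        setLIntegral_mono' hs fun x hx => ENNReal.ofReal_le_ofReal (hC x hx)
    _ = _ := by simp

lemma sqrt_two_pi_ge : (2 : ℝ) ≤ Real.sqrt (2 * Real.pi) :=
  Real.le_sqrt_of_sq_le (by nlinarith [Real.pi_gt_three])

/-- The density is at most 1/√(2π) ≤ 1/2, on an interval of length 2t. -/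
lemma gaussianReal_abs_le {t : ℝ} (ht : 0 ≤ t) :
    (gaussianReal 0 1).real {x | |x| ≤ t} ≤ t := by
  have hset : {x : ℝ | |x| ≤ t} = Set.Icc (-t) t := by ext x; simp [abs_le]
  have h := gaussianReal_le_volume one_ne_zero (Set.Icc (-t) t) measurableSet_Icc (C := 1 / 2)
    fun x _ => by
      rw [gaussianPDFReal_def]
      simp only [NNReal.coe_one, mul_one, sub_zero]
      have h1 : Real.exp (-x ^ 2 / 2) ≤ 1 := Real.exp_le_one_iff.2 (by nlinarith [sq_nonneg x])
      have h2 : (Real.sqrt (2 * Real.pi))⁻¹ ≤ 1 / 2 := by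
        rw [one_div]; exact inv_anti₀ two_pos sqrt_two_pi_ge
      calc _ ≤ 1 / 2 * 1 := mul_le_mul h2 h1 (Real.exp_pos _).le (by norm_num)
        _ = 1 / 2 := by norm_num
  rw [Real.volume_Icc, ← ENNReal.ofReal_mul (by norm_num)] at h
  rw [hset, Measure.real]
  refine (ENNReal.toReal_mono ENNReal.ofReal_ne_top h).trans (le_of_eq ?_)
  rw [ENNReal.toReal_ofReal (by linarith)]; ring

/-- Away from the origin the density is bounded uniformly in the variance: the exponential beats a
small variance and the normalisation a large one. Hence the boundary band of a classifier is small
whatever the length of its weight vector; this uses the nonzero threshold 1. -/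
lemma gaussianPDFReal_le_one {v : NNReal} (hv : v ≠ 0) {x : ℝ} (hx : 1 / 2 ≤ x) :
    gaussianPDFReal 0 v x ≤ 1 := by
  have hv' : (0 : ℝ) < v := by positivity
  rw [gaussianPDFReal_def]
  simp only [sub_zero]
  set w : ℝ := Real.sqrt v with hw
  have hwpos : 0 < w := Real.sqrt_pos.2 hv'
  have hwsq : w ^ 2 = v := Real.sq_sqrt hv'.le
  have h1 : Real.sqrt (2 * Real.pi * v) = Real.sqrt (2 * Real.pi) * w :=
    Real.sqrt_mul (by positivity) _
  rw [h1, inv_mul_le_iff₀ (by positivity), mul_one]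
  have h2 : Real.exp (-x ^ 2 / (2 * v)) ≤ Real.exp (-(1 / (8 * v))) := by
    refine Real.exp_le_exp.2 ?_
    rw [neg_div, neg_le_neg_iff, div_le_div_iff₀ (by positivity) (by positivity)]
    have hx2 : 1 / 4 ≤ x ^ 2 := by nlinarith
    nlinarith [mul_le_mul_of_nonneg_right hx2 hv'.le]
  have h3 : Real.exp (-(1 / (8 * v))) ≤ 2 * w := by
    rw [Real.exp_neg]
    have h4 : 1 / (8 * (v : ℝ)) + 1 ≤ Real.exp (1 / (8 * v)) := Real.add_one_le_exp _
    have h5 : 1 / (2 * w) ≤ 1 / (8 * (v : ℝ)) + 1 := by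
      rw [← hwsq]
      -- With w the standard deviation, 1/(2w) ≤ 1 + 1/(8w²) amounts to 0 ≤ 8w² - 4w + 1, which is
      -- this sum of squares.
      have h6 : 0 ≤ (1 - 2 * w) ^ 2 + 4 * w ^ 2 := by positivity
      rw [div_add_one (by positivity), div_le_div_iff₀ (by positivity) (by positivity)]
      nlinarith [mul_nonneg hwpos.le h6]
    rw [inv_le_comm₀ (Real.exp_pos _) (by positivity), ← one_div]
    exact h5.trans h4
  refine h2.trans (h3.trans ?_)
  exact mul_le_mul_of_nonneg_right sqrt_two_pi_ge hwpos.le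

lemma toNNReal_dot_self_ne_zero {u : Vec d} (hu : u ≠ 0) : (u ⬝ᵥ u).toNNReal ≠ 0 := by
  rw [Ne, Real.toNNReal_eq_zero, not_le]
  exact lt_of_le_of_ne (dotProduct_self_nonneg' u) fun h => hu (dotProduct_self_eq_zero.1 h.symm)

/-- A band around the boundary of a classifier has small mass. -/
lemma measure_band_le (hD : D.map Prod.fst = stdNormal d) (u : Vec d) {ν : ℝ} (hν : 0 ≤ ν)
    (hν' : ν ≤ 1 / 2) : D.real {z | |z.1 ⬝ᵥ u - 1| ≤ ν} ≤ 2 * ν := by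
  have hset : {z : LabeledPoint d | |z.1 ⬝ᵥ u - 1| ≤ ν} =
      {z | z.1 ⬝ᵥ u ∈ Set.Icc (1 - ν) (1 + ν)} := by
    ext z
    simp only [Set.mem_ofPred_eq, abs_le, Set.mem_Icc]
    constructor <;> rintro ⟨h1, h2⟩ <;> constructor <;> linarith
  rw [hset, Measure.real, real_eq_map_real hD u measurableSet_Icc]
  rcases eq_or_ne u 0 with rfl | hu
  · have : (0 : ℝ) ∉ Set.Icc (1 - ν) (1 + ν) := fun h => by linarith [h.1]
    rw [zero_dotProduct, Real.toNNReal_zero, gaussianReal_zero_var,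
      Measure.dirac_apply' _ measurableSet_Icc]
    simp only [Set.indicator_of_notMem this]
    simpa using hν
  · have h := gaussianReal_le_volume (toNNReal_dot_self_ne_zero hu) (Set.Icc (1 - ν) (1 + ν))
      measurableSet_Icc (C := 1) fun x hx =>
        gaussianPDFReal_le_one (toNNReal_dot_self_ne_zero hu) (by linarith [hx.1])
    rw [Real.volume_Icc, ENNReal.ofReal_one, one_mul] at h
    refine (ENNReal.toReal_mono ENNReal.ofReal_ne_top h).trans (le_of_eq ?_)
    rw [ENNReal.toReal_ofReal (by linarith)]; ring

lemma measure_hyperplane_eq_zero (hD : D.map Prod.fst = stdNormal d) {u : Vec d} (hu : u ≠ 0) :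
    D {z | z.1 ⬝ᵥ u = 0} = 0 := by
  have := nullSingletonClass_gaussianReal (μ := 0) (toNNReal_dot_self_ne_zero hu)
  exact (real_eq_map_real hD u (measurableSet_singleton 0)).trans (measure_singleton 0)

/-- By symmetry the two closed half-lines have equal mass, and they cover the line. -/
lemma half_le_measure_halfspace (hD : D.map Prod.fst = stdNormal d) (v : Vec d) :
    1 / 2 ≤ D.real {z | z.1 ∈ halfspace v} := by
  have h1 : D {z | z.1 ∈ halfspace v} = gaussianReal 0 (v ⬝ᵥ v).toNNReal (Set.Ici 0) :=
    real_eq_map_real hD v measurableSet_Ici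
  have h2 : gaussianReal 0 (v ⬝ᵥ v).toNNReal (Set.Iic 0) =
      gaussianReal 0 (v ⬝ᵥ v).toNNReal (Set.Ici 0) := by
    have h3 := gaussianReal_map_neg (μ := 0) (v := (v ⬝ᵥ v).toNNReal)
    rw [neg_zero] at h3
    conv_lhs => rw [← h3, Measure.map_apply measurable_neg measurableSet_Iic]
    congr 1
    ext x; simp
  have h3 : (1 : ℝ≥0∞) ≤ gaussianReal 0 (v ⬝ᵥ v).toNNReal (Set.Ici 0) +
      gaussianReal 0 (v ⬝ᵥ v).toNNReal (Set.Ici 0) := by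
    rw [← measure_univ (μ := gaussianReal 0 (v ⬝ᵥ v).toNNReal)]
    refine (measure_mono (t := Set.Iic 0 ∪ Set.Ici 0) (by
      intro x _; exact le_total x 0)).trans ((measure_union_le _ _).trans ?_)
    rw [h2]
  have h4 := ENNReal.toReal_mono (by simp) h3
  rw [ENNReal.toReal_add (by simp) (by simp), ENNReal.toReal_one] at h4
  rw [Measure.real, h1]
  linarith

/-! ### Exponential moments -/

/-- The function `e^{2⟨x,u⟩} + e^{-2⟨x,u⟩}`, which dominates `|⟨x,u⟩|`. -/
def envelope (u : Vec d) (z : LabeledPoint d) : ℝ :=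
  Real.exp (2 * z.1 ⬝ᵥ u) + Real.exp (-2 * z.1 ⬝ᵥ u)

lemma exp_abs_le_envelope (u : Vec d) (z : LabeledPoint d) :
    Real.exp (2 * |z.1 ⬝ᵥ u|) ≤ envelope u z := by
  unfold envelope
  rcases abs_cases (z.1 ⬝ᵥ u) with ⟨h, _⟩ | ⟨h, _⟩ <;> rw [h]
  · exact le_add_of_nonneg_right (Real.exp_pos _).le
  · rw [mul_neg, ← neg_mul]
    exact le_add_of_nonneg_left (Real.exp_pos _).le

lemma integrable_envelope (hD : D.map Prod.fst = stdNormal d) (u : Vec d) :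
    Integrable (envelope u) D :=
  (integrable_exp_dot hD u 2).add (integrable_exp_dot hD u (-2))

/-- The moment generating function gives at most 2e² < 15. -/
lemma integral_envelope_le (hD : D.map Prod.fst = stdNormal d) {u : Vec d} (hu : u ⬝ᵥ u ≤ 1) :
    ∫ z, envelope u z ∂D ≤ 15 := by
  have h : ∀ t : ℝ, ∫ z, Real.exp (t * z.1 ⬝ᵥ u) ∂D = Real.exp ((u ⬝ᵥ u) * t ^ 2 / 2) := fun t => by
    have := mgf_gaussianReal (map_dot_example hD u) t
    rw [Real.coe_toNNReal _ (dotProduct_self_nonneg' u), zero_mul, zero_add] at this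
    exact this
  unfold envelope
  rw [integral_add (integrable_exp_dot hD u 2) (integrable_exp_dot hD u (-2)), h, h]
  have h1 : Real.exp (u ⬝ᵥ u * 2 ^ 2 / 2) ≤ Real.exp 2 := Real.exp_le_exp.2 (by linarith)
  have h2 : Real.exp (u ⬝ᵥ u * (-2) ^ 2 / 2) ≤ Real.exp 2 := Real.exp_le_exp.2 (by linarith)
  have h3 : Real.exp 2 ≤ 7.5 := by
    rw [show (2 : ℝ) = 1 + 1 by norm_num, Real.exp_add]
    nlinarith [Real.exp_one_lt_d9, Real.exp_pos 1]
  linarith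

lemma abs_le_envelope (u : Vec d) (z : LabeledPoint d) : |z.1 ⬝ᵥ u| ≤ envelope u z := by
  refine le_trans ?_ (exp_abs_le_envelope u z)
  have := Real.add_one_le_exp (2 * |z.1 ⬝ᵥ u|)
  linarith [abs_nonneg (z.1 ⬝ᵥ u)]

lemma integrable_of_abs_le_dot (hD : D.map Prod.fst = stdNormal d) {u : Vec d}
    {Y : LabeledPoint d → ℝ} (hY : Measurable Y) (hYu : ∀ z, |Y z| ≤ |z.1 ⬝ᵥ u|) :
    Integrable Y D :=
  (integrable_envelope hD u).mono' hY.aestronglyMeasurable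
    (Filter.Eventually.of_forall fun z => (hYu z).trans (abs_le_envelope u z))

lemma integrable_dot (hD : D.map Prod.fst = stdNormal d) (u : Vec d) :
    Integrable (fun z => z.1 ⬝ᵥ u) D :=
  integrable_of_abs_le_dot hD (measurable_dot_example u) fun _ => le_rfl

lemma integrable_indicator_abs_dot (hD : D.map Prod.fst = stdNormal d) (u : Vec d)
    {A : Set (LabeledPoint d)} (hA : MeasurableSet A) :
    Integrable (A.indicator fun z => |z.1 ⬝ᵥ u|) D :=
  (integrable_dot hD u).abs.indicator hA

/-- The first absolute moment on a small event is small. -/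
lemma integral_indicator_abs_dot_le [IsProbabilityMeasure D] (hD : D.map Prod.fst = stdNormal d) {u : Vec d}
    (hu : u ⬝ᵥ u ≤ 1) {A : Set (LabeledPoint d)} (hA : MeasurableSet A) {t : ℝ} (ht : 0 ≤ t) :
    ∫ z, A.indicator (fun z => |z.1 ⬝ᵥ u|) z ∂D ≤ t * D.real A + 15 * Real.exp (-t) := by
  have hpt : ∀ z, A.indicator (fun z => |z.1 ⬝ᵥ u|) z ≤
      A.indicator (fun _ => t) z + Real.exp (-t) * envelope u z := fun z => by
    have henv : 0 ≤ Real.exp (-t) * envelope u z :=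
      mul_nonneg (Real.exp_pos _).le ((abs_nonneg _).trans (abs_le_envelope u z))
    by_cases hz : z ∈ A
    · simp only [Set.indicator_of_mem hz]
      by_cases h : |z.1 ⬝ᵥ u| ≤ t
      · linarith
      · have h1 : |z.1 ⬝ᵥ u| ≤ Real.exp (-t) * Real.exp (2 * |z.1 ⬝ᵥ u|) := by
          rw [← Real.exp_add]
          refine le_trans ?_ (Real.add_one_le_exp _)
          linarith
        have h2 := mul_le_mul_of_nonneg_left (exp_abs_le_envelope u z) (Real.exp_pos (-t)).le
        linarith
    · simp only [Set.indicator_of_notMem hz]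
      linarith
  have hint : Integrable (fun z => A.indicator (fun _ => t) z + Real.exp (-t) * envelope u z) D :=
    ((integrable_const t).indicator hA).add ((integrable_envelope hD u).const_mul _)
  refine (integral_mono (integrable_indicator_abs_dot hD u hA) hint hpt).trans ?_
  rw [integral_add ((integrable_const t).indicator hA) ((integrable_envelope hD u).const_mul _),
    integral_indicator_const _ hA, integral_const_mul, smul_eq_mul, mul_comm t]
  have := mul_le_mul_of_nonneg_left (integral_envelope_le hD hu) (Real.exp_pos (-t)).le
  linarith

/-- The first absolute moment on an event is at least quadratic in its probability. -/
lemma sq_le_integral_indicator_abs_dot [IsProbabilityMeasure D] (hD : D.map Prod.fst = stdNormal d) {u : Vec d}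
    (hu : u ⬝ᵥ u = 1) {A : Set (LabeledPoint d)} (hA : MeasurableSet A) :
    D.real A ^ 2 / 4 ≤ ∫ z, A.indicator (fun z => |z.1 ⬝ᵥ u|) z ∂D := by
  -- The slab of half-width t has mass at most t, half the mass of `A`. So |⟨x,u⟩| > t on a part of
  -- `A` of mass at least t.
  set t := D.real A / 2 with ht
  have ht0 : 0 ≤ t := by positivity
  set B : Set (LabeledPoint d) := {z | |z.1 ⬝ᵥ u| ≤ t}
  have hB : MeasurableSet B := measurableSet_le (measurable_dot_example u).abs measurable_const
  have hBt : D.real B ≤ t := by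
    have h := real_eq_map_real hD u (s := {x | |x| ≤ t})
      (measurableSet_le measurable_id.abs measurable_const)
    rw [hu, Real.toNNReal_one] at h
    have h' := gaussianReal_abs_le ht0
    rw [Measure.real, ← h] at h'
    exact h'
  have hpt : ∀ z, A.indicator (fun _ => t) z - B.indicator (fun _ => t) z ≤
      A.indicator (fun z => |z.1 ⬝ᵥ u|) z := fun z => by
    by_cases hz : z ∈ A <;> by_cases hz' : z ∈ B <;>
      simp only [Set.indicator_of_mem, Set.indicator_of_notMem, hz, hz', not_false_eq_true]
    · linarith [abs_nonneg (z.1 ⬝ᵥ u)]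
    · have : ¬ |z.1 ⬝ᵥ u| ≤ t := hz'
      linarith
    · linarith
    · linarith
  have hi := integral_mono (((integrable_const t).indicator hA).sub
    ((integrable_const t).indicator hB)) (integrable_indicator_abs_dot hD u hA) hpt
  rw [Pi.sub_def, integral_sub ((integrable_const t).indicator hA)
    ((integrable_const t).indicator hB), integral_indicator_const _ hA,
    integral_indicator_const _ hB, smul_eq_mul, smul_eq_mul] at hi
  nlinarith

/-- A second-order bound without restriction on y: the factor e^|y| pays for large arguments and is
later dominated by the envelope, so unbounded variables are allowed. -/
lemma exp_le_quadratic (y : ℝ) : Real.exp y ≤ 1 + y + y ^ 2 * Real.exp |y| := by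
  have h1 : 1 ≤ Real.exp |y| := Real.one_le_exp (abs_nonneg y)
  rcases le_or_gt |y| 1 with h | h
  · have h2 := (abs_le.1 (Real.abs_exp_sub_one_sub_id_le h)).2
    nlinarith [sq_nonneg y]
  · rcases le_or_gt 0 y with hy | hy
    · rw [abs_of_nonneg hy] at h ⊢
      nlinarith [mul_nonneg (by nlinarith : 0 ≤ y ^ 2 - 1) (Real.exp_pos y).le]
    · rw [abs_of_neg hy] at h h1 ⊢
      have h3 : Real.exp y ≤ 1 := Real.exp_le_one_iff.2 hy.le
      nlinarith [sq_nonneg y]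

/-- The centred exponential moments of a function dominated by a linear functional. -/
lemma lintegral_exp_centred_le [IsProbabilityMeasure D] (hD : D.map Prod.fst = stdNormal d) {u : Vec d} (hu : u ⬝ᵥ u ≤ 1)
    {Y : LabeledPoint d → ℝ} (hY : Measurable Y) (hYu : ∀ z, |Y z| ≤ |z.1 ⬝ᵥ u|) {l : ℝ}
    (hl : 0 ≤ l) (hl' : l ≤ 1) :
    ∫⁻ z, ENNReal.ofReal (Real.exp (l * Y z)) ∂D ≤
      ENNReal.ofReal (Real.exp (l * ∫ z, Y z ∂D + 30 * l ^ 2)) := by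
  have hint := integrable_of_abs_le_dot hD hY hYu
  have hpt : ∀ z, Real.exp (l * Y z) ≤ 1 + l * Y z + 2 * l ^ 2 * envelope u z := fun z => by
    refine (exp_le_quadratic _).trans ?_
    set g := |z.1 ⬝ᵥ u|
    have hg0 : 0 ≤ g := abs_nonneg _
    have h1 : |l * Y z| ≤ g := by
      rw [abs_mul, abs_of_nonneg hl]
      exact (mul_le_of_le_one_left (abs_nonneg _) hl').trans (hYu z)
    have h2 : (l * Y z) ^ 2 ≤ l ^ 2 * g ^ 2 := by
      rw [mul_pow]
      refine mul_le_mul_of_nonneg_left ?_ (sq_nonneg l)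
      rw [← sq_abs (Y z)]
      exact pow_le_pow_left₀ (abs_nonneg _) (hYu z) 2
    have h3 : g ^ 2 ≤ 2 * Real.exp g := by
      have := Real.quadratic_le_exp_of_nonneg hg0
      linarith
    have h4 : Real.exp |l * Y z| ≤ Real.exp g := Real.exp_le_exp.2 h1
    have h5 : Real.exp g * Real.exp g ≤ envelope u z := by
      rw [← Real.exp_add, ← two_mul]; exact exp_abs_le_envelope u z
    have h6 : (l * Y z) ^ 2 * Real.exp |l * Y z| ≤ l ^ 2 * (2 * Real.exp g) * Real.exp g :=
      mul_le_mul (h2.trans (mul_le_mul_of_nonneg_left h3 (sq_nonneg l))) h4 (Real.exp_pos _).le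
        (by positivity)
    nlinarith [mul_le_mul_of_nonneg_left h5 (sq_nonneg l)]
  have hi : Integrable (fun z => 1 + l * Y z + 2 * l ^ 2 * envelope u z) D :=
    ((integrable_const 1).add (hint.const_mul l)).add ((integrable_envelope hD u).const_mul _)
  refine (lintegral_mono fun z => ENNReal.ofReal_le_ofReal (hpt z)).trans ?_
  rw [← ofReal_integral_eq_lintegral_ofReal hi (Filter.Eventually.of_forall fun z =>
    (Real.exp_pos _).le.trans (hpt z))]
  refine ENNReal.ofReal_le_ofReal ?_
  rw [integral_add (f := fun z => 1 + l * Y z) ((integrable_const 1).add (hint.const_mul l))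
    ((integrable_envelope hD u).const_mul _), integral_add (integrable_const 1) (hint.const_mul l),
    integral_const_mul, integral_const_mul]
  have h1 := mul_le_mul_of_nonneg_left (integral_envelope_le hD hu)
    (by positivity : 0 ≤ 2 * l ^ 2)
  refine le_trans ?_ (Real.add_one_le_exp _)
  simp only [integral_const, probReal_univ, smul_eq_mul, mul_one]
  linarith

/-- The standard density times e^(x²/4) is √2 times the density of variance 2, so the integral is √2
≤ e^(1/2). -/
lemma lintegral_gaussianReal_exp_sq :
    ∫⁻ x, ENNReal.ofReal (Real.exp (x ^ 2 / 4)) ∂(gaussianReal 0 1) ≤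
      ENNReal.ofReal (Real.exp (1 / 2)) := by
  rw [gaussianReal_of_var_ne_zero 0 one_ne_zero,
    lintegral_withDensity_eq_lintegral_mul _ (measurable_gaussianPDF 0 1) (by fun_prop)]
  have h : ∀ x : ℝ, (gaussianPDF 0 1 * fun x => ENNReal.ofReal (Real.exp (x ^ 2 / 4))) x =
      ENNReal.ofReal (Real.sqrt 2) * gaussianPDF 0 2 x := fun x => by
    simp only [Pi.mul_apply, gaussianPDF]
    rw [← ENNReal.ofReal_mul (gaussianPDFReal_nonneg _ _ _), ← ENNReal.ofReal_mul (by positivity)]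
    congr 1
    simp only [gaussianPDFReal_def, NNReal.coe_one, mul_one, sub_zero, NNReal.coe_ofNat]
    rw [mul_assoc, ← Real.exp_add, Real.sqrt_mul (by positivity) 2, mul_inv, ← mul_assoc,
      mul_comm (Real.sqrt 2), mul_assoc ((Real.sqrt (2 * Real.pi))⁻¹), inv_mul_cancel₀ (by positivity),
      mul_one]
    congr 2
    ring
  simp_rw [h]
  rw [lintegral_const_mul _ (measurable_gaussianPDF 0 2), lintegral_gaussianPDF_eq_one 0 two_ne_zero,
    mul_one]
  refine ENNReal.ofReal_le_ofReal (Real.sqrt_le_iff.2 ⟨(Real.exp_pos _).le, ?_⟩)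
  rw [← Real.exp_nat_mul]
  norm_num
  linarith [Real.add_one_le_exp (1 : ℝ)]

/-- An exponential moment of the squared norm. -/
lemma lintegral_exp_sq_norm_le (hD : D.map Prod.fst = stdNormal d) :
    ∫⁻ z, ENNReal.ofReal (Real.exp (z.1 ⬝ᵥ z.1 / 4)) ∂D ≤ ENNReal.ofReal (Real.exp (d / 2)) := by
  have hmeas : Measurable fun x : Vec d => ENNReal.ofReal (Real.exp (x ⬝ᵥ x / 4)) := by
    unfold dotProduct; fun_prop
  have h1 : ∫⁻ z, ENNReal.ofReal (Real.exp (z.1 ⬝ᵥ z.1 / 4)) ∂D =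
      ∫⁻ x, ENNReal.ofReal (Real.exp (x ⬝ᵥ x / 4)) ∂(stdNormal d) := by
    rw [← hD, lintegral_map hmeas measurable_fst]
  set f : ℝ → ℝ≥0∞ := fun x => ENNReal.ofReal (Real.exp (x ^ 2 / 4))
  have hf : Measurable f := by fun_prop
  have hind : iIndepFun (fun (i : Fin d) (x : Vec d) => f (x i)) (stdNormal d) :=
    iIndepFun_pi (μ := fun _ : Fin d => gaussianReal 0 1) (X := fun _ => f) fun i => hf.aemeasurable
  have h2 : ∀ x : Vec d, ENNReal.ofReal (Real.exp (x ⬝ᵥ x / 4)) = ∏ i, f (x i) := fun x => by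
    simp only [f]
    rw [← ENNReal.ofReal_prod_of_nonneg fun i _ => (Real.exp_pos _).le, ← Real.exp_sum,
      ← Finset.sum_div]
    congr 3
    exact Finset.sum_congr rfl fun i _ => (sq (x i)).symm
  rw [h1]
  simp_rw [h2]
  rw [lintegral_prod_eq_prod_lintegral_of_indepFun Finset.univ _ hind
    fun i => hf.comp (measurable_pi_apply i)]
  have h3 : ∀ i : Fin d, ∫⁻ x, f (x i) ∂(stdNormal d) ≤ ENNReal.ofReal (Real.exp (1 / 2)) :=
    fun i => (le_of_eq ((measurePreserving_eval (fun _ : Fin d => gaussianReal 0 1) i).lintegral_comp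
      hf)).trans lintegral_gaussianReal_exp_sq
  refine (Finset.prod_le_prod' fun i _ => h3 i).trans ?_
  rw [Finset.prod_const, Finset.card_univ, Fintype.card_fin, ← ENNReal.ofReal_pow (Real.exp_pos _).le,
    ← Real.exp_nat_mul]
  exact ENNReal.ofReal_le_ofReal (Real.exp_le_exp.2 (by rw [mul_one_div]))

end

/-! ### One step of projected gradient descent and its expected drift. -/

section

open scoped ENNReal
open Prog

variable {d : ℕ}

/-! ### Measurability -/

section measurability

variable {α : Type*} [MeasurableSpace α]

lemma Measurable.dot {n : ℕ} {f g : α → Fin n → ℝ} (hf : Measurable f) (hg : Measurable g) :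
    Measurable fun a => f a ⬝ᵥ g a := by
  unfold dotProduct; fun_prop

/-- Joint measurability is needed because the classifier is itself random: it is computed from the
first examples. -/
lemma measurableSet_mistake : MeasurableSet {q : Vec d × LabeledPoint d | mistake q.1 q.2 = true} := by
  have h : {q : Vec d × LabeledPoint d | mistake q.1 q.2 = true} =
      ({q | 1 ≤ q.1 ⬝ᵥ q.2.1} ∩ {q | q.2.2 = false}) ∪
        ({q | 1 ≤ q.1 ⬝ᵥ q.2.1}ᶜ ∩ {q | q.2.2 = true}) := by
    ext ⟨c, x, y⟩
    by_cases h : 1 ≤ c ⬝ᵥ x <;> cases y <;> simp [mistake, classify, h]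
  have h1 : MeasurableSet {q : Vec d × LabeledPoint d | 1 ≤ q.1 ⬝ᵥ q.2.1} :=
    measurableSet_le measurable_const (Measurable.dot measurable_fst measurable_snd.fst)
  have h2 : ∀ b : Bool, MeasurableSet {q : Vec d × LabeledPoint d | q.2.2 = b} := fun b =>
    measurable_snd.snd (measurableSet_singleton b)
  rw [h]
  exact (h1.inter (h2 _)).union (h1.compl.inter (h2 _))

lemma measurableSet_halfspace :
    MeasurableSet {q : Vec d × LabeledPoint d | q.2.1 ∈ halfspace q.1} :=
  measurableSet_le measurable_const (Measurable.dot measurable_snd.fst measurable_fst)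

lemma measurable_gradVal : Measurable fun q : (Vec d × Vec d) × LabeledPoint d =>
    gradVal q.1.2 q.2.1 (mistake q.1.1 q.2) := by
  have hm : Measurable fun q : (Vec d × Vec d) × LabeledPoint d => (q.1.1, q.2) :=
    measurable_fst.fst.prodMk measurable_snd
  have hh : Measurable fun q : (Vec d × Vec d) × LabeledPoint d => (q.1.2, q.2) :=
    measurable_fst.snd.prodMk measurable_snd
  unfold gradVal
  refine Measurable.ite ((hm measurableSet_mistake).inter (hh measurableSet_halfspace)) ?_
    measurable_const
  refine measurable_pi_lambda _ fun j => ?_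
  have h1 : Measurable fun q : (Vec d × Vec d) × LabeledPoint d => q.2.1 ⬝ᵥ q.1.2 :=
    Measurable.dot measurable_snd.fst measurable_fst.snd
  have h2 : Measurable fun q : (Vec d × Vec d) × LabeledPoint d => q.1.2 ⬝ᵥ q.1.2 :=
    Measurable.dot measurable_fst.snd measurable_fst.snd
  fun_prop

lemma measurable_batchGrad {N : ℕ} :
    Measurable fun q : (Vec d × Vec d) × (Fin N → LabeledPoint d) =>
      batchGrad q.1.1 q.1.2 q.2 := by
  unfold batchGrad
  refine measurable_pi_lambda _ fun j => Measurable.div_const ?_ _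
  refine Finset.measurable_sum _ fun i _ => ?_
  have h : Measurable fun q : (Vec d × Vec d) × (Fin N → LabeledPoint d) => (q.1, q.2 i) :=
    measurable_fst.prodMk ((measurable_pi_apply i).comp measurable_snd)
  have h3 := (measurable_gradVal (d := d)).comp h
  exact measurable_pi_iff.1 h3 j

lemma measurable_psgdUpdate {N : ℕ} (β : ℝ) :
    Measurable fun q : (Vec d × Vec d) × (Fin N → LabeledPoint d) =>
      psgdUpdate β q.1.1 q.1.2 q.2 := by
  have h : Measurable fun q : (Vec d × Vec d) × (Fin N → LabeledPoint d) =>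
      (fun j => q.1.2 j - β * batchGrad q.1.1 q.1.2 q.2 j : Vec d) := by
    refine measurable_pi_lambda _ fun j => ?_
    have h1 := (measurable_pi_apply j).comp (measurable_batchGrad (d := d) (N := N))
    have h2 : Measurable fun q : (Vec d × Vec d) × (Fin N → LabeledPoint d) => q.1.2 j :=
      (measurable_pi_apply j).comp measurable_fst.snd
    exact h2.sub (h1.const_mul β)
  unfold psgdUpdate
  refine measurable_pi_lambda _ fun j => ?_
  exact ((measurable_pi_apply j).comp h).div (Measurable.dot h h).sqrt

end measurability

/-! ### One iteration of projected gradient descent -/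

/-- The projection away from w is self-adjoint. Moved to v, it makes the component of the gradient
along v a truncation of one fixed linear functional of x. -/
lemma gradVal_dot {w : Vec d} (hw : w ⬝ᵥ w = 1) (x : Vec d) (y : Bool) (v : Vec d) :
    gradVal w x y ⬝ᵥ v =
      if y = true ∧ 0 ≤ x ⬝ᵥ w then x ⬝ᵥ (v - (w ⬝ᵥ v) • w) else 0 := by
  unfold gradVal
  split_ifs
  · have h : (fun j => x j - x ⬝ᵥ w / w ⬝ᵥ w * w j) = x - (x ⬝ᵥ w) • w := by
      funext j; simp [hw]
    rw [h, sub_dotProduct, smul_dotProduct, dotProduct_sub, dotProduct_smul, smul_eq_mul,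
      smul_eq_mul]
    ring
  · exact zero_dotProduct v

lemma gradVal_dot_self_le {w : Vec d} (hw : w ⬝ᵥ w = 1) (x : Vec d) (y : Bool) :
    gradVal w x y ⬝ᵥ gradVal w x y ≤ x ⬝ᵥ x := by
  unfold gradVal
  split_ifs
  · have h : (fun j => x j - x ⬝ᵥ w / w ⬝ᵥ w * w j) = x - (x ⬝ᵥ w) • w := by
      funext j; simp [hw]
    rw [h]
    simp only [sub_dotProduct, dotProduct_sub, smul_dotProduct, dotProduct_smul, smul_eq_mul, hw]
    rw [dotProduct_comm w x]
    nlinarith [sq_nonneg (x ⬝ᵥ w)]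
  · simpa using dotProduct_self_nonneg' x

lemma batchGrad_dot {N : ℕ} (c w : Vec d) (b : Fin N → LabeledPoint d) (v : Vec d) :
    batchGrad c w b ⬝ᵥ v = (∑ i, gradVal w (b i).1 (mistake c (b i)) ⬝ᵥ v) / N := by
  simp only [batchGrad, dotProduct]
  rw [Finset.sum_comm, Finset.sum_div]
  exact Finset.sum_congr rfl fun j _ => by rw [div_mul_eq_mul_div, Finset.sum_mul]

/-- Orthogonality to w gives the unnormalised step the squared length 1 + β²|g|² ≥ 1. Normalising is
thus always possible and costs only a second-order term. -/
lemma batchGrad_dot_right {N : ℕ} (c : Vec d) {w : Vec d} (hw : w ⬝ᵥ w = 1)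
    (b : Fin N → LabeledPoint d) : batchGrad c w b ⬝ᵥ w = 0 := by
  rw [batchGrad_dot, Finset.sum_eq_zero, zero_div]
  intro i _
  rw [gradVal_dot hw, hw, one_smul, sub_self, dotProduct_zero, ite_self]

/-- Cauchy–Schwarz in each coordinate; projecting does not lengthen x. -/
lemma batchGrad_dot_self_le {N : ℕ} (c : Vec d) {w : Vec d} (hw : w ⬝ᵥ w = 1)
    (b : Fin N → LabeledPoint d) :
    batchGrad c w b ⬝ᵥ batchGrad c w b ≤ (∑ i, (b i).1 ⬝ᵥ (b i).1) / N := by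
  rcases Nat.eq_zero_or_pos N with rfl | hN
  · simp [batchGrad, dotProduct]
  have hN' : (0 : ℝ) < N := by exact_mod_cast hN
  have h1 : ∀ j, batchGrad c w b j * batchGrad c w b j ≤
      (∑ i, gradVal w (b i).1 (mistake c (b i)) j * gradVal w (b i).1 (mistake c (b i)) j) / N :=
    fun j => by
      have h := sq_sum_le_card_mul_sum_sq (s := Finset.univ)
        (f := fun i => gradVal w (b i).1 (mistake c (b i)) j)
      rw [Finset.card_univ, Fintype.card_fin] at h
      simp only [batchGrad]
      rw [div_mul_div_comm, div_le_div_iff₀ (by positivity) hN', ← sq]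
      simp only [← sq]
      nlinarith
  refine (Finset.sum_le_sum fun j _ => h1 j).trans ?_
  rw [← Finset.sum_div, Finset.sum_comm]
  refine div_le_div_of_nonneg_right (Finset.sum_le_sum fun i _ => ?_) hN'.le
  exact gradVal_dot_self_le hw _ _

lemma psgdUpdate_eq {N : ℕ} (β : ℝ) (c : Vec d) {w : Vec d} (hw : w ⬝ᵥ w = 1)
    (b : Fin N → LabeledPoint d) :
    psgdUpdate β c w b = (Real.sqrt (1 + β ^ 2 * (batchGrad c w b ⬝ᵥ batchGrad c w b)))⁻¹ •
      (w - β • batchGrad c w b) := by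
  have h : (fun j => w j - β * batchGrad c w b j) = w - β • batchGrad c w b := by
    funext j; simp
  have h2 : (w - β • batchGrad c w b) ⬝ᵥ (w - β • batchGrad c w b) =
      1 + β ^ 2 * (batchGrad c w b ⬝ᵥ batchGrad c w b) := by
    simp only [sub_dotProduct, dotProduct_sub, smul_dotProduct, dotProduct_smul, smul_eq_mul, hw]
    rw [dotProduct_comm w, batchGrad_dot_right c hw]
    ring
  unfold psgdUpdate
  rw [h, h2]
  funext j
  simp [div_eq_inv_mul]

lemma sub_dot_self {N : ℕ} (β : ℝ) (c : Vec d) {w : Vec d} (hw : w ⬝ᵥ w = 1)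
    (b : Fin N → LabeledPoint d) :
    (w - β • batchGrad c w b) ⬝ᵥ (w - β • batchGrad c w b) =
      1 + β ^ 2 * (batchGrad c w b ⬝ᵥ batchGrad c w b) := by
  simp only [sub_dotProduct, dotProduct_sub, smul_dotProduct, dotProduct_smul, smul_eq_mul, hw]
  rw [dotProduct_comm w, batchGrad_dot_right c hw]
  ring

lemma one_le_norm_factor {N : ℕ} (β : ℝ) (c w : Vec d) (b : Fin N → LabeledPoint d) :
    1 ≤ 1 + β ^ 2 * (batchGrad c w b ⬝ᵥ batchGrad c w b) :=
  le_add_of_nonneg_right (mul_nonneg (sq_nonneg _) (dotProduct_self_nonneg' _))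

lemma psgdUpdate_dot_self {N : ℕ} (β : ℝ) (c : Vec d) {w : Vec d} (hw : w ⬝ᵥ w = 1)
    (b : Fin N → LabeledPoint d) : psgdUpdate β c w b ⬝ᵥ psgdUpdate β c w b = 1 := by
  have h := one_le_norm_factor β c w b
  rw [psgdUpdate_eq β c hw, smul_dotProduct, dotProduct_smul, sub_dot_self β c hw, smul_eq_mul,
    smul_eq_mul, ← mul_assoc, ← mul_inv, Real.mul_self_sqrt (by linarith),
    inv_mul_cancel₀ (by linarith)]

lemma abs_dot_le_sqrt (u : Vec d) {v : Vec d} (hv : v ⬝ᵥ v = 1) :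
    u ⬝ᵥ v ≤ Real.sqrt (u ⬝ᵥ u) := by
  refine Real.le_sqrt_of_sq_le ?_
  have h := Finset.sum_mul_sq_le_sq_mul_sq Finset.univ u v
  have h1 : ∑ i, u i ^ 2 = u ⬝ᵥ u := Finset.sum_congr rfl fun i _ => sq (u i)
  have h2 : ∑ i, v i ^ 2 = v ⬝ᵥ v := Finset.sum_congr rfl fun i _ => sq (v i)
  rw [h1, h2, hv, mul_one] at h
  exact h

/-- The progress of one iteration in direction `v`. -/
lemma le_psgdUpdate_dot {N : ℕ} (β : ℝ) (c : Vec d) {w v : Vec d} (hw : w ⬝ᵥ w = 1)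
    (hv : v ⬝ᵥ v = 1) (b : Fin N → LabeledPoint d) :
    w ⬝ᵥ v - β * batchGrad c w b ⬝ᵥ v - β ^ 2 * (batchGrad c w b ⬝ᵥ batchGrad c w b) / 2 ≤
      psgdUpdate β c w b ⬝ᵥ v := by
  have h := one_le_norm_factor β c w b
  have hnum := abs_dot_le_sqrt (w - β • batchGrad c w b) hv
  rw [sub_dot_self β c hw] at hnum
  rw [psgdUpdate_eq β c hw, smul_dotProduct, smul_eq_mul]
  have hd : (w - β • batchGrad c w b) ⬝ᵥ v = w ⬝ᵥ v - β * batchGrad c w b ⬝ᵥ v := by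
    rw [sub_dotProduct, smul_dotProduct, smul_eq_mul]
  rw [hd] at hnum ⊢
  set q := β ^ 2 * (batchGrad c w b ⬝ᵥ batchGrad c w b)
  set n := Real.sqrt (1 + q) with hn
  set a := w ⬝ᵥ v - β * batchGrad c w b ⬝ᵥ v
  have hn1 : 1 ≤ n := Real.one_le_sqrt.2 h
  have hnsq : n ^ 2 = 1 + q := Real.sq_sqrt (by linarith)
  rw [inv_mul_eq_div, le_div_iff₀ (by linarith)]
  -- From a ≤ n and q = n² - 1: a(n - 1) ≤ n(n - 1) ≤ nq/2, the last gap being n(n - 1)²/2.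
  nlinarith [sq_nonneg (n - 1)]

/-! ### The expected gradient -/

variable {D : Measure (LabeledPoint d)} [IsProbabilityMeasure D]

/-- The expected gradient in direction `v`. -/
def drift (D : Measure (LabeledPoint d)) (v c w : Vec d) : ℝ :=
  ∫ z, gradVal w z.1 (mistake c z) ⬝ᵥ v ∂D

lemma measurable_gradVal_dot (c w v : Vec d) :
    Measurable fun z : LabeledPoint d => gradVal w z.1 (mistake c z) ⬝ᵥ v :=
  (measurable_dot_left v).comp ((measurable_gradVal (d := d)).comp
    (measurable_prodMk_left (x := (c, w))))

lemma abs_gradVal_dot_le (c : Vec d) {w : Vec d} (hw : w ⬝ᵥ w = 1) (v : Vec d)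
    (z : LabeledPoint d) :
    |gradVal w z.1 (mistake c z) ⬝ᵥ v| ≤ |z.1 ⬝ᵥ (v - (w ⬝ᵥ v) • w)| := by
  rw [gradVal_dot hw]
  split_ifs
  · exact le_rfl
  · simp

lemma residual_dot_self {w v : Vec d} (hw : w ⬝ᵥ w = 1) (hv : v ⬝ᵥ v = 1) :
    (v - (w ⬝ᵥ v) • w) ⬝ᵥ (v - (w ⬝ᵥ v) • w) ≤ 1 := by
  simp only [sub_dotProduct, dotProduct_sub, smul_dotProduct, dotProduct_smul, smul_eq_mul, hw, hv]
  rw [dotProduct_comm v w]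
  nlinarith [sq_nonneg (w ⬝ᵥ v)]

lemma mistake_iff (c : Vec d) (z : LabeledPoint d) :
    mistake c z = true ↔ classify c z.1 ≠ z.2 := by simp [mistake]

lemma measurableSet_error (c w : Vec d) :
    MeasurableSet {z : LabeledPoint d | z.1 ∈ halfspace w ∧ classify c z.1 ≠ z.2} := by
  have h1 : MeasurableSet {z : LabeledPoint d | z.1 ∈ halfspace w} :=
    (measurable_prodMk_left (x := w)) measurableSet_halfspace
  have h2 : MeasurableSet {z : LabeledPoint d | mistake c z = true} :=
    (measurable_prodMk_left (x := c)) measurableSet_mistake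
  simp only [mistake_iff] at h2
  exact h1.inter h2

/-- The expected gradient is correlated with the direction of a good selector, unless the
error is small. -/
lemma drift_le (hD : D.map Prod.fst = stdNormal d) {v c w : Vec d} (hv : v ⬝ᵥ v = 1)
    (hw : w ⬝ᵥ w = 1) {ε : ℝ} (hε : 0 < ε) (hε' : ε ≤ 1) (hγ : -ε ≤ w ⬝ᵥ v)
    (herr : condError D c v ≤ 3 * ε) :
    ∃ p : ℝ, condError D c w ≤ 3 * ε + p ∧ 0 ≤ p ∧
      drift D v c w ≤ 3 * ε * Real.log (1 / ε) + 30 * ε - p ^ 2 / 4 := by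
  -- The errors in h(w) are split by h(v): those inside are rare by assumption, those outside pull w
  -- towards v. The witness p is the mass of the outside part.
  set A₁ : Set (LabeledPoint d) := {z | z.1 ∈ halfspace w ∧ classify c z.1 ≠ z.2} ∩
    {z | z.1 ∈ halfspace v}
  set A₂ : Set (LabeledPoint d) := {z | z.1 ∈ halfspace w ∧ classify c z.1 ≠ z.2} \
    {z | z.1 ∈ halfspace v}
  have hmv : MeasurableSet {z : LabeledPoint d | z.1 ∈ halfspace v} :=
    (measurable_prodMk_left (x := v)) measurableSet_halfspace
  have hA₁ : MeasurableSet A₁ := (measurableSet_error c w).inter hmv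
  have hA₂ : MeasurableSet A₂ := (measurableSet_error c w).diff hmv
  have hA₁le : D.real A₁ ≤ 3 * ε := by
    refine le_trans (measureReal_mono ?_) herr
    rintro z ⟨⟨-, h1⟩, h2⟩
    exact ⟨h2, h1⟩
  refine ⟨D.real A₂, ?_, measureReal_nonneg, ?_⟩
  · have h : condError D c w ≤ D.real A₁ + D.real A₂ := by
      refine le_trans (measureReal_mono ?_) (measureReal_union_le _ _)
      intro z hz
      by_cases h : z.1 ∈ halfspace v
      · exact Or.inl ⟨hz, h⟩
      · exact Or.inr ⟨hz, h⟩
    linarith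
  set r := v - (w ⬝ᵥ v) • w with hr
  have hr1 : r ⬝ᵥ r ≤ 1 := residual_dot_self hw hv
  have hxr : ∀ x : Vec d, x ⬝ᵥ r = x ⬝ᵥ v - (w ⬝ᵥ v) * x ⬝ᵥ w := fun x => by
    rw [hr, dotProduct_sub, dotProduct_smul, smul_eq_mul]
  -- Outside h(v) one has ⟨x,v⟩ = -|⟨x,v⟩|; as ⟨x,w⟩ ≥ 0 and ⟨w,v⟩ ≥ -ε, the projection costs at
  -- most ε|⟨x,w⟩|.
  have hpt : ∀ z : LabeledPoint d, gradVal w z.1 (mistake c z) ⬝ᵥ v ≤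
      A₁.indicator (fun z => |z.1 ⬝ᵥ r|) z - A₂.indicator (fun z => |z.1 ⬝ᵥ v|) z
        + ε * |z.1 ⬝ᵥ w| := fun z => by
    have hpos : 0 ≤ ε * |z.1 ⬝ᵥ w| := by positivity
    simp only [gradVal_dot hw, ← hr, mistake_iff]
    by_cases h1 : z.1 ∈ halfspace w ∧ classify c z.1 ≠ z.2
    · rw [if_pos ⟨h1.2, h1.1⟩]
      by_cases h2 : z.1 ∈ halfspace v
      · rw [Set.indicator_of_mem (show z ∈ A₁ from ⟨h1, h2⟩), Set.indicator_of_notMem fun h => h.2 h2]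
        linarith [le_abs_self (z.1 ⬝ᵥ r)]
      · rw [Set.indicator_of_mem (show z ∈ A₂ from ⟨h1, h2⟩), Set.indicator_of_notMem fun h => h2 h.2]
        have h3 : z.1 ⬝ᵥ v < 0 := not_le.1 h2
        have h4 : 0 ≤ z.1 ⬝ᵥ w := h1.1
        rw [hxr, abs_of_neg h3, abs_of_nonneg h4]
        nlinarith
    · rw [if_neg fun h => h1 ⟨h.2, h.1⟩, Set.indicator_of_notMem fun h => h1 h.1,
        Set.indicator_of_notMem fun h => h1 h.1]
      linarith
  have hi₁ := integrable_indicator_abs_dot hD r hA₁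
  have hi₂ := integrable_indicator_abs_dot hD v hA₂
  have hi₃ : Integrable (fun z : LabeledPoint d => ε * |z.1 ⬝ᵥ w|) D :=
    (integrable_dot hD w).abs.const_mul ε
  have hint := integral_mono (integrable_of_abs_le_dot hD (measurable_gradVal_dot c w v)
    (abs_gradVal_dot_le c hw v)) ((hi₁.sub hi₂).add hi₃) hpt
  rw [Pi.add_def, integral_add (hi₁.sub hi₂) hi₃, Pi.sub_def, integral_sub hi₁ hi₂,
    integral_const_mul] at hint
  have hL : 0 ≤ Real.log (1 / ε) := Real.log_nonneg (by rw [le_div_iff₀ hε]; linarith)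
  -- Truncation at ln(1/ε) leaves a tail of 15ε; together with `b₃` this gives 30ε.
  have b₁ := integral_indicator_abs_dot_le hD hr1 hA₁ hL
  have b₂ := sq_le_integral_indicator_abs_dot hD hv hA₂
  have b₃ : ∫ z, |z.1 ⬝ᵥ w| ∂D ≤ 15 :=
    (integral_mono (integrable_dot hD w).abs (integrable_envelope hD w)
      (abs_le_envelope w)).trans (integral_envelope_le hD hw.le)
  have hexp : Real.exp (-Real.log (1 / ε)) = ε := by
    rw [Real.exp_neg, Real.exp_log (by positivity), one_div, inv_inv]
  rw [hexp] at b₁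
  have b₄ := mul_le_mul_of_nonneg_left hA₁le hL
  have b₅ := mul_le_mul_of_nonneg_left b₃ hε.le
  unfold drift
  linarith

/-! ### Concentration of the empirical gradient -/

/-- The batches whose gradient deviates from its expectation or is too long. -/
def stepBad (D : Measure (LabeledPoint d)) (v : Vec d) (ε : ℝ) (N : ℕ) :
    Set ((Vec d × Vec d) × (Fin N → LabeledPoint d)) :=
  {q | drift D v q.1.1 q.1.2 + ε ≤ batchGrad q.1.1 q.1.2 q.2 ⬝ᵥ v} ∪
    {q | 5 * (d : ℝ) ≤ batchGrad q.1.1 q.1.2 q.2 ⬝ᵥ batchGrad q.1.1 q.1.2 q.2}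

lemma measurableSet_stepBad (v : Vec d) (ε : ℝ) (N : ℕ) : MeasurableSet (stepBad D v ε N) := by
  have h1 : Measurable fun q : Vec d × Vec d => drift D v q.1 q.2 := by
    have h : StronglyMeasurable fun q : (Vec d × Vec d) × LabeledPoint d =>
        gradVal q.1.2 q.2.1 (mistake q.1.1 q.2) ⬝ᵥ v :=
      ((measurable_dot_left v).comp measurable_gradVal).stronglyMeasurable
    exact h.integral_prod_right'.measurable
  have h2 := measurable_batchGrad (d := d) (N := N)
  exact (measurableSet_le ((h1.comp measurable_fst).add_const ε)
    ((measurable_dot_left v).comp h2)).union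
    (measurableSet_le measurable_const (Measurable.dot h2 h2))

/-- Two Chernoff bounds: the component along v is dominated by a Gaussian functional, and the
squared length is controlled by the exponential moment of |x|², with exponent N(d/2 - 5d/4). -/
lemma pi_stepBad_le (hD : D.map Prod.fst = stdNormal d) {v c w : Vec d} (hv : v ⬝ᵥ v = 1)
    (hw : w ⬝ᵥ w = 1) {ε : ℝ} (hε : 0 < ε) (hε' : ε ≤ 1) {N : ℕ} (hN : 0 < N) :
    Measure.pi (fun _ : Fin N => D) {b | ((c, w), b) ∈ stepBad D v ε N} ≤
      ENNReal.ofReal (Real.exp (-(N * ε ^ 2 / 120))) +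
        ENNReal.ofReal (Real.exp (-(N * d * 3 / 4))) := by
  have hN' : (0 : ℝ) < N := by exact_mod_cast hN
  refine (measure_union_le _ _).trans (add_le_add ?_ ?_)
  · set l := ε / 60 with hl
    have hm := lintegral_exp_centred_le hD (residual_dot_self hw hv)
      (measurable_gradVal_dot c w v) (abs_gradVal_dot_le c hw v) (l := l) (by positivity)
      (by rw [hl]; linarith)
    have h := pi_sum_ge_le (n := N) ((measurable_gradVal_dot c w v).const_mul l) hm
      (N * (l * (drift D v c w + ε)))
    refine (measure_mono ?_).trans (h.trans (ENNReal.ofReal_le_ofReal (Real.exp_le_exp.2 ?_)))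
    · intro b hb
      have hb' : drift D v c w + ε ≤ batchGrad c w b ⬝ᵥ v := hb
      rw [batchGrad_dot, le_div_iff₀ hN'] at hb'
      simp only [Set.mem_ofPred_eq]
      rw [← Finset.mul_sum]
      have := mul_le_mul_of_nonneg_left hb' (by positivity : 0 ≤ l)
      linarith
    · change (N : ℝ) * (l * drift D v c w + 30 * l ^ 2) - N * (l * (drift D v c w + ε)) ≤ _
      rw [hl]
      apply le_of_eq
      ring
  · have hmeas : Measurable fun z : LabeledPoint d => z.1 ⬝ᵥ z.1 / 4 :=
      (Measurable.dot measurable_fst measurable_fst).div_const 4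
    have h := pi_sum_ge_le (n := N) hmeas (lintegral_exp_sq_norm_le hD) (5 * d * N / 4)
    refine (measure_mono ?_).trans (h.trans (ENNReal.ofReal_le_ofReal (Real.exp_le_exp.2 ?_)))
    · intro b hb
      have hb' : 5 * (d : ℝ) ≤ batchGrad c w b ⬝ᵥ batchGrad c w b := hb
      have h1 := hb'.trans (batchGrad_dot_self_le c hw b)
      rw [le_div_iff₀ hN'] at h1
      simp only [Set.mem_ofPred_eq]
      rw [← Finset.sum_div]
      linarith
    · apply le_of_eq
      ring

/-- The streams on which some batch is bad. -/
def runBad (D : Measure (LabeledPoint d)) (v : Vec d) (ε β : ℝ) (N : ℕ) :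
    ℕ → Set ((Vec d × Vec d) × (ℕ → LabeledPoint d))
  | 0 => ∅
  | T + 1 => {q | (q.1, first N q.2) ∈ stepBad D v ε N} ∪
      {q | ((q.1.1, psgdUpdate β q.1.1 q.1.2 (first N q.2)), shift N q.2) ∈ runBad D v ε β N T}

lemma measurableSet_runBad (v : Vec d) (ε β : ℝ) (N T : ℕ) :
    MeasurableSet (runBad D v ε β N T) := by
  induction T with
  | zero => exact MeasurableSet.empty
  | succ T ih =>
    have h1 : Measurable fun q : (Vec d × Vec d) × (ℕ → LabeledPoint d) => (q.1, first N q.2) :=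
      measurable_fst.prodMk ((measurable_first N).comp measurable_snd)
    refine (h1 (measurableSet_stepBad v ε N)).union ?_
    have h2 : Measurable fun q : (Vec d × Vec d) × (ℕ → LabeledPoint d) =>
        ((q.1.1, psgdUpdate β q.1.1 q.1.2 (first N q.2)), shift N q.2) :=
      (measurable_fst.fst.prodMk ((measurable_psgdUpdate β).comp h1)).prodMk
        ((measurable_shift N).comp measurable_snd)
    exact h2 ih

/-- Each batch is fresh and `r` bounds the failure at every unit vector, hence also at the random
iterate reached so far. The union over the steps gives the factor T. -/
lemma stream_runBad_le (v : Vec d) (ε β : ℝ) (N T : ℕ) {r : ℝ≥0∞}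
    (hr : ∀ c w : Vec d, w ⬝ᵥ w = 1 →
      Measure.pi (fun _ : Fin N => D) {b | ((c, w), b) ∈ stepBad D v ε N} ≤ r)
    (c w : Vec d) (hw : w ⬝ᵥ w = 1) :
    Measure.infinitePi (fun _ : ℕ => D) {ω | ((c, w), ω) ∈ runBad D v ε β N T} ≤ T * r := by
  induction T generalizing w with
  | zero =>
    have : {ω : ℕ → LabeledPoint d | ((c, w), ω) ∈ runBad D v ε β N 0} = ∅ := by
      ext ω; simp [runBad]
    simp [this]
  | succ T ih =>
    have h1 := stream_first_le (D := D) (n := N)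
      ((measurable_prodMk_left (x := (c, w))) (measurableSet_stepBad (D := D) v ε N))
    have hmeas : Measurable fun p : (Fin N → LabeledPoint d) × (ℕ → LabeledPoint d) =>
        ((c, psgdUpdate β c w p.1), p.2) := by
      have h : Measurable fun b : Fin N → LabeledPoint d => psgdUpdate β c w b :=
        (measurable_psgdUpdate (d := d) (N := N) β).comp (measurable_prodMk_left (x := (c, w)))
      exact (measurable_const.prodMk (h.comp measurable_fst)).prodMk measurable_snd
    have h2 := stream_le_of_forall_first (D := D) (n := N)
      (hmeas (measurableSet_runBad (D := D) v ε β N T)) (r := T * r)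
      fun S => ih _ (psgdUpdate_dot_self β c hw S)
    refine (measure_union_le _ _).trans ?_
    rw [Nat.cast_succ, add_mul, one_mul, add_comm]
    exact add_le_add h2 (h1.trans (hr c w hw))

/-! ### Convergence -/

/-- Both inequalities follow from β²Td = 1. The first keeps the second-order loss of a step below
its gain; the second makes T gains of βε exceed the range of a correlation. -/
lemma stepSize_facts {T : ℕ} {ε : ℝ} (hd : 1 ≤ d) (hε : 0 < ε)
    (hT : 4 * d / ε ^ 4 ≤ (T : ℝ)) :
    0 < stepSize d T ∧ stepSize d T * (2 * d) ≤ ε ^ 2 ∧ 2 ≤ T * stepSize d T * ε ^ 2 := by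
  have hd' : (1 : ℝ) ≤ d := by exact_mod_cast hd
  have hT0 : (0 : ℝ) < T := lt_of_lt_of_le (by positivity) hT
  rw [div_le_iff₀ (by positivity)] at hT
  have hpos : 0 < stepSize d T := Real.sqrt_pos.2 (by positivity)
  have hsq : stepSize d T ^ 2 * (T * d) = 1 := by
    rw [stepSize, Real.sq_sqrt (by positivity)]
    field_simp
  refine ⟨hpos, ?_, ?_⟩
  · refine (pow_le_pow_iff_left₀ (by positivity) (by positivity) two_ne_zero).1 ?_
    have h := mul_le_mul_of_nonneg_left hT
      (by positivity : 0 ≤ stepSize d T ^ 2 * d)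
    have h1 : stepSize d T ^ 2 * d * (T * ε ^ 4) = ε ^ 4 := by
      calc _ = stepSize d T ^ 2 * (T * d) * ε ^ 4 := by ring
        _ = _ := by rw [hsq, one_mul]
    nlinarith
  · refine (pow_le_pow_iff_left₀ (by positivity) (by positivity) two_ne_zero).1 ?_
    have h := mul_le_mul_of_nonneg_left hT (by positivity : 0 ≤ stepSize d T ^ 2 * T)
    have h1 : stepSize d T ^ 2 * T * (4 * d) = 4 := by
      calc _ = stepSize d T ^ 2 * (T * d) * 4 := by ring
        _ = _ := by rw [hsq, one_mul]
    nlinarith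

end

/-! ### Convergence of the descent and reliability of the validation sample. -/

section

open scoped ENNReal
open Prog

variable {d : ℕ} {D : Measure (LabeledPoint d)}

/-- The error that projected gradient descent achieves. -/
def targetError (ε : ℝ) : ℝ := 24 * Real.sqrt ε * Real.log (1 / ε)

lemma one_le_log_inv {ε : ℝ} (hε : 0 < ε) (hε' : ε ≤ 1 / 100) : 1 ≤ Real.log (1 / ε) := by
  rw [Real.le_log_iff_exp_le (by positivity), le_div_iff₀ hε]
  nlinarith [Real.exp_one_lt_d9]

lemma mul_log_inv_le_one {ε : ℝ} (hε : 0 < ε) : ε * Real.log (1 / ε) ≤ 1 := by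
  have h := Real.log_le_sub_one_of_pos (by positivity : 0 < 1 / ε)
  calc ε * Real.log (1 / ε) ≤ ε * (1 / ε) := mul_le_mul_of_nonneg_left (by linarith) hε.le
    _ = 1 := by field_simp

/-- Beyond the target error, p ≥ 12√ε ln(1/ε), so p²/4 ≥ 36ε ln²(1/ε). This pays for 3ε ln(1/ε) +
30ε and leaves 3ε, since ln(1/ε) ≥ 1. -/
lemma drift_le_of_targetError_lt [IsProbabilityMeasure D] (hD : D.map Prod.fst = stdNormal d) {v c w : Vec d}
    (hv : v ⬝ᵥ v = 1) (hw : w ⬝ᵥ w = 1) {ε : ℝ} (hε : 0 < ε) (hε' : ε ≤ 1 / 100)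
    (hγ : -ε ≤ w ⬝ᵥ v) (herr : condError D c v ≤ 3 * ε) (hbig : targetError ε < condError D c w) :
    drift D v c w ≤ -3 * ε := by
  obtain ⟨p, hp, hp0, hdrift⟩ := drift_le hD hv hw hε (by linarith) hγ herr
  have hL := one_le_log_inv hε hε'
  set L := Real.log (1 / ε)
  set q := Real.sqrt ε with hq
  have hq0 : 0 ≤ q := Real.sqrt_nonneg ε
  have hqε : q ^ 2 = ε := Real.sq_sqrt hε.le
  have hq1 : q ≤ 1 := Real.sqrt_le_one.2 (by linarith)
  unfold targetError at hbig
  have h1 : ε ≤ q := by rw [← hqε]; nlinarith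
  have h2 : q ≤ q * L := le_mul_of_one_le_right hq0 hL
  have h3 : 12 * (q * L) ≤ p := by linarith
  have h4 : 144 * (ε * L ^ 2) ≤ p ^ 2 := by
    have h := pow_le_pow_left₀ (by positivity) h3 2
    calc 144 * (ε * L ^ 2) = (12 * (q * L)) ^ 2 := by rw [← hqε]; ring
      _ ≤ p ^ 2 := h
  have h5 : ε * L ≤ ε * L ^ 2 := mul_le_mul_of_nonneg_left (by nlinarith) hε.le
  have h6 : ε ≤ ε * L := le_mul_of_one_le_right hε.le hL
  linarith

section step

variable {v c w : Vec d} {ε : ℝ} {N T : ℕ} {b : Fin N → LabeledPoint d}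

/-- On a good batch the sampling deviation costs βε, and the second-order term is at most (5/4)βε²,
less than another βε. -/
lemma le_dot_of_not_stepBad (hd : 1 ≤ d) (hv : v ⬝ᵥ v = 1) (hw : w ⬝ᵥ w = 1) (hε : 0 < ε)
    (hε' : ε ≤ 1 / 100) (hT : 4 * d / ε ^ 4 ≤ (T : ℝ)) (hb : ((c, w), b) ∉ stepBad D v ε N) :
    w ⬝ᵥ v - stepSize d T * (drift D v c w + 2 * ε) ≤
      psgdUpdate (stepSize d T) c w b ⬝ᵥ v := by
  obtain ⟨hβ, hβd, -⟩ := stepSize_facts hd hε hT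
  set β := stepSize d T
  have h1 : ¬ (drift D v c w + ε ≤ batchGrad c w b ⬝ᵥ v) := fun h => hb (Or.inl h)
  have h2 : ¬ (5 * (d : ℝ) ≤ batchGrad c w b ⬝ᵥ batchGrad c w b) := fun h => hb (Or.inr h)
  rw [not_le] at h1 h2
  have h := le_psgdUpdate_dot β c hw hv b
  have h3 := mul_le_mul_of_nonneg_left h1.le hβ.le
  have h4 : β ^ 2 * (batchGrad c w b ⬝ᵥ batchGrad c w b) ≤ β ^ 2 * (5 * d) :=
    mul_le_mul_of_nonneg_left h2.le (sq_nonneg β)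
  have h5 : β * (β * (2 * d)) ≤ β * ε ^ 2 := mul_le_mul_of_nonneg_left hβd hβ.le
  have h6 : β * ε ^ 2 ≤ β * (ε / 100) := mul_le_mul_of_nonneg_left (by nlinarith) hβ.le
  have h7 : 0 < β * ε := mul_pos hβ hε
  linarith

variable [IsProbabilityMeasure D]

/-- As long as all iterates have a large error, the correlation with `v` grows linearly. -/
lemma dot_add_le_one (hD : D.map Prod.fst = stdNormal d) (hd : 1 ≤ d) (hv : v ⬝ᵥ v = 1)
    (hε : 0 < ε) (hε' : ε ≤ 1 / 100) (hT : 4 * d / ε ^ 4 ≤ (T : ℝ))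
    (herr : condError D c v ≤ 3 * ε) (k : ℕ) (w : Vec d) (ω : ℕ → LabeledPoint d)
    (hw : w ⬝ᵥ w = 1) (hγ : -ε ≤ w ⬝ᵥ v) (hbig : targetError ε < condError D c w)
    (hω : ((c, w), ω) ∉ runBad D v ε (stepSize d T) N k)
    (hall : ∀ w' ∈ iterates (stepSize d T) N c k w ω, targetError ε < condError D c w') :
    w ⬝ᵥ v + k * (stepSize d T * ε) ≤ 1 := by
  induction k generalizing w ω with
  | zero =>
    have := abs_dot_le_sqrt w hv
    rw [hw, Real.sqrt_one] at this
    simpa using this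
  | succ k ih =>
    have hβ := (stepSize_facts hd hε hT).1
    have hb : ((c, w), first N ω) ∉ stepBad D v ε N := fun h => hω (Or.inl h)
    have hr : ((c, psgdUpdate (stepSize d T) c w (first N ω)), shift N ω) ∉
      runBad D v ε (stepSize d T) N k := fun h => hω (Or.inr h)
    have hstep := le_dot_of_not_stepBad hd hv hw hε hε' hT hb
    have hdrift := drift_le_of_targetError_lt hD hv hw hε hε' hγ herr hbig
    have h1 := mul_le_mul_of_nonneg_left hdrift hβ.le
    have h2 : 0 < stepSize d T * ε := mul_pos hβ hε
    have := ih _ _ (psgdUpdate_dot_self _ c hw (first N ω)) (by linarith)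
      (hall _ (by simp [iterates])) hr fun w' hw' => hall w' (by simp [iterates, hw'])
    push_cast
    linarith

/-- Some iterate of `PSGD` has a small error, if no batch is bad. -/
lemma exists_good_iterate (hD : D.map Prod.fst = stdNormal d) (hd : 1 ≤ d) (hv : v ⬝ᵥ v = 1)
    (hε : 0 < ε) (hε' : ε ≤ 1 / 100) (hT : 4 * d / ε ^ 4 ≤ (T : ℝ))
    (herr : condError D c v ≤ 3 * ε) (w : Vec d) (ω : ℕ → LabeledPoint d)
    (hw : w ⬝ᵥ w = 1) (hγ : 0 ≤ w ⬝ᵥ v)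
    (hω : ((c, w), ω) ∉ runBad D v ε (stepSize d T) N T) :
    ∃ w' ∈ iterates (stepSize d T) N c T w ω, condError D c w' ≤ targetError ε := by
  by_contra! hall
  obtain ⟨hβ, hβd, hβT⟩ := stepSize_facts hd hε hT
  obtain ⟨k, rfl⟩ : ∃ k, T = k + 1 := by
    refine ⟨T - 1, (Nat.succ_pred_eq_of_pos ?_).symm⟩
    rcases Nat.eq_zero_or_pos T with rfl | h
    · norm_num at hβT
    · exact h
  set β := stepSize d (k + 1)
  have hb : ((c, w), first N ω) ∉ stepBad D v ε N := fun h => hω (Or.inl h)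
  have hr : ((c, psgdUpdate β c w (first N ω)), shift N ω) ∉ runBad D v ε β N k :=
    fun h => hω (Or.inr h)
  have hstep := le_dot_of_not_stepBad hd hv hw hε hε' hT hb
  -- The starting vector is not among the iterates, so nothing is known about its error and the
  -- first step may lose correlation. The loss is at most 4β ≤ 2ε² ≤ ε, which is why the drift
  -- bounds tolerate ⟨w,v⟩ ≥ -ε.
  obtain ⟨p, -, hp0, hdrift⟩ := drift_le hD hv hw hε (by linarith) (by linarith) herr
  have hd' : (1 : ℝ) ≤ d := by exact_mod_cast hd
  have hβ2 : β * 2 ≤ ε ^ 2 := le_trans (by nlinarith) hβd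
  have hlog := mul_log_inv_le_one hε
  have h1 : β * (drift D v c w + 2 * ε) ≤ β * 4 :=
    mul_le_mul_of_nonneg_left (by nlinarith [sq_nonneg p]) hβ.le
  have hγ1 : -ε ≤ psgdUpdate β c w (first N ω) ⬝ᵥ v := by nlinarith
  have := dot_add_le_one hD hd hv hε hε' hT herr k _ _ (psgdUpdate_dot_self _ c hw (first N ω)) hγ1
    (hall _ (by simp [iterates, β])) hr fun w' hw' => hall w' (by
      simp only [iterates, List.mem_cons]; exact Or.inr hw')
  -- Tβε² ≥ 2 and ε ≤ 1/100 give Tβε ≥ 200, far more than the correlation can gain in the T - 1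
  -- remaining steps.
  have h3 : 200 ≤ ((k + 1 : ℕ) : ℝ) * β * ε := by
    by_contra! h
    have : ((k + 1 : ℕ) : ℝ) * β * ε ^ 2 < 2 := by nlinarith
    linarith
  push_cast at h3
  nlinarith

lemma iterates_unit (β : ℝ) (c : Vec d) (k : ℕ) (w : Vec d) (ω : ℕ → LabeledPoint d)
    (hw : w ⬝ᵥ w = 1) : ∀ w' ∈ iterates β N c k w ω, w' ⬝ᵥ w' = 1 := by
  induction k generalizing w ω with
  | zero => simp [iterates]
  | succ k ih =>
    intro w' hw'
    rw [iterates, List.mem_cons] at hw'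
    rcases hw' with rfl | hw'
    · exact psgdUpdate_dot_self β c hw _
    · exact ih _ _ (psgdUpdate_dot_self β c hw _) w' hw'

end step

variable [IsProbabilityMeasure D]

/-! ### Validation -/

/-- The validation samples on which the empirical error of a selector is misleading. -/
def validBad (D : Measure (LabeledPoint d)) (p : ℝ) (n : ℕ) :
    Set ((Vec d × Vec d) × (Fin n → LabeledPoint d)) :=
  {q | condError D q.1.1 q.1.2 ≤ p ∧ 4 * p ≤ empErr q.2 q.1.1 q.1.2} ∪
    {q | 12 * p < condError D q.1.1 q.1.2 ∧ empErr q.2 q.1.1 q.1.2 ≤ 4 * p}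

lemma measurableSet_error_pair :
    MeasurableSet {q : (Vec d × Vec d) × LabeledPoint d |
      q.2.1 ∈ halfspace q.1.2 ∧ classify q.1.1 q.2.1 ≠ q.2.2} := by
  have hm : Measurable fun q : (Vec d × Vec d) × LabeledPoint d => (q.1.1, q.2) :=
    measurable_fst.fst.prodMk measurable_snd
  have hh : Measurable fun q : (Vec d × Vec d) × LabeledPoint d => (q.1.2, q.2) :=
    measurable_fst.snd.prodMk measurable_snd
  have h1 := hm measurableSet_mistake
  have h2 := hh measurableSet_halfspace
  simp only [mistake_iff] at h1
  exact h2.inter h1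

lemma measurable_condError : Measurable fun q : Vec d × Vec d => condError D q.1 q.2 :=
  (measurable_measure_prodMk_left (ν := D) measurableSet_error_pair).ennreal_toReal

lemma measurable_empErr {n : ℕ} :
    Measurable fun q : (Vec d × Vec d) × (Fin n → LabeledPoint d) => empErr q.2 q.1.1 q.1.2 := by
  unfold empErr
  refine Measurable.div_const (Finset.measurable_sum _ fun i _ => ?_) _
  have h : Measurable fun q : (Vec d × Vec d) × (Fin n → LabeledPoint d) => (q.1, q.2 i) :=
    measurable_fst.prodMk ((measurable_pi_apply i).comp measurable_snd)
  exact Measurable.ite (h measurableSet_error_pair) measurable_const measurable_const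

lemma measurableSet_validBad (p : ℝ) (n : ℕ) : MeasurableSet (validBad D p n) := by
  have h1 : Measurable fun q : (Vec d × Vec d) × (Fin n → LabeledPoint d) =>
      condError D q.1.1 q.1.2 := (measurable_condError (D := D)).comp measurable_fst
  have h2 := measurable_empErr (d := d) (n := n)
  exact ((measurableSet_le h1 measurable_const).inter (measurableSet_le measurable_const h2)).union
    ((measurableSet_lt measurable_const h1).inter (measurableSet_le h2 measurable_const))

/-- The Poisson form of the moment bound measures deviations relative to the probability, so the
validation sample scales inversely with the error level and not with its square. -/
lemma lintegral_exp_indicator {A : Set (LabeledPoint d)} (hA : MeasurableSet A) (l : ℝ) :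
    ∫⁻ z, ENNReal.ofReal (Real.exp (l * A.indicator (fun _ => (1 : ℝ)) z)) ∂D ≤
      ENNReal.ofReal (Real.exp ((Real.exp l - 1) * D.real A)) := by
  have hpt : ∀ z, Real.exp (l * A.indicator (fun _ => (1 : ℝ)) z) =
      1 + A.indicator (fun _ => Real.exp l - 1) z := fun z => by
    by_cases h : z ∈ A <;> simp [h]
  have hi : Integrable (fun z => 1 + A.indicator (fun _ => Real.exp l - 1) z) D :=
    (integrable_const 1).add ((integrable_const _).indicator hA)
  simp_rw [hpt]
  rw [← ofReal_integral_eq_lintegral_ofReal hi (Filter.Eventually.of_forall fun z => by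
    exact (Real.exp_pos _).le.trans_eq (hpt z))]
  refine ENNReal.ofReal_le_ofReal ?_
  rw [integral_add (integrable_const 1) ((integrable_const _).indicator hA),
    integral_indicator_const _ hA]
  refine le_trans ?_ (Real.add_one_le_exp _)
  simp only [integral_const, probReal_univ, smul_eq_mul, mul_one]
  linarith

/-- The empirical error on the validation sample is reliable. -/
lemma pi_validBad_le (c w : Vec d) {p : ℝ} (hp : 0 ≤ p) {n : ℕ} (hn : 0 < n) :
    Measure.pi (fun _ : Fin n => D) {S | ((c, w), S) ∈ validBad D p n} ≤
      ENNReal.ofReal (Real.exp (-(n * p))) + ENNReal.ofReal (Real.exp (-(n * p))) := by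
  classical
  have hn' : (0 : ℝ) < n := by exact_mod_cast hn
  have hA := measurableSet_error c w
  set A : Set (LabeledPoint d) := {z | z.1 ∈ halfspace w ∧ classify c z.1 ≠ z.2}
  have hmeas : ∀ l : ℝ, Measurable fun z => l * A.indicator (fun _ => (1 : ℝ)) z := fun l =>
    (measurable_const.indicator hA).const_mul l
  have hemp : ∀ S : Fin n → LabeledPoint d,
      empErr S c w = (∑ i, A.indicator (fun _ => (1 : ℝ)) (S i)) / n := fun S => by
    unfold empErr
    congr 1
    refine Finset.sum_congr rfl fun i _ => ?_
    rw [Set.indicator_apply]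
    congr
  -- The exponents become 2np - 4np for overestimation, from e - 1 ≤ 2, and -6np + 4np for
  -- underestimation, from e⁻¹ - 1 ≤ -1/2.
  have he1 : Real.exp 1 - 1 ≤ 2 := by linarith [Real.exp_one_lt_d9]
  have he2 : Real.exp (-1) - 1 ≤ -1 / 2 := by
    have h2 : (2 : ℝ) ≤ Real.exp 1 := by linarith [Real.add_one_le_exp (1 : ℝ)]
    have : Real.exp (-1) ≤ 1 / 2 := by
      rw [Real.exp_neg, one_div]; exact inv_anti₀ two_pos h2
    linarith
  refine (measure_union_le _ _).trans (add_le_add ?_ ?_)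
  · by_cases herr : condError D c w ≤ p
    · have h := pi_sum_ge_le (n := n) (hmeas 1) (lintegral_exp_indicator (D := D) hA 1) (n * (4 * p))
      refine (measure_mono ?_).trans (h.trans (ENNReal.ofReal_le_ofReal (Real.exp_le_exp.2 ?_)))
      · rintro S ⟨-, hS⟩
        have hS' : 4 * p ≤ empErr S c w := hS
        rw [hemp, le_div_iff₀ hn'] at hS'
        simp only [Set.mem_ofPred_eq, one_mul]
        linarith
      · have h1 : (Real.exp 1 - 1) * D.real A ≤ 2 * p :=
          mul_le_mul he1 herr measureReal_nonneg zero_le_two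
        have h2 := mul_le_mul_of_nonneg_left h1 hn'.le
        nlinarith
    · exact (measure_mono (t := ∅) fun S hS => herr hS.1).trans (by simp)
  · by_cases herr : 12 * p < condError D c w
    · have h := pi_sum_ge_le (n := n) (hmeas (-1)) (lintegral_exp_indicator (D := D) hA (-1)) (-(n * (4 * p)))
      refine (measure_mono ?_).trans (h.trans (ENNReal.ofReal_le_ofReal (Real.exp_le_exp.2 ?_)))
      · rintro S ⟨-, hS⟩
        have hS' : empErr S c w ≤ 4 * p := hS
        rw [hemp, div_le_iff₀ hn'] at hS'
        simp only [Set.mem_ofPred_eq]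
        rw [← Finset.mul_sum]
        linarith
      · have h0 : 12 * p < D.real A := herr
        have h1 : (Real.exp (-1) - 1) * D.real A ≤ -(6 * p) := by
          nlinarith [measureReal_nonneg (μ := D) (s := A)]
        have h2 := mul_le_mul_of_nonneg_left h1 hn'.le
        nlinarith
    · exact (measure_mono (t := ∅) fun S hS => herr hS.1).trans (by simp)

end

section

open scoped ENNReal
open Prog

variable {d : ℕ} {D : Measure (LabeledPoint d)}

/-! ### Selecting a pair -/

lemma bothIterates_unit {T N : ℕ} {w₀ : Vec d} (hw₀ : w₀ ⬝ᵥ w₀ = 1) (c : Vec d)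
    (ω : ℕ → LabeledPoint d) : ∀ w ∈ bothIterates T N w₀ c ω, w ⬝ᵥ w = 1 := by
  intro w hw
  rcases List.mem_append.1 hw with hw | hw
  · exact iterates_unit _ c T w₀ ω hw₀ w hw
  · exact iterates_unit _ c T (-w₀) _ (by simpa using hw₀) w hw

/-- The pair `(c, w(c))` found by one iteration of the loop of `ccfc`. -/
def selectedPair {n : ℕ} (S : Fin n → LabeledPoint d) (T N : ℕ) (w₀ c : Vec d)
    (ω : ℕ → LabeledPoint d) : Vec d × Vec d :=
  (c, ((argminVal (empErr S c) (bothIterates T N w₀ c ω)).map Prod.fst).getD 0)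

section selection

variable {n T : ℕ} (S : Fin n → LabeledPoint d) (hT : 0 < T) (N : ℕ) (w₀ : Vec d)
include hT

lemma bothIterates_ne_nil (c : Vec d) (ω : ℕ → LabeledPoint d) : bothIterates T N w₀ c ω ≠ [] := by
  intro h
  have := congrArg List.length h
  rw [length_bothIterates] at this
  simp at this
  omega

/-- For T > 0 there are iterates, so the default 0 in `selectedPair` is never used. -/
lemma selectedPair_spec (c : Vec d) (ω : ℕ → LabeledPoint d) :
    (selectedPair S T N w₀ c ω).2 ∈ bothIterates T N w₀ c ω ∧
      ∀ w ∈ bothIterates T N w₀ c ω, empErr S c (selectedPair S T N w₀ c ω).2 ≤ empErr S c w := by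
  obtain ⟨w, hw, hv, hmin⟩ := exists_argminVal (empErr S c) (bothIterates T N w₀ c ω)
    (bothIterates_ne_nil hT N w₀ c ω)
  have h : (selectedPair S T N w₀ c ω).2 = w := by simp [selectedPair, hv]
  rw [h]
  exact ⟨hw, hmin⟩

lemma selectorStep_eq (acc : List (Vec d × Vec d)) (c : Vec d) (ω : ℕ → LabeledPoint d) :
    selectorStep S T N w₀ acc c ω = selectedPair S T N w₀ c ω :: acc := by
  obtain ⟨w, hw, hv, hmin⟩ := exists_argminVal (empErr S c) (bothIterates T N w₀ c ω)
    (bothIterates_ne_nil hT N w₀ c ω)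
  simp [selectorStep, selectedPair, hv]

lemma mem_selectorPairs (C : List (Vec d)) (ω : ℕ → LabeledPoint d) (x : Vec d × Vec d) :
    x ∈ selectorPairs S T N w₀ C ω ↔ ∃ k, ∃ hk : k < C.length,
      x = selectedPair S T N w₀ C[k] (shift (k * (2 * (T * N))) ω) := by
  rw [selectorPairs, mem_streamFold (selectorStep_eq S hT N w₀)]
  simp

/-- If the validation sample is reliable and some candidate has a good iterate, then a good pair is
selected. -/
lemma exists_ccfcVal_eq {p : ℝ} (C : List (Vec d)) (hw₀ : w₀ ⬝ᵥ w₀ = 1) (ω : ℕ → LabeledPoint d)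
    (hV : ∀ k, ∀ hk : k < C.length,
      ∀ w ∈ bothIterates T N w₀ C[k] (shift (k * (2 * (T * N))) (shift n ω)),
        ((C[k], w), first n ω) ∉ validBad D p n)
    (hG : ∃ k, ∃ hk : k < C.length,
      ∃ w ∈ bothIterates T N w₀ C[k] (shift (k * (2 * (T * N))) (shift n ω)),
        condError D C[k] w ≤ p) :
    ∃ c w : Vec d, ccfcVal T N n w₀ C ω = some (c, w) ∧ c ∈ C ∧ w ⬝ᵥ w = 1 ∧
      condError D c w ≤ 12 * p := by
  obtain ⟨k, hk, w, hw, herr⟩ := hG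
  obtain ⟨hsel, hselmin⟩ := selectedPair_spec (first n ω) hT N w₀ C[k]
    (shift (k * (2 * (T * N))) (shift n ω))
  have hmem := (mem_selectorPairs (first n ω) hT N w₀ C (shift n ω) _).2 ⟨k, hk, rfl⟩
  obtain ⟨b, hb, hbv, hbmin⟩ := exists_argminVal
    (fun q : Vec d × Vec d => empErr (first n ω) q.1 q.2)
    (selectorPairs (first n ω) T N w₀ C (shift n ω)) (List.ne_nil_of_mem hmem)
  -- The level 4p separates: pairs of error at most p lie below it and pairs of error above 12p lie
  -- above it, so the empirical minimiser is not of the second kind.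
  have h1 : empErr (first n ω) C[k] w < 4 * p := by
    by_contra! h
    exact hV k hk w hw (Or.inl ⟨herr, h⟩)
  have h2 : empErr (first n ω) b.1 b.2 < 4 * p :=
    ((hbmin _ hmem).trans (hselmin w hw)).trans_lt h1
  obtain ⟨k', hk', rfl⟩ := (mem_selectorPairs (first n ω) hT N w₀ C (shift n ω) b).1 hb
  have hsel' := (selectedPair_spec (first n ω) hT N w₀ C[k']
    (shift (k' * (2 * (T * N))) (shift n ω))).1
  refine ⟨C[k'], _, ?_, List.getElem_mem hk', bothIterates_unit hw₀ _ _ _ hsel', ?_⟩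
  · rw [ccfcVal, hbv]
    rfl
  · by_contra! h
    exact hV k' hk' _ hsel' (Or.inr ⟨h, h2.le⟩)

end selection

/-! ### The bad events of conditional classification -/

lemma measurableSet_exists_iterate {Y : Type*} [MeasurableSpace Y]
    {V : Set ((Vec d × Vec d) × Y)} (hV : MeasurableSet V) (β : ℝ) (N T : ℕ) :
    MeasurableSet {q : ((Vec d × Vec d) × (ℕ → LabeledPoint d)) × Y |
      ∃ w ∈ iterates β N q.1.1.1 T q.1.1.2 q.1.2, ((q.1.1.1, w), q.2) ∈ V} := by
  induction T with
  | zero =>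
    simp only [iterates, List.not_mem_nil, false_and, exists_false]
    exact MeasurableSet.const _
  | succ T ih =>
    simp only [iterates, List.mem_cons, exists_eq_or_imp]
    have h1 : Measurable fun q : ((Vec d × Vec d) × (ℕ → LabeledPoint d)) × Y =>
        psgdUpdate β q.1.1.1 q.1.1.2 (first N q.1.2) :=
      (measurable_psgdUpdate (d := d) (N := N) β).comp (measurable_fst.fst.prodMk
        ((measurable_first N).comp measurable_fst.snd))
    have h2 : Measurable fun q : ((Vec d × Vec d) × (ℕ → LabeledPoint d)) × Y =>
        ((q.1.1.1, psgdUpdate β q.1.1.1 q.1.1.2 (first N q.1.2)), q.2) :=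
      (measurable_fst.fst.fst.prodMk h1).prodMk measurable_snd
    have h3 : Measurable fun q : ((Vec d × Vec d) × (ℕ → LabeledPoint d)) × Y =>
        (((q.1.1.1, psgdUpdate β q.1.1.1 q.1.1.2 (first N q.1.2)), shift N q.1.2), q.2) :=
      ((measurable_fst.fst.fst.prodMk h1).prodMk
        ((measurable_shift N).comp measurable_fst.snd)).prodMk measurable_snd
    exact (h2 hV).union (h3 ih)

lemma measure_exists_mem_list_le {α β : Type*} [MeasurableSpace α] (μ : Measure α) (l : List β)
    (E : β → Set α) {r : ℝ≥0∞} (h : ∀ b ∈ l, μ (E b) ≤ r) :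
    μ {x | ∃ b ∈ l, x ∈ E b} ≤ l.length * r := by
  induction l with
  | nil => simp
  | cons b l ih =>
    have hsub : {x | ∃ b' ∈ b :: l, x ∈ E b'} ⊆ {x | ∃ b' ∈ l, x ∈ E b'} ∪ E b := by
      rintro x ⟨b', hb', hx⟩
      rcases List.mem_cons.1 hb' with rfl | hb'
      · exact Or.inr hx
      · exact Or.inl ⟨b', hb', hx⟩
    refine (measure_mono hsub).trans ((measure_union_le _ _).trans ?_)
    rw [List.length_cons, Nat.cast_succ, add_mul, one_mul]
    exact add_le_add (ih fun b' hb' => h b' (List.mem_cons_of_mem _ hb'))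
      (h b (List.mem_cons_self ..))

open Classical in
/-- The starting point with a nonnegative correlation with `v`. -/
def goodStart (v w₀ : Vec d) : Vec d := if 0 ≤ w₀ ⬝ᵥ v then w₀ else -w₀

open Classical in
/-- The number of examples read before the run from `goodStart`. -/
def goodOffset (v w₀ : Vec d) (T N : ℕ) : ℕ := if 0 ≤ w₀ ⬝ᵥ v then 0 else T * N

/-- The streams on which the run of `PSGD` from the good starting point for the `k`-th candidate
has a bad batch. -/
def descentBad (D : Measure (LabeledPoint d)) (v w₀ : Vec d) (ε : ℝ) (T N n k : ℕ) :
    Set (Vec d × (ℕ → LabeledPoint d)) :=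
  {q | ((q.1, goodStart v w₀), shift (n + k * (2 * (T * N)) + goodOffset v w₀ T N) q.2) ∈
    runBad D v ε (stepSize d T) N T}

/-- The streams on which the validation sample is misleading for an iterate for the `k`-th
candidate. -/
def selectBad (D : Measure (LabeledPoint d)) (p : ℝ) (w₀ : Vec d) (T N n k : ℕ) :
    Set (Vec d × (ℕ → LabeledPoint d)) :=
  {q | ∃ w ∈ bothIterates T N w₀ q.1 (shift (k * (2 * (T * N))) (shift n q.2)),
    ((q.1, w), first n q.2) ∈ validBad D p n}

variable [IsProbabilityMeasure D]

lemma measurableSet_descentBad (v w₀ : Vec d) (ε : ℝ) (T N n k : ℕ) :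
    MeasurableSet (descentBad D v w₀ ε T N n k) := by
  have h : Measurable fun q : Vec d × (ℕ → LabeledPoint d) =>
      ((q.1, goodStart v w₀), shift (n + k * (2 * (T * N)) + goodOffset v w₀ T N) q.2) :=
    (measurable_fst.prodMk measurable_const).prodMk ((measurable_shift _).comp measurable_snd)
  exact h (measurableSet_runBad v ε (stepSize d T) N T)

lemma measurableSet_exists_bothIterates {Y : Type*} [MeasurableSpace Y]
    {V : Set ((Vec d × Vec d) × Y)} (hV : MeasurableSet V) (w₀ : Vec d) (T N : ℕ) :
    MeasurableSet {q : (Vec d × (ℕ → LabeledPoint d)) × Y |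
      ∃ w ∈ bothIterates T N w₀ q.1.1 q.1.2, ((q.1.1, w), q.2) ∈ V} := by
  simp only [bothIterates, List.mem_append, or_and_right, exists_or]
  have h1 : Measurable fun q : (Vec d × (ℕ → LabeledPoint d)) × Y => (((q.1.1, w₀), q.1.2), q.2) :=
    ((measurable_fst.fst.prodMk measurable_const).prodMk measurable_fst.snd).prodMk measurable_snd
  have h2 : Measurable fun q : (Vec d × (ℕ → LabeledPoint d)) × Y =>
      (((q.1.1, -w₀), shift (T * N) q.1.2), q.2) :=
    ((measurable_fst.fst.prodMk measurable_const).prodMk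
      ((measurable_shift _).comp measurable_fst.snd)).prodMk measurable_snd
  have h3 := measurableSet_exists_iterate hV (stepSize d T) N T
  exact (h1 h3).union (h2 h3)

lemma measurableSet_selectBad (p : ℝ) (w₀ : Vec d) (T N n k : ℕ) :
    MeasurableSet (selectBad D p w₀ T N n k) := by
  have h : Measurable fun q : Vec d × (ℕ → LabeledPoint d) =>
      ((q.1, shift (k * (2 * (T * N))) (shift n q.2)), first n q.2) :=
    (measurable_fst.prodMk ((measurable_shift _).comp ((measurable_shift n).comp
      measurable_snd))).prodMk ((measurable_first n).comp measurable_snd)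
  exact h (measurableSet_exists_bothIterates (measurableSet_validBad (D := D) p n) w₀ T N)

omit [IsProbabilityMeasure D] in
lemma goodStart_spec (v : Vec d) {w₀ : Vec d} (hw₀ : w₀ ⬝ᵥ w₀ = 1) :
    goodStart v w₀ ⬝ᵥ goodStart v w₀ = 1 ∧ 0 ≤ goodStart v w₀ ⬝ᵥ v := by
  unfold goodStart
  split_ifs with h
  · exact ⟨hw₀, h⟩
  · rw [not_le] at h
    refine ⟨by simpa using hw₀, ?_⟩
    rw [neg_dotProduct]; linarith

/-- Dropping an initial segment does not change the law of the stream, so the offset is harmless. -/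
lemma stream_descentBad_le {v w₀ : Vec d} (hw₀ : w₀ ⬝ᵥ w₀ = 1) (ε : ℝ) (T N n k : ℕ) {r : ℝ≥0∞}
    (hr : ∀ c w : Vec d, w ⬝ᵥ w = 1 →
      Measure.pi (fun _ : Fin N => D) {b | ((c, w), b) ∈ stepBad D v ε N} ≤ r) (c : Vec d) :
    Measure.infinitePi (fun _ : ℕ => D) {ω | (c, ω) ∈ descentBad D v w₀ ε T N n k} ≤ T * r :=
  (stream_shift_le (D := D) ((measurable_prodMk_left (x := (c, goodStart v w₀)))
    (measurableSet_runBad (D := D) v ε (stepSize d T) N T))).trans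
    (stream_runBad_le v ε (stepSize d T) N T hr c _ (goodStart_spec v hw₀).1)

/-- Once the stream after the validation sample is frozen, the 2T iterates are fixed vectors and the
union bound concerns the sample alone. -/
lemma stream_selectBad_le (p : ℝ) (w₀ : Vec d) (T N n k : ℕ) {r : ℝ≥0∞}
    (hr : ∀ c w : Vec d,
      Measure.pi (fun _ : Fin n => D) {S | ((c, w), S) ∈ validBad D p n} ≤ r) (c : Vec d) :
    Measure.infinitePi (fun _ : ℕ => D) {ω | (c, ω) ∈ selectBad D p w₀ T N n k} ≤
      (2 * T : ℕ) * r := by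
  have h : Measurable fun q : (Fin n → LabeledPoint d) × (ℕ → LabeledPoint d) =>
      ((c, shift (k * (2 * (T * N))) q.2), q.1) :=
    (measurable_const.prodMk ((measurable_shift _).comp measurable_snd)).prodMk measurable_fst
  refine stream_le_of_forall_shift (D := D) (n := n)
    (h (measurableSet_exists_bothIterates (measurableSet_validBad (D := D) p n) w₀ T N))
    fun ω => ?_
  have := measure_exists_mem_list_le (Measure.pi fun _ : Fin n => D)
    (bothIterates T N w₀ c (shift (k * (2 * (T * N))) ω)) (fun w => {S | ((c, w), S) ∈ validBad D p n})
    fun w _ => hr c w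
  rw [length_bothIterates] at this
  exact this

/-- Conditional classification succeeds outside of the bad events. -/
lemma exists_ccfcVal_eq_of_not_bad (hD : D.map Prod.fst = stdNormal d) (hd : 1 ≤ d) {v w₀ : Vec d}
    (hv : v ⬝ᵥ v = 1) (hw₀ : w₀ ⬝ᵥ w₀ = 1) {ε : ℝ} (hε : 0 < ε) (hε' : ε ≤ 1 / 100) {T N n : ℕ}
    (hT : 4 * d / ε ^ 4 ≤ (T : ℝ)) (C : List (Vec d)) (ω : ℕ → LabeledPoint d)
    (h1 : ∀ k, ∀ hk : k < C.length, (C[k], ω) ∉ descentBad D v w₀ ε T N n k)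
    (h2 : ∀ k, ∀ hk : k < C.length, (C[k], ω) ∉ selectBad D (targetError ε) w₀ T N n k)
    (hC : ∃ c ∈ C, condError D c v ≤ 3 * ε) :
    ∃ c w : Vec d, ccfcVal T N n w₀ C ω = some (c, w) ∧ c ∈ C ∧ w ⬝ᵥ w = 1 ∧
      condError D c w ≤ 12 * targetError ε := by
  have hT0 : 0 < T := by
    have hd' : (1 : ℝ) ≤ d := by exact_mod_cast hd
    have : (0 : ℝ) < T := lt_of_lt_of_le (by positivity) hT
    exact_mod_cast this
  refine exists_ccfcVal_eq hT0 N w₀ C hw₀ ω (fun k hk w hw hbad => h2 k hk ⟨w, hw, hbad⟩) ?_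
  obtain ⟨c, hc, herr⟩ := hC
  obtain ⟨k, hk, rfl⟩ := List.getElem_of_mem hc
  obtain ⟨hs1, hs2⟩ := goodStart_spec v hw₀
  obtain ⟨w, hw, hwerr⟩ := exists_good_iterate hD hd hv hε hε' hT herr _ _ hs1 hs2 (h1 k hk)
  refine ⟨k, hk, w, ?_, hwerr⟩
  rw [bothIterates, List.mem_append, shift_shift, shift_shift]
  unfold goodStart goodOffset at hw
  split_ifs at hw with h
  · exact Or.inl hw
  · exact Or.inr hw

end

/-! ### Vertices of polyhedra and sparse vectors. -/

section

open Prog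

variable {d s : ℕ}

/-! ### Linear inequalities -/

/-- If no nonzero vector is orthogonal to all rows, the rows span, and a basis chosen among them has
exactly s members. -/
lemma exists_regular_rows {ι : Type*} (a : ι → Fin s → ℝ)
    (ha : ∀ h : Fin s → ℝ, (∀ j, a j ⬝ᵥ h = 0) → h = 0) :
    ∃ J : Fin s → ι, (Matrix.of fun i => a (J i)).det ≠ 0 := by
  have hspan : Submodule.span ℝ (Set.range a) = ⊤ := by
    by_contra hne
    obtain ⟨f, hf, hle⟩ := Submodule.exists_le_ker_of_lt_top _ (lt_top_iff_ne_top.2 hne)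
    have hfx : ∀ x, f x = x ⬝ᵥ fun k => f (Pi.single k 1) := fun x => by
      conv_lhs => rw [pi_eq_sum_univ' x, map_sum]
      simp only [map_smul, smul_eq_mul, dotProduct]
    have h0 := ha (fun k => f (Pi.single k 1)) fun j => by
      rw [← hfx]
      exact hle (Submodule.subset_span ⟨j, rfl⟩)
    exact hf (LinearMap.ext fun x => by rw [hfx, h0]; simp)
  obtain ⟨κ, b, -, hb, hli⟩ := exists_linearIndependent' ℝ a
  have B := Module.Basis.mk hli (by rw [hb, hspan])
  have e : Fin s ≃ κ := (Pi.basisFun ℝ (Fin s)).indexEquiv B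
  refine ⟨b ∘ e, ?_⟩
  have : LinearIndependent ℝ (Matrix.of fun i => a ((b ∘ e) i)).row :=
    hli.comp e e.injective
  rw [Matrix.linearIndependent_rows_iff_isUnit, Matrix.isUnit_iff_isUnit_det] at this
  exact this.ne_zero

/-- If the normal vectors of a feasible system of linear inequalities span the space, then the
feasible region has a vertex. -/
lemma exists_vertex {ι : Type*} [Finite ι] (a : ι → Fin s → ℝ) (b : ι → ℝ)
    (ha : ∀ h : Fin s → ℝ, (∀ j, a j ⬝ᵥ h = 0) → h = 0)
    (hfeas : ∃ u : Fin s → ℝ, ∀ j, b j ≤ a j ⬝ᵥ u) :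
    ∃ u : Fin s → ℝ, (∀ j, b j ≤ a j ⬝ᵥ u) ∧ ∃ J : Fin s → ι,
      (Matrix.of fun i => a (J i)).det ≠ 0 ∧ ∀ i, a (J i) ⬝ᵥ u = b (J i) := by
  classical
  have := Fintype.ofFinite ι
  set F : Set (Fin s → ℝ) := {u | ∀ j, b j ≤ a j ⬝ᵥ u}
  set t : (Fin s → ℝ) → Finset ι := fun u => Finset.univ.filter fun j => a j ⬝ᵥ u = b j with htdef
  -- A vertex is a feasible point with the largest number of tight constraints.
  obtain ⟨u, hu, hmax⟩ : ∃ u ∈ F, ∀ u' ∈ F, (t u').card ≤ (t u).card := by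
    have hfin : ((fun u => (t u).card) '' F).Finite :=
      (Set.finite_Iic (Fintype.card ι)).subset (by
        rintro _ ⟨u, -, rfl⟩
        exact Finset.card_le_univ _)
    obtain ⟨u, hu, h⟩ := Set.exists_max_image ((fun u => (t u).card) '' F) id hfin
      (Set.Nonempty.image _ hfeas)
    obtain ⟨u, hu, rfl⟩ := hu
    exact ⟨u, hu, fun u' hu' => h _ ⟨u', hu', rfl⟩⟩
  have htight : ∀ h : Fin s → ℝ, (∀ j : {j // a j ⬝ᵥ u = b j}, a j ⬝ᵥ h = 0) → h = 0 := by
    intro h hh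
    by_contra hne
    -- A direction along which tight constraints stay tight, with the sign chosen so that some
    -- constraint decreases.
    obtain ⟨h, hh, j₀, hj₀⟩ : ∃ h : Fin s → ℝ, (∀ j, a j ⬝ᵥ u = b j → a j ⬝ᵥ h = 0) ∧
        ∃ j, a j ⬝ᵥ h < 0 := by
      obtain ⟨j, hj⟩ : ∃ j, a j ⬝ᵥ h ≠ 0 := by
        by_contra! hall
        exact hne (ha h hall)
      rcases lt_or_gt_of_ne hj with hj | hj
      · exact ⟨h, fun j hj => hh ⟨j, hj⟩, j, hj⟩
      · refine ⟨-h, fun j hj => ?_, j, ?_⟩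
        · rw [dotProduct_neg, hh ⟨j, hj⟩, neg_zero]
        · rw [dotProduct_neg]; linarith
    set N : Finset ι := Finset.univ.filter fun j => a j ⬝ᵥ h < 0
    -- The ratio test of the simplex method: r is the longest feasible step, and the constraint k
    -- that limits it becomes tight, against maximality.
    obtain ⟨k, hk, hmin⟩ := N.exists_min_image (fun j => (a j ⬝ᵥ u - b j) / -(a j ⬝ᵥ h))
      ⟨j₀, by simp [N, hj₀]⟩
    simp only [N, Finset.mem_filter, Finset.mem_univ, true_and] at hk hmin
    set r := (a k ⬝ᵥ u - b k) / -(a k ⬝ᵥ h) with hr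
    have hr0 : 0 ≤ r := div_nonneg (by linarith [hu k]) (by linarith)
    have hdot : ∀ j, a j ⬝ᵥ (u + r • h) = a j ⬝ᵥ u + r * (a j ⬝ᵥ h) := fun j => by
      rw [dotProduct_add, dotProduct_smul, smul_eq_mul]
    have hfeas' : u + r • h ∈ F := fun j => by
      rw [hdot]
      rcases lt_or_ge (a j ⬝ᵥ h) 0 with hj | hj
      · have := hmin j hj
        rw [le_div_iff₀ (by linarith)] at this
        linarith
      · have := hu j
        have := mul_nonneg hr0 hj
        linarith
    have hk0 : a k ⬝ᵥ u ≠ b k := fun h' => by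
      have := hh k h'
      linarith
    have hsub : insert k (t u) ⊆ t (u + r • h) := by
      intro j hj
      simp only [htdef, Finset.mem_insert, Finset.mem_filter, Finset.mem_univ, true_and] at hj ⊢
      rw [hdot]
      rcases hj with rfl | hj
      · rw [hr, div_neg, neg_mul, div_mul_cancel₀ _ hk.ne]
        ring
      · rw [hh j hj, hj]; ring
    have := Finset.card_le_card hsub
    rw [Finset.card_insert_of_notMem (by simp [htdef, hk0])] at this
    have := hmax _ hfeas'
    omega
  obtain ⟨J, hJ⟩ := exists_regular_rows (fun j : {j // a j ⬝ᵥ u = b j} => a j) htight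
  exact ⟨u, hu, fun i => J i, hJ, fun i => (J i).2⟩

/-- Cramer's rule. -/
lemma cramerSol_eq {A : Fin s → Fin s → ℝ} (hA : (Matrix.of A).det ≠ 0) {b u : Fin s → ℝ}
    (h : ∀ i, A i ⬝ᵥ u = b i) : cramerSol A b = u := by
  have hmul : (Matrix.of A).mulVec u = b := funext h
  have hcr : ∀ k, cramerSol A b k = ((Matrix.of A).cramer b) k / (Matrix.of A).det := fun k => by
    rw [Matrix.cramer_apply, cramerSol]
    congr 2
    ext i j
    simp [Matrix.updateCol_apply]
  funext k
  rw [hcr, Matrix.cramer_eq_adjugate_mulVec, ← hmul, Matrix.mulVec_mulVec, Matrix.adjugate_mul,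
    Matrix.smul_mulVec, Matrix.one_mulVec, Pi.smul_apply, smul_eq_mul]
  field_simp

/-! ### Sparse vectors -/

lemma foldl_update_of_notMem (I : Fin s → Fin d) (u : Fin s → ℝ) (l : List (Fin s)) (w : Vec d)
    {i : Fin d} (hi : i ∉ Set.range I) :
    l.foldl (fun w b => Function.update w (I b) (u b)) w i = w i := by
  induction l generalizing w with
  | nil => rfl
  | cons b l ih =>
    rw [List.foldl_cons, ih, Function.update_of_ne]
    rintro rfl
    exact hi ⟨b, rfl⟩

lemma foldl_update_of_injective {I : Fin s → Fin d} (hI : Function.Injective I) (u : Fin s → ℝ)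
    (l : List (Fin s)) (w : Vec d) (b : Fin s) :
    l.foldl (fun w b => Function.update w (I b) (u b)) w (I b) = if b ∈ l then u b else w (I b) := by
  induction l generalizing w with
  | nil => simp
  | cons b' l ih =>
    rw [List.foldl_cons, ih, Function.update_apply]
    by_cases hb : b = b'
    · subst hb; simp
    · simp [hb, hI.eq_iff]

lemma scatterVec_of_notMem (I : Fin s → Fin d) (u : Fin s → ℝ) {i : Fin d}
    (hi : i ∉ Set.range I) : scatterVec I u i = 0 :=
  foldl_update_of_notMem I u _ 0 hi

lemma scatterVec_apply {I : Fin s → Fin d} (hI : Function.Injective I) (u : Fin s → ℝ)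
    (b : Fin s) : scatterVec I u (I b) = u b := by
  rw [scatterVec, foldl_update_of_injective hI]
  simp

lemma dot_scatterVec {I : Fin s → Fin d} (hI : Function.Injective I) (u : Fin s → ℝ) (x : Vec d) :
    x ⬝ᵥ scatterVec I u = (fun b => x (I b)) ⬝ᵥ u := by
  rw [dotProduct, dotProduct]
  calc ∑ i, x i * scatterVec I u i = ∑ i ∈ Finset.univ.map ⟨I, hI⟩, x i * scatterVec I u i := by
        refine (Finset.sum_subset (Finset.subset_univ _) fun i _ hi => ?_).symm
        rw [scatterVec_of_notMem, mul_zero]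
        rintro ⟨b, rfl⟩
        exact hi (by simp)
    _ = ∑ b, x (I b) * u b := by
        rw [Finset.sum_map]
        exact Finset.sum_congr rfl fun b _ => by
          rw [Function.Embedding.coeFn_mk, scatterVec_apply hI]

lemma scatterVec_mem_sparseClassifiers (I : Fin s → Fin d) (u : Fin s → ℝ) :
    scatterVec I u ∈ sparseClassifiers d s := by
  have hsub : Function.support (scatterVec I u) ⊆ Set.range I := fun i hi => by
    by_contra h
    exact hi (scatterVec_of_notMem I u h)
  refine (Set.ncard_le_ncard hsub (Set.toFinite _)).trans ?_
  rw [← Set.image_univ]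
  refine (Set.ncard_image_le (Set.toFinite _)).trans ?_
  simp

lemma mem_sparseClassifiers_of_mem_sparseListVal {m : ℕ} {ν : ℝ} {S : Fin m → LabeledPoint d}
    {c : Vec d} (hc : c ∈ sparseListVal s ν S) : c ∈ sparseClassifiers d s := by
  simp only [sparseListVal, List.mem_reverse, List.mem_map] at hc
  obtain ⟨q, -, rfl⟩ := hc
  exact scatterVec_mem_sparseClassifiers _ _

/-- The support is padded to exactly s coordinates, which requires s ≤ d. -/
lemma exists_eq_scatterVec (hsd : s ≤ d) {c : Vec d} (hc : c ∈ sparseClassifiers d s) :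
    ∃ I : Fin s → Fin d, Function.Injective I ∧ c = scatterVec I fun b => c (I b) := by
  classical
  have hcard : (Finset.univ.filter fun i => c i ≠ 0).card ≤ s := by
    have h : (Function.support c).ncard ≤ s := hc
    rwa [show Function.support c = ↑(Finset.univ.filter fun i => c i ≠ 0) by ext; simp,
      Set.ncard_coe_finset] at h
  obtain ⟨t, ht, hts⟩ := Finset.exists_superset_card_eq hcard (by simpa using hsd)
  refine ⟨t.orderEmbOfFin hts, (t.orderEmbOfFin hts).injective, funext fun i => ?_⟩
  by_cases hi : i ∈ t
  · obtain ⟨b, rfl⟩ : i ∈ Set.range (t.orderEmbOfFin hts) := by simpa using hi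
    rw [scatterVec_apply (t.orderEmbOfFin hts).injective]
  · rw [scatterVec_of_notMem _ _ (by simpa using hi)]
    by_contra h
    exact hi (ht (by simpa using h))

end

/-! ### Probabilistic analysis of the list learner. -/

section

open scoped ENNReal
open Prog

variable {d s m : ℕ}

/-! ### Measurability of the candidates -/

section measurability

variable {α : Type*} [MeasurableSpace α]

lemma measurable_det {n : ℕ} {A : α → Fin n → Fin n → ℝ}
    (hA : ∀ i j, Measurable fun x => A x i j) : Measurable fun x => (Matrix.of (A x)).det := by
  simp only [Matrix.det_apply, Matrix.of_apply]
  exact Finset.measurable_sum _ fun σ _ =>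
    (Finset.measurable_prod _ fun i _ => hA _ _).const_smul _

lemma measurable_cramerSol {n : ℕ} {A : α → Fin n → Fin n → ℝ} {b : α → Fin n → ℝ}
    (hA : ∀ i j, Measurable fun x => A x i j) (hb : ∀ i, Measurable fun x => b x i) :
    Measurable fun x => cramerSol (A x) (b x) := by
  refine measurable_pi_lambda _ fun k => Measurable.div ?_ (measurable_det hA)
  refine measurable_det fun i j => ?_
  by_cases h : j = k
  · simp only [h, if_true]; exact hb i
  · simp only [h, if_false]; exact hA i j

lemma measurable_foldl_update (I : Fin s → Fin d) {u : α → Fin s → ℝ} (hu : Measurable u)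
    (l : List (Fin s)) {w : α → Vec d} (hw : Measurable w) :
    Measurable fun x => l.foldl (fun w b => Function.update w (I b) (u x b)) (w x) := by
  induction l generalizing w with
  | nil => exact hw
  | cons b l ih =>
    refine ih (w := fun x => Function.update (w x) (I b) (u x b)) (measurable_pi_lambda _ fun i => ?_)
    by_cases h : i = I b
    · subst h
      simp only [Function.update_self]
      exact (measurable_pi_apply b).comp hu
    · simp only [Function.update_of_ne h]
      exact (measurable_pi_apply i).comp hw

lemma measurable_sgn : Measurable sgn := measurable_of_countable _

lemma measurable_sysMatrix (I : Fin s → Fin d) (J : Fin s → Fin m) (a b : Fin s) :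
    Measurable fun S : Fin m → LabeledPoint d => sysMatrix S I J a b := by
  have h1 : Measurable fun S : Fin m → LabeledPoint d => sgn (S (J a)).2 :=
    measurable_sgn.comp (measurable_pi_apply (J a)).snd
  have h2 : Measurable fun S : Fin m → LabeledPoint d => (S (J a)).1 (I b) :=
    (measurable_pi_apply (I b)).comp (measurable_pi_apply (J a)).fst
  exact h1.mul h2

lemma measurable_candidate (ν : ℝ) (q : (Fin s → Fin d) × (Fin s → Fin m)) :
    Measurable fun S : Fin m → LabeledPoint d => candidate ν S q := by
  refine measurable_foldl_update _ (measurable_cramerSol (measurable_sysMatrix _ _) fun a => ?_) _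
    measurable_const
  exact (measurable_sgn.comp (measurable_pi_apply (q.2 a)).snd).sub measurable_const

end measurability

/-! ### General position -/

section product

variable {Z : Type*} [MeasurableSpace Z] {D : Measure Z} [IsProbabilityMeasure D]

/-- Distinct indices pick independent examples; repeated ones would not, so general position is
claimed for injective tuples only. -/
lemma measurePreserving_comp_injective {J : Fin s → Fin m} (hJ : Function.Injective J) :
    MeasurePreserving (fun S : Fin m → Z => S ∘ J) (Measure.pi fun _ : Fin m => D)
      (Measure.pi fun _ : Fin s => D) := by
  have hind : iIndepFun (fun (i : Fin m) (S : Fin m → Z) => S i) (Measure.pi fun _ : Fin m => D) :=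
    iIndepFun_pi (X := fun _ => id) fun i => aemeasurable_id
  have h := (iIndepFun_iff_map_fun_eq_pi_map (fun a =>
    (measurable_pi_apply (J a)).aemeasurable)).1 (hind.precomp hJ)
  refine ⟨measurable_pi_lambda _ fun a => measurable_pi_apply (J a), ?_⟩
  refine h.trans ?_
  congr 1
  funext a
  exact (measurePreserving_eval (fun _ : Fin m => D) (J a)).map_eq

/-- Unions over all tuples of indices. -/
lemma pi_exists_compression_le (B : Set ((Fin s → Z) × Z)) (hB : MeasurableSet B) {q : ℝ≥0∞}
    (hq : q ≤ 1) :
    Measure.pi (fun _ : Fin m => D) {S | ∃ J : Fin s → Fin m, D {z | (S ∘ J, z) ∈ B} ≤ q ∧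
      ∀ j, j ∉ Set.range J → (S ∘ J, S j) ∈ B} ≤ m ^ s * q ^ (m - s) := by
  rw [Set.ofPred_exists]
  refine (measure_iUnion_fintype_le _ _).trans ((Finset.sum_le_sum fun J _ =>
    pi_compression_le J hB hq).trans (le_of_eq ?_))
  simp

/-- With high probability at least `s` of the examples lie in a given set. -/
lemma pi_few_le {G : Set Z} (hG : MeasurableSet G) {q : ℝ≥0∞} (hq : q ≤ 1) (hGq : D Gᶜ ≤ q)
    (hm : 0 < m) :
    Measure.pi (fun _ : Fin m => D) {S | ¬ ∃ J : Fin s → Fin m, Function.Injective J ∧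
      ∀ a, S (J a) ∈ G} ≤ m ^ s * q ^ (m - s) := by
  classical
  have hB : MeasurableSet ((Set.univ : Set (Fin s → Z)) ×ˢ Gᶜ) := MeasurableSet.univ.prod hG.compl
  -- If fewer than s examples lie in `G`, a tuple listing all of them leaves only examples outside
  -- `G`: a compression event. Spare slots hold the index 0, hence m > 0.
  refine (measure_mono fun S hS => ?_).trans (pi_exists_compression_le _ hB hq)
  set t : Finset (Fin m) := Finset.univ.filter fun j => S j ∈ G
  have hts : t.card < s := by
    by_contra! h
    obtain ⟨t', ht', hcard⟩ := Finset.exists_subset_card_eq h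
    refine hS ⟨t'.orderEmbOfFin hcard, (t'.orderEmbOfFin hcard).injective, fun a => ?_⟩
    have := ht' (t'.orderEmbOfFin_mem hcard a)
    simpa [t] using this
  have : Nonempty (Fin m) := ⟨⟨0, hm⟩⟩
  refine ⟨fun a => if h : (a : ℕ) < t.card then t.orderEmbOfFin rfl ⟨a, h⟩ else ⟨0, hm⟩, ?_,
    fun j hj => ?_⟩
  · exact (measure_mono fun z hz => hz.2).trans hGq
  · refine ⟨Set.mem_univ _, fun hjG => hj ?_⟩
    obtain ⟨b, hb⟩ : j ∈ Set.range (t.orderEmbOfFin rfl) := by simpa [t] using hjG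
    refine ⟨⟨b, b.2.trans hts⟩, ?_⟩
    simp [hb]

end product

variable {D : Measure (LabeledPoint d)} [IsProbabilityMeasure D]

/-- Gaussian points are in general position with respect to any coordinate subspace. -/
lemma pi_det_eq_zero (hD : D.map Prod.fst = stdNormal d) {I : Fin s → Fin d}
    (hI : Function.Injective I) :
    Measure.pi (fun _ : Fin s => D)
      {S | (Matrix.of fun a b => (S a).1 (I b)).det = 0} = 0 := by
  induction s with
  | zero => simp
  | succ s ih =>
    set I' : Fin s → Fin d := I ∘ Fin.succ
    have hI' : Function.Injective I' := hI.comp (Fin.succ_injective _)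
    have hmp := measurePreserving_piFinSuccAbove (fun _ : Fin (s + 1) => D) 0
    set E : Set (LabeledPoint d × (Fin s → LabeledPoint d)) :=
      {q | (Matrix.of fun a b => ((Fin.cons q.1 q.2 : Fin (s + 1) → LabeledPoint d) a).1 (I b)).det
        = 0}
    have hE : MeasurableSet E := by
      have h : Measurable fun q : LabeledPoint d × (Fin s → LabeledPoint d) =>
          (Matrix.of fun a b =>
            ((Fin.cons q.1 q.2 : Fin (s + 1) → LabeledPoint d) a).1 (I b)).det := by
        refine measurable_det fun a b => ?_
        refine Fin.cases ?_ (fun a => ?_) a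
        · exact (measurable_pi_apply (I b)).comp measurable_fst.fst
        · exact (measurable_pi_apply (I b)).comp
            ((measurable_pi_apply a).comp measurable_snd).fst
      exact h (measurableSet_singleton 0)
    have hpre : {S : Fin (s + 1) → LabeledPoint d |
        (Matrix.of fun a b => (S a).1 (I b)).det = 0} =
        MeasurableEquiv.piFinSuccAbove (fun _ => LabeledPoint d) 0 ⁻¹' E := by
      ext S
      have : (Fin.cons (S 0) (fun a => S (Fin.succ a)) : Fin (s + 1) → LabeledPoint d) = S :=
        Fin.cons_self_tail S
      simp only [E, Set.mem_preimage, Set.mem_ofPred_eq]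
      rw [← this]
      rfl
    rw [hpre, hmp.measure_preimage hE.nullMeasurableSet, Measure.prod_apply_symm hE,
      lintegral_eq_zero_iff (measurable_measure_prodMk_right hE)]
    refine (measure_eq_zero_iff_ae_notMem.1 (ih hI')).mono fun S hS => ?_
    set u : Fin (s + 1) → ℝ := fun j => (-1) ^ (j : ℕ) *
      ((Matrix.of fun a b => ((Fin.cons 0 S : Fin (s + 1) → LabeledPoint d) a).1 (I b)).submatrix
        Fin.succ j.succAbove).det
    have hu : scatterVec I u ≠ 0 := fun h => by
      have h0 := congrFun h (I 0)
      rw [scatterVec_apply hI] at h0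
      refine hS ?_
      simp only [u, Fin.val_zero, pow_zero, one_mul, Fin.succAbove_zero, Pi.zero_apply] at h0
      exact h0
    refine le_antisymm ((measure_mono fun z hz => ?_).trans
      (le_of_eq (measure_hyperplane_eq_zero hD hu))) bot_le
    change z.1 ⬝ᵥ scatterVec I u = 0
    rw [dot_scatterVec hI, ← show _ = _ from hz, Matrix.det_succ_row_zero, dotProduct]
    refine Finset.sum_congr rfl fun j _ => ?_
    simp only [u, Matrix.of_apply, Fin.cons_zero]
    rw [mul_left_comm, mul_assoc]
    rfl

/-! ### The list learner -/

/-- The examples in the selected halfspace that the classifier labels correctly. -/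
def goodSample (c v : Vec d) : Set (LabeledPoint d) :=
  {z | z.1 ∈ halfspace v ∧ classify c z.1 = z.2}

/-- The examples that satisfy the linear inequality with margin parameter `ν`. -/
def marginSet (ν : ℝ) (c : Vec d) : Set (LabeledPoint d) :=
  {z | sgn z.2 - ν ≤ sgn z.2 * (z.1 ⬝ᵥ c)}

lemma measurableSet_goodSample (c v : Vec d) : MeasurableSet (goodSample c v) := by
  have h1 : MeasurableSet {z : LabeledPoint d | z.1 ∈ halfspace v} :=
    (measurable_prodMk_left (x := v)) measurableSet_halfspace
  convert h1.diff (measurableSet_error c v) using 1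
  ext z
  simp only [goodSample, Set.mem_ofPred_eq, Set.mem_sdiff]
  tauto

/-- A correct label gives the inequality without margin and ν ≥ 0 relaxes it, so the reference
classifier is feasible for the system of its good examples. -/
lemma goodSample_subset_marginSet {ν : ℝ} (hν : 0 ≤ ν) (c v : Vec d) :
    goodSample c v ⊆ marginSet ν c := by
  rintro ⟨x, y⟩ ⟨-, h⟩
  have h' : classify c x = y := h
  subst h'
  simp only [marginSet, Set.mem_ofPred_eq, classify, sgn]
  rw [dotProduct_comm x c]
  by_cases h : 1 ≤ c ⬝ᵥ x
  · simp only [h, decide_true, if_true]; linarith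
  · simp only [h, decide_false, Bool.false_eq_true, if_false]; linarith

/-- As h(v) has mass at least 1/2, the complement has mass at most 1/2 + ε, which ε ≤ 1/4 brings to
the common bound 1 - ε. -/
lemma measure_compl_goodSample_le (hD : D.map Prod.fst = stdNormal d) {c v : Vec d} {ε : ℝ}
    (hε : ε ≤ 1 / 4) (herr : condError D c v ≤ ε) :
    D (goodSample c v)ᶜ ≤ ENNReal.ofReal (1 - ε) := by
  have h1 : MeasurableSet {z : LabeledPoint d | z.1 ∈ halfspace v} :=
    (measurable_prodMk_left (x := v)) measurableSet_halfspace
  have hsub : (goodSample c v)ᶜ ⊆ {z : LabeledPoint d | z.1 ∈ halfspace v}ᶜ ∪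
      {z | z.1 ∈ halfspace v ∧ classify c z.1 ≠ z.2} := fun z hz => by
    by_cases h : z.1 ∈ halfspace v
    · exact Or.inr ⟨h, fun h' => hz ⟨h, h'⟩⟩
    · exact Or.inl h
  rw [← ofReal_measureReal]
  refine ENNReal.ofReal_le_ofReal ((measureReal_mono hsub).trans
    ((measureReal_union_le _ _).trans ?_))
  rw [probReal_compl_eq_one_sub h1]
  have h2 := half_le_measure_halfspace hD v
  have h3 : D.real {z | z.1 ∈ halfspace v ∧ classify c z.1 ≠ z.2} ≤ ε := herr
  linarith

/-- A classifier that rarely violates the margin inequalities on the good examples has a small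
error. -/
lemma condError_le_of_margin (hD : D.map Prod.fst = stdNormal d) {c c' v : Vec d} {ε ν : ℝ}
    (hν : 0 ≤ ν) (hνε : ν ≤ ε / 2) (hε : ε ≤ 1 / 2) (herr : condError D c v ≤ ε)
    (h : D.real (goodSample c v \ marginSet ν c') ≤ ε) : condError D c' v ≤ 3 * ε := by
  -- An error of c' in h(v) is an error of c, or violates its inequality, or satisfies it with
  -- ⟨x,c'⟩ within ν of 1. The masses are ε, ε and 2ν ≤ ε.
  have hsub : {z : LabeledPoint d | z.1 ∈ halfspace v ∧ classify c' z.1 ≠ z.2} ⊆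
      ({z | z.1 ∈ halfspace v ∧ classify c z.1 ≠ z.2} ∪ (goodSample c v \ marginSet ν c')) ∪
        {z | |z.1 ⬝ᵥ c' - 1| ≤ ν} := by
    rintro ⟨x, y⟩ ⟨hx, hne⟩
    by_cases hy : classify c x = y
    · by_cases hm : ((x, y) : LabeledPoint d) ∈ marginSet ν c'
      · right
        have hne' : classify c' x ≠ y := hne
        simp only [marginSet, Set.mem_ofPred_eq, sgn] at hm
        simp only [Set.mem_ofPred_eq, abs_le]
        rw [classify, dotProduct_comm] at hne'
        cases y
        · simp only [Bool.false_eq_true, if_false] at hm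
          have : 1 ≤ x ⬝ᵥ c' := by simpa using hne'
          constructor <;> linarith
        · simp only [if_true] at hm
          have : x ⬝ᵥ c' < 1 := by simpa using hne'
          constructor <;> linarith
      · exact Or.inl (Or.inr ⟨⟨hx, hy⟩, hm⟩)
    · exact Or.inl (Or.inl ⟨hx, hy⟩)
  have h1 := measure_band_le hD c' hν (by linarith)
  have h2 : D.real {z | z.1 ∈ halfspace v ∧ classify c z.1 ≠ z.2} ≤ ε := herr
  refine (measureReal_mono hsub).trans ((measureReal_union_le _ _).trans
    ((add_le_add_left (measureReal_union_le _ _) _).trans ?_))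
  linarith

lemma sgn_ne_zero (y : Bool) : sgn y ≠ 0 := by
  cases y <;> simp [sgn]

/-- If `s` good examples are in general position, then some candidate satisfies the margin
inequalities on all good examples of the sample. -/
lemma exists_candidate {ν : ℝ} (hν : 0 ≤ ν) {I : Fin s → Fin d} (hI : Function.Injective I)
    {c v : Vec d} (hc : c = scatterVec I fun b => c (I b)) (S : Fin m → LabeledPoint d)
    {J₀ : Fin s → Fin m} (hJ₀ : ∀ a, S (J₀ a) ∈ goodSample c v)
    (hdet : (Matrix.of fun a b => (S (J₀ a)).1 (I b)).det ≠ 0) :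
    ∃ J : Fin s → Fin m, (Matrix.of (sysMatrix S I J)).det ≠ 0 ∧
      ∀ j, S j ∈ goodSample c v → S j ∈ marginSet ν (candidate ν S (I, J)) := by
  set ι := {j : Fin m // S j ∈ goodSample c v}
  set a : ι → Fin s → ℝ := fun j b => sgn (S j).2 * (S j).1 (I b) with hadef
  have hdot : ∀ (j : ι) (u : Fin s → ℝ), a j ⬝ᵥ u = sgn (S j).2 * ((S j).1 ⬝ᵥ scatterVec I u) :=
    fun j u => by
      rw [dot_scatterVec hI, dotProduct, dotProduct, Finset.mul_sum]
      exact Finset.sum_congr rfl fun b _ => by rw [hadef]; ring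
  have ha : ∀ h : Fin s → ℝ, (∀ j, a j ⬝ᵥ h = 0) → h = 0 := fun h hh => by
    refine Matrix.eq_zero_of_mulVec_eq_zero hdet (funext fun i => ?_)
    have := hh ⟨J₀ i, hJ₀ i⟩
    rw [hdot, dot_scatterVec hI] at this
    exact (mul_eq_zero.1 this).resolve_left (sgn_ne_zero _)
  -- Only good examples enter the system, so that `c` is feasible. The learner does not know which
  -- examples are good, but it tries all tuples.
  obtain ⟨u, hu, J, hJ, htight⟩ := exists_vertex a (fun j => sgn (S j).2 - ν) ha
    ⟨fun b => c (I b), fun j => by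
      rw [hdot, ← hc]
      exact goodSample_subset_marginSet hν c v j.2⟩
  refine ⟨fun i => J i, hJ, fun j hj => ?_⟩
  have hcand : candidate ν S (I, fun i => (J i : Fin m)) = scatterVec I u :=
    congrArg (scatterVec I) (cramerSol_eq (u := u) hJ htight)
  rw [hcand]
  have := hu ⟨j, hj⟩
  rw [hdot] at this
  exact this

/-- The list learner outputs a classifier whose error is comparable to the error of a given
sparse classifier. -/
lemma pi_list_le (hD : D.map Prod.fst = stdNormal d) (hsd : s ≤ d) (hm : 0 < m) {c v : Vec d}
    (hc : c ∈ sparseClassifiers d s) {ε ν : ℝ} (hε : 0 ≤ ε) (hε' : ε ≤ 1 / 4)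
    (herr : condError D c v ≤ ε) (hν : 0 ≤ ν) (hνε : ν ≤ ε / 2) :
    Measure.pi (fun _ : Fin m => D)
      {S | ¬ ∃ c' ∈ sparseListVal s ν S, condError D c' v ≤ 3 * ε} ≤
        2 * (m ^ s * ENNReal.ofReal (1 - ε) ^ (m - s)) := by
  obtain ⟨I, hI, hcI⟩ := exists_eq_scatterVec hsd hc
  set q := ENNReal.ofReal (1 - ε)
  have hq : q ≤ 1 := by
    rw [← ENNReal.ofReal_one]
    exact ENNReal.ofReal_le_ofReal (by linarith)
  -- `I` belongs to the fixed `c`, so the union runs over tuples of examples only and no power of d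
  -- arises. The candidate of `J` depends on `S ∘ J` alone, hence `id`.
  set B : Set ((Fin s → LabeledPoint d) × LabeledPoint d) :=
    {p | p.2 ∈ goodSample c v → p.2 ∈ marginSet ν (candidate ν p.1 (I, id))}
  have hmargin : MeasurableSet {p : (Fin s → LabeledPoint d) × LabeledPoint d |
      p.2 ∈ marginSet ν (candidate ν p.1 (I, id))} := by
    have h1 : Measurable fun p : (Fin s → LabeledPoint d) × LabeledPoint d => sgn p.2.2 :=
      measurable_sgn.comp measurable_snd.snd
    have h2 : Measurable fun p : (Fin s → LabeledPoint d) × LabeledPoint d =>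
        p.2.1 ⬝ᵥ candidate ν p.1 (I, id) :=
      Measurable.dot measurable_snd.fst ((measurable_candidate ν (I, id)).comp measurable_fst)
    exact measurableSet_le (h1.sub measurable_const) (h1.mul h2)
  have hB : MeasurableSet B := by
    have h1 : MeasurableSet {p : (Fin s → LabeledPoint d) × LabeledPoint d |
        p.2 ∈ goodSample c v} := measurable_snd (measurableSet_goodSample c v)
    exact h1.imp hmargin
  -- Failure requires s examples in special position (a null event), or fewer than s good examples,
  -- or a tuple whose candidate fits all other examples although it violates mass at least ε.
  set E₀ : Set (Fin m → LabeledPoint d) := ⋃ J : {J : Fin s → Fin m // Function.Injective J},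
    {S | (Matrix.of fun a b => (S (J.1 a)).1 (I b)).det = 0}
  set E₁ : Set (Fin m → LabeledPoint d) := {S | ¬ ∃ J : Fin s → Fin m, Function.Injective J ∧
      ∀ a, S (J a) ∈ goodSample c v}
  set E₂ : Set (Fin m → LabeledPoint d) := {S | ∃ J : Fin s → Fin m,
    D {z | (S ∘ J, z) ∈ B} ≤ q ∧ ∀ j, j ∉ Set.range J → (S ∘ J, S j) ∈ B}
  have h0 : Measure.pi (fun _ : Fin m => D) E₀ = 0 := by
    refine measure_iUnion_null fun J => ?_
    have hmeas : Measurable fun S : Fin s → LabeledPoint d =>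
        (Matrix.of fun a b => (S a).1 (I b)).det :=
      measurable_det fun a b => (measurable_pi_apply (I b)).comp (measurable_pi_apply a).fst
    have h := (measurePreserving_comp_injective (D := D) J.2).measure_preimage
      (hmeas (measurableSet_singleton 0)).nullMeasurableSet
    exact h.trans (pi_det_eq_zero hD hI)
  have h1 : Measure.pi (fun _ : Fin m => D) E₁ ≤ m ^ s * q ^ (m - s) :=
    pi_few_le (measurableSet_goodSample c v) hq (measure_compl_goodSample_le hD hε' herr) hm
  have h2 : Measure.pi (fun _ : Fin m => D) E₂ ≤ m ^ s * q ^ (m - s) :=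
    pi_exists_compression_le B hB hq
  have hsub : {S | ¬ ∃ c' ∈ sparseListVal s ν S, condError D c' v ≤ 3 * ε} ⊆ E₀ ∪ (E₁ ∪ E₂) := by
    intro S hS
    by_contra hno
    simp only [Set.mem_union, not_or] at hno
    obtain ⟨hS0, hS1, hS2⟩ := hno
    obtain ⟨J₀, hJ₀, hgood⟩ := not_not.1 hS1
    have hdet : (Matrix.of fun a b => (S (J₀ a)).1 (I b)).det ≠ 0 := fun h =>
      hS0 (Set.mem_iUnion.2 ⟨⟨J₀, hJ₀⟩, h⟩)
    obtain ⟨J, hJ, hall⟩ := exists_candidate hν hI hcI S hgood hdet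
    refine hS ⟨candidate ν S (I, J), ?_, ?_⟩
    · simp only [sparseListVal, List.mem_reverse, List.mem_map]
      exact ⟨(I, J), by simp [regularPairs, mem_tuplePairs, hJ], rfl⟩
    · have hBq : ¬ D {z | (S ∘ J, z) ∈ B} ≤ q := fun h => hS2 ⟨J, h, fun j _ => hall j⟩
      have hBm : MeasurableSet {z | (S ∘ J, z) ∈ B} := measurable_prodMk_left hB
      rw [← ofReal_measureReal, ENNReal.ofReal_le_ofReal_iff (by linarith)] at hBq
      refine condError_le_of_margin hD hν hνε (by linarith) herr ?_
      have hcompl : goodSample c v \ marginSet ν (candidate ν S (I, J)) =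
          {z | (S ∘ J, z) ∈ B}ᶜ := by
        ext z
        simp only [B, Set.mem_sdiff, Set.mem_compl_iff, Set.mem_ofPred_eq, Classical.not_imp]
        rfl
      rw [hcompl, probReal_compl_eq_one_sub hBm]
      linarith
  refine (measure_mono hsub).trans ((measure_union_le _ _).trans ?_)
  rw [h0, zero_add, two_mul]
  exact (measure_union_le _ _).trans (add_le_add h1 h2)

end

section

open scoped ENNReal
open Prog

/-! ### Sample sizes -/

/-- The claim is s ln m + ln 4 + ln(1/δ) ≤ ε(m - s). With P = B ln(1/ε), ln m is at most ln(2a) + 3P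
while εm ≥ aP, and a = 50(s+1)² exceeds the resulting coefficient 20s(s+1) + 4s + 4. -/
lemma listSampleSize_spec (s d : ℕ) {ε δ : ℝ} (hε : 0 < ε)
    (hε' : ε ≤ 1 / 100) (hδ : 0 < δ) (hδ' : δ < 1) {m : ℕ}
    (hm : m = listSampleSize (50 * (s + 1) ^ 2) s d ε δ) :
    0 < m ∧ 2 * ((m : ℝ≥0∞) ^ s * ENNReal.ofReal (1 - ε) ^ (m - s)) ≤ ENNReal.ofReal (δ / 2) := by
  set a : ℝ := 50 * (s + 1) ^ 2 with ha
  set B := s * Real.log d + Real.log (1 / δ) + 1 with hB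
  set Λ := Real.log (1 / ε) with hΛ
  have hs : (0 : ℝ) ≤ s := Nat.cast_nonneg s
  have hlogd : 0 ≤ s * Real.log d := mul_nonneg hs (Real.log_natCast_nonneg d)
  have hlogδ : 0 ≤ Real.log (1 / δ) := Real.log_nonneg (by rw [le_div_iff₀ hδ]; linarith)
  have hB1 : 1 ≤ B := by linarith
  have hΛ1 : 1 ≤ Λ := one_le_log_inv hε hε'
  have ha1 : 50 ≤ a := by rw [ha]; nlinarith only [hs]
  set P := B * Λ with hP
  have hBP : B ≤ P := le_mul_of_one_le_right (by linarith) hΛ1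
  have hΛP : Λ ≤ P := le_mul_of_one_le_left (by linarith) hB1
  have hP1 : 1 ≤ P := hB1.trans hBP
  have haP : 1 ≤ a * P := by nlinarith only [ha1, hP1]
  set X := a * P / ε with hX
  have hX1 : 1 ≤ X := by rw [hX, le_div_iff₀ hε]; linarith
  have hmX : m = ⌈X⌉₊ := by rw [hm, listSampleSize, hX, hP, mul_assoc]
  have hXm : X ≤ m := by rw [hmX]; exact Nat.le_ceil X
  have hmX2 : (m : ℝ) ≤ 2 * X := by
    rw [hmX]; linarith [Nat.ceil_lt_add_one (by linarith : 0 ≤ X)]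
  have hm0 : (0 : ℝ) < m := by linarith
  refine ⟨by exact_mod_cast hm0, ?_⟩
  have hεm : a * P ≤ ε * m := by
    have := mul_le_mul_of_nonneg_left hXm hε.le
    rwa [hX, mul_div_cancel₀ _ hε.ne'] at this
  have hlogm : Real.log m ≤ Real.log (2 * a) + 3 * P := by
    have h1 : Real.log m ≤ Real.log (2 * a * (B * Λ * (1 / ε))) := by
      refine Real.log_le_log hm0 (hmX2.trans (le_of_eq ?_))
      rw [hX, hP]; ring
    have h2 : Real.log (2 * a * (B * Λ * (1 / ε))) = Real.log (2 * a) + (Real.log B + Real.log Λ + Λ) := by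
      have hΛ0 : Λ ≠ 0 := by linarith
      have hB0 : B ≠ 0 := by linarith
      rw [Real.log_mul (x := 2 * a) (by positivity) (by positivity),
        Real.log_mul (mul_ne_zero hB0 hΛ0) (by positivity), Real.log_mul hB0 hΛ0]
    have h3 := Real.log_le_self (by linarith : 0 ≤ B)
    have h4 := Real.log_le_self (by linarith : 0 ≤ Λ)
    linarith
  have hloga : Real.log (2 * a) ≤ 20 * (s + 1) := by
    have h1 : 2 * a = (10 * (s + 1)) ^ 2 := by rw [ha]; ring
    rw [h1, Real.log_pow]
    have := Real.log_le_self (by positivity : (0 : ℝ) ≤ 10 * (s + 1))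
    push_cast
    linarith
  have hlog4 : Real.log 4 ≤ 3 := (Real.log_le_sub_one_of_pos (by norm_num)).trans (by norm_num)
  have hmain : s * Real.log m - ε * (m - s) + Real.log 4 ≤ Real.log δ := by
    rw [one_div, Real.log_inv] at hB hlogδ
    have h1 : s * Real.log m ≤ s * (20 * (s + 1) + 3 * P) :=
      mul_le_mul_of_nonneg_left (hlogm.trans (by linarith)) hs
    have h2 : s * (20 * (s + 1)) ≤ s * (20 * (s + 1)) * P := le_mul_of_one_le_right (by positivity) hP1
    have h3 : ε * s ≤ s * P := by nlinarith only [hs, hε', hP1]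
    have h4 : (s * (20 * (s + 1)) + 4 * s + 4) * P ≤ a * P := by
      refine mul_le_mul_of_nonneg_right ?_ (by linarith)
      rw [ha]; nlinarith only [hs]
    have h5 : -Real.log δ ≤ P := by linarith
    linarith only [h1, h2, h3, h4, h5, hεm, hlog4, hP1]
  have hreal : (m : ℝ) ^ s * (1 - ε) ^ (m - s) ≤ δ / 4 := by
    have h1 : (m : ℝ) ^ s = Real.exp (s * Real.log m) := by
      rw [Real.exp_nat_mul, Real.exp_log hm0]
    have h2 : (1 - ε) ^ (m - s) ≤ Real.exp (-(ε * (m - s))) := by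
      have h3 : (m : ℝ) - s ≤ ((m - s : ℕ) : ℝ) := by
        rw [sub_le_iff_le_add]; exact_mod_cast (by omega : m ≤ m - s + s)
      calc (1 - ε) ^ (m - s) ≤ Real.exp (-ε) ^ (m - s) :=
            pow_le_pow_left₀ (by linarith) (Real.one_sub_le_exp_neg ε) _
        _ = Real.exp ((m - s : ℕ) * -ε) := (Real.exp_nat_mul _ _).symm
        _ ≤ _ := Real.exp_le_exp.2 (by nlinarith only [h3, hε])
    rw [le_div_iff₀ (by norm_num)]
    calc (m : ℝ) ^ s * (1 - ε) ^ (m - s) * 4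
        ≤ Real.exp (s * Real.log m) * Real.exp (-(ε * (m - s))) * Real.exp (Real.log 4) := by
          rw [h1, Real.exp_log (by norm_num : (0 : ℝ) < 4)]
          gcongr
      _ = Real.exp (s * Real.log m - ε * (m - s) + Real.log 4) := by
          rw [← Real.exp_add, ← Real.exp_add]; ring_nf
      _ ≤ δ := by rw [← Real.exp_log hδ, Real.exp_le_exp]; simpa [Real.log_exp] using hmain
  have hcast : 2 * ((m : ℝ≥0∞) ^ s * ENNReal.ofReal (1 - ε) ^ (m - s)) =
      ENNReal.ofReal (2 * ((m : ℝ) ^ s * (1 - ε) ^ (m - s))) := by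
    rw [ENNReal.ofReal_mul (by norm_num), ENNReal.ofReal_mul (by positivity),
      ENNReal.ofReal_pow (by positivity), ENNReal.ofReal_pow (by linarith), ENNReal.ofReal_natCast,
      ENNReal.ofReal_ofNat]
  rw [hcast]
  exact ENNReal.ofReal_le_ofReal (by linarith)

section sizes

variable {d L T : ℕ} {ε δ : ℝ}

lemma le_numIterationsVal (hL : 1 ≤ L) (hε : 0 < ε) (hδ : 0 < δ) (hδ' : δ < 1) :
    4 * d / ε ^ 4 ≤ (numIterationsVal d L ε δ : ℝ) := by
  have hL' : (1 : ℝ) ≤ L := by exact_mod_cast hL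
  have hlog : 0 ≤ Real.log (8 * L / δ) := Real.log_nonneg (by rw [le_div_iff₀ hδ]; linarith)
  refine le_trans ?_ (Nat.le_ceil _)
  rw [show ε * ε * (ε * ε) = ε ^ 4 by ring]
  gcongr
  linarith

/-- Nε² ≥ 1600ℓ makes each exponential at most e^(-ℓ) = δ/(16TL); the union over L candidates and T
steps leaves δ/8. -/
lemma batchSizeVal_spec (hd : 1 ≤ d) (hL : 1 ≤ L) (hT : 1 ≤ T) (hε : 0 < ε) (hε' : ε ≤ 1 / 100)
    (hδ : 0 < δ) (hδ' : δ < 1) {N : ℕ} (hN : N = batchSizeVal L T ε δ) :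
    0 < N ∧ (L : ℝ≥0∞) * (T * (ENNReal.ofReal (Real.exp (-(N * ε ^ 2 / 120))) +
      ENNReal.ofReal (Real.exp (-(N * d * 3 / 4))))) ≤ ENNReal.ofReal (δ / 8) := by
  have hd' : (1 : ℝ) ≤ d := by exact_mod_cast hd
  have hL' : (1 : ℝ) ≤ L := by exact_mod_cast hL
  have hT' : (1 : ℝ) ≤ T := by exact_mod_cast hT
  have hTL : (1 : ℝ) ≤ T * L := one_le_mul_of_one_le_of_one_le hT' hL'
  set ℓ := Real.log (16 * T * L / δ) with hℓ
  have hℓ1 : 1 ≤ ℓ := by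
    rw [hℓ, Real.le_log_iff_exp_le (by positivity), le_div_iff₀ hδ]
    nlinarith only [Real.exp_one_lt_d9, hTL, hδ, hδ']
  have hexp : Real.exp (-ℓ) = δ / (16 * T * L) := by
    rw [Real.exp_neg, hℓ, Real.exp_log (by positivity), inv_div]
  have hNℓ : 1600 * ℓ ≤ N * ε ^ 2 := by
    have h := Nat.le_ceil (1600 * (ℓ * ℓ) / (ε * ε))
    rw [div_le_iff₀ (by positivity)] at h
    have h2 : (N : ℝ) = ⌈1600 * (ℓ * ℓ) / (ε * ε)⌉₊ := by rw [hN]; rfl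
    rw [← h2] at h
    nlinarith only [h, hℓ1]
  have hε2 : ε ^ 2 ≤ 1 := by nlinarith only [hε, hε']
  have hN0 : (0 : ℝ) < N := by
    have : (0 : ℝ) < N * ε ^ 2 := by linarith
    exact pos_of_mul_pos_left this (by positivity)
  refine ⟨by exact_mod_cast hN0, ?_⟩
  have h1 : Real.exp (-(N * ε ^ 2 / 120)) ≤ δ / (16 * T * L) := by
    rw [← hexp]; exact Real.exp_le_exp.2 (by linarith)
  have h2 : Real.exp (-(N * d * 3 / 4)) ≤ δ / (16 * T * L) := by
    rw [← hexp]
    have h3 : N * ε ^ 2 ≤ N := mul_le_of_le_one_right hN0.le hε2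
    have h4 : (N : ℝ) ≤ N * d := le_mul_of_one_le_right hN0.le hd'
    exact Real.exp_le_exp.2 (by linarith)
  rw [← ENNReal.ofReal_add (Real.exp_pos _).le (Real.exp_pos _).le, ← ENNReal.ofReal_natCast L,
    ← ENNReal.ofReal_natCast T, ← ENNReal.ofReal_mul (by positivity),
    ← ENNReal.ofReal_mul (by positivity)]
  refine ENNReal.ofReal_le_ofReal ?_
  calc (L : ℝ) * (T * (Real.exp (-(N * ε ^ 2 / 120)) + Real.exp (-(N * d * 3 / 4))))
      ≤ L * (T * (δ / (16 * T * L) + δ / (16 * T * L))) := by gcongr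
    _ = δ / 8 := by field_simp; norm_num

/-- The target error is at least 4ε, so the exponent is at least 2ℓ and δ/(4LT) enters squared,
which absorbs the 4LT events of the union. -/
lemma validationSizeVal_spec (hL : 1 ≤ L) (hT : 1 ≤ T) (hε : 0 < ε) (hε' : ε ≤ 1 / 100)
    (hδ : 0 < δ) (hδ' : δ < 1) {n : ℕ} (hn : n = validationSizeVal L T ε δ) :
    0 < n ∧ (L : ℝ≥0∞) * ((2 * T : ℕ) * (ENNReal.ofReal (Real.exp (-(n * targetError ε))) +
      ENNReal.ofReal (Real.exp (-(n * targetError ε))))) ≤ ENNReal.ofReal (δ / 4) := by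
  have hL' : (1 : ℝ) ≤ L := by exact_mod_cast hL
  have hT' : (1 : ℝ) ≤ T := by exact_mod_cast hT
  have hLT : (1 : ℝ) ≤ L * T := one_le_mul_of_one_le_of_one_le hL' hT'
  set ℓ := Real.log (4 * L * T / δ) with hℓ
  have hℓ0 : 0 < ℓ := Real.log_pos (by rw [lt_div_iff₀ hδ]; nlinarith only [hLT, hδ'])
  have hexp : Real.exp (-(2 * ℓ)) = (δ / (4 * L * T)) ^ 2 := by
    rw [show -(2 * ℓ) = (2 : ℕ) * -ℓ by push_cast; ring, Real.exp_nat_mul, Real.exp_neg, hℓ,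
      Real.exp_log (by positivity), inv_div]
  have hnℓ : ℓ ≤ n * (2 * ε) := by
    have h := Nat.le_ceil (ℓ / (2 * ε))
    have h2 : (n : ℝ) = ⌈ℓ / (2 * ε)⌉₊ := by rw [hn]; rfl
    rwa [← h2, div_le_iff₀ (by positivity)] at h
  have hn0 : (0 : ℝ) < n := pos_of_mul_pos_left (hℓ0.trans_le hnℓ) (by positivity)
  refine ⟨by exact_mod_cast hn0, ?_⟩
  have hp : 4 * ε ≤ targetError ε := by
    have h1 := one_le_log_inv hε hε'
    have h2 : ε ≤ Real.sqrt ε := Real.le_sqrt_of_sq_le (by nlinarith only [hε, hε'])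
    have h3 : Real.sqrt ε ≤ Real.sqrt ε * Real.log (1 / ε) :=
      le_mul_of_one_le_right (Real.sqrt_nonneg _) h1
    unfold targetError
    linarith
  have h1 : Real.exp (-(n * targetError ε)) ≤ (δ / (4 * L * T)) ^ 2 := by
    rw [← hexp]
    have := mul_le_mul_of_nonneg_left hp hn0.le
    exact Real.exp_le_exp.2 (by linarith)
  rw [← ENNReal.ofReal_add (Real.exp_pos _).le (Real.exp_pos _).le, ← ENNReal.ofReal_natCast L,
    ← ENNReal.ofReal_natCast (2 * T), ← ENNReal.ofReal_mul (by positivity),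
    ← ENNReal.ofReal_mul (by positivity)]
  refine ENNReal.ofReal_le_ofReal ?_
  push_cast
  calc (L : ℝ) * (2 * T * (Real.exp (-(n * targetError ε)) + Real.exp (-(n * targetError ε))))
      ≤ L * (2 * T * ((δ / (4 * L * T)) ^ 2 + (δ / (4 * L * T)) ^ 2)) := by gcongr
    _ = δ / 4 * (δ / (L * T)) := by field_simp; norm_num
    _ ≤ δ / 4 * 1 := by
        gcongr
        rw [div_le_one (by positivity)]; linarith
    _ = δ / 4 := mul_one _

end sizes

end

section

open scoped ENNReal
open Prog

variable {d s m : ℕ}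

/-! ### Conditional classification on a random list -/

/-- The list has random length; measurability is obtained by stratifying over the countably many
outcomes of the filter. -/
lemma measurableSet_filter_eq {α β : Type*} [MeasurableSpace α] (t : List β) (p : α → β → Prop)
    [∀ x, DecidablePred (p x)] (hp : ∀ b, MeasurableSet {x | p x b}) (l : List β) :
    MeasurableSet {x | t.filter (fun b => p x b) = l} := by
  induction t generalizing l with
  | nil => simp
  | cons b t ih =>
    have hcons : MeasurableSet {x | b :: t.filter (fun b => p x b) = l} := by
      cases l with
      | nil => simp
      | cons c l =>
        simp only [List.cons.injEq]
        exact (MeasurableSet.const _).inter (ih l)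
    convert ((hp b).inter hcons).union ((hp b).compl.inter (ih l)) using 1
    ext x
    by_cases h : p x b <;> simp [h]

lemma measurableSet_regularPairs_eq (l : List ((Fin s → Fin d) × (Fin s → Fin m))) :
    MeasurableSet {S : Fin m → LabeledPoint d | regularPairs s S = l} := by
  refine measurableSet_filter_eq _
    (fun (S : Fin m → LabeledPoint d) q => (Matrix.of (sysMatrix S q.1 q.2)).det ≠ 0)
    (fun q => ?_) l
  have h : Measurable fun S : Fin m → LabeledPoint d => (Matrix.of (sysMatrix S q.1 q.2)).det :=
    measurable_det (measurable_sysMatrix q.1 q.2)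
  exact (h (measurableSet_singleton 0)).compl

/-- Some entry of the list, together with the stream, lies in the exceptional set of a list of
that length. -/
def listBad (s m : ℕ) (ν : ℝ) (A : ℕ → ℕ → Set (Vec d × (ℕ → LabeledPoint d))) :
    Set ((Fin m → LabeledPoint d) × (ℕ → LabeledPoint d)) :=
  {p | ∃ k, ∃ hk : k < (sparseListVal s ν p.1).length,
    ((sparseListVal s ν p.1)[k], p.2) ∈ A (sparseListVal s ν p.1).length k}

lemma measurableSet_listBad (ν : ℝ) {A : ℕ → ℕ → Set (Vec d × (ℕ → LabeledPoint d))}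
    (hA : ∀ L k, MeasurableSet (A L k)) : MeasurableSet (listBad s m ν A) := by
  have heq : listBad s m ν A = ⋃ l : List ((Fin s → Fin d) × (Fin s → Fin m)),
      {p | regularPairs s p.1 = l} ∩ ⋃ k : Fin l.length,
        {p | (candidate ν p.1 (l.reverse[k]'(by simp)), p.2) ∈ A l.length k} := by
    ext p
    simp only [listBad, Set.mem_ofPred_eq, Set.mem_iUnion, Set.mem_inter_iff]
    constructor
    · rintro ⟨k, hk, h⟩
      refine ⟨_, rfl, ⟨k, by simpa [sparseListVal] using hk⟩, ?_⟩
      simpa [sparseListVal] using h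
    · rintro ⟨l, rfl, k, h⟩
      refine ⟨k, by simp [sparseListVal], ?_⟩
      simpa [sparseListVal] using h
  rw [heq]
  refine MeasurableSet.iUnion fun l => MeasurableSet.inter ?_ (MeasurableSet.iUnion fun k => ?_)
  · exact measurable_fst (measurableSet_regularPairs_eq l)
  · have h : Measurable fun p : (Fin m → LabeledPoint d) × (ℕ → LabeledPoint d) =>
        (candidate ν p.1 (l.reverse[k]'(by simp)), p.2) :=
      ((measurable_candidate ν _).comp measurable_fst).prodMk measurable_snd
    exact h (hA _ _)

variable {D : Measure (LabeledPoint d)} [IsProbabilityMeasure D]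

/-- Given the first m examples the list is fixed and the rest of the stream is independent of it.
`ρ` depends on L because the sample parameters do. -/
lemma stream_listBad_le (ν : ℝ) {A : ℕ → ℕ → Set (Vec d × (ℕ → LabeledPoint d))}
    (hA : ∀ L k, MeasurableSet (A L k)) {r : ℝ≥0∞} {ρ : ℕ → ℝ≥0∞}
    (hAρ : ∀ L k c, 1 ≤ L → Measure.infinitePi (fun _ : ℕ => D) {ω | (c, ω) ∈ A L k} ≤ ρ L)
    (hρ : ∀ L : ℕ, 1 ≤ L → L * ρ L ≤ r) :
    Measure.infinitePi (fun _ : ℕ => D) {ω | (first m ω, shift m ω) ∈ listBad s m ν A} ≤ r := by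
  refine stream_le_of_forall_first (measurableSet_listBad ν hA) fun S => ?_
  set C := sparseListVal s ν S
  have hsub : {ω | (S, ω) ∈ listBad s m ν A} ⊆
      ⋃ k : Fin C.length, {ω | (C[k], ω) ∈ A C.length k} := by
    rintro ω ⟨k, hk, h⟩
    exact Set.mem_iUnion.2 ⟨⟨k, hk⟩, h⟩
  refine (measure_mono hsub).trans ((measure_iUnion_fintype_le _ _).trans ?_)
  rcases Nat.eq_zero_or_pos C.length with h0 | hpos
  · rw [Finset.sum_eq_zero fun k _ => absurd k.2 (by omega)]
    exact bot_le
  · refine (Finset.sum_le_sum fun (k : Fin C.length) _ => hAρ C.length k C[k] hpos).trans (le_trans ?_ (hρ _ hpos))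
    simp

/-- The exceptional set of conditional classification for a list of length `L`. -/
def ccfcBad (D : Measure (LabeledPoint d)) (v w₀ : Vec d) (ε δ : ℝ) (L k : ℕ) :
    Set (Vec d × (ℕ → LabeledPoint d)) :=
  descentBad D v w₀ ε (numIterationsVal d L ε δ)
      (batchSizeVal L (numIterationsVal d L ε δ) ε δ)
      (validationSizeVal L (numIterationsVal d L ε δ) ε δ) k ∪
    selectBad D (targetError ε) w₀ (numIterationsVal d L ε δ)
      (batchSizeVal L (numIterationsVal d L ε δ) ε δ)
      (validationSizeVal L (numIterationsVal d L ε δ) ε δ) k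

lemma measurableSet_ccfcBad (v w₀ : Vec d) (ε δ : ℝ) (L k : ℕ) :
    MeasurableSet (ccfcBad D v w₀ ε δ L k) :=
  (measurableSet_descentBad v w₀ ε _ _ _ k).union (measurableSet_selectBad _ w₀ _ _ _ k)

/-- Descent contributes δ/8 and validation δ/4, for every list length, as T, N and n are computed
from it. -/
lemma stream_listBad_ccfcBad_le (hD : D.map Prod.fst = stdNormal d) (hd : 1 ≤ d) {v w₀ : Vec d}
    (hv : v ⬝ᵥ v = 1) (hw₀ : w₀ ⬝ᵥ w₀ = 1) {ε δ : ℝ} (hε : 0 < ε) (hε' : ε ≤ 1 / 100) (hδ : 0 < δ)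
    (hδ' : δ < 1) (ν : ℝ) :
    Measure.infinitePi (fun _ : ℕ => D)
      {ω | (first m ω, shift m ω) ∈ listBad s m ν (ccfcBad D v w₀ ε δ)} ≤
        ENNReal.ofReal (δ / 2) := by
  set T : ℕ → ℕ := fun L => numIterationsVal d L ε δ
  set N : ℕ → ℕ := fun L => batchSizeVal L (T L) ε δ
  set n : ℕ → ℕ := fun L => validationSizeVal L (T L) ε δ
  have hT : ∀ L, 1 ≤ L → 1 ≤ T L := fun L hL => by
    have h : 4 * d / ε ^ 4 ≤ (T L : ℝ) := le_numIterationsVal hL hε hδ hδ'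
    have hd' : (1 : ℝ) ≤ d := by exact_mod_cast hd
    have : (0 : ℝ) < T L := lt_of_lt_of_le (by positivity) h
    exact_mod_cast this
  have hN : ∀ L, 1 ≤ L → _ := fun L hL =>
    batchSizeVal_spec hd hL (hT L hL) hε hε' hδ hδ' (N := N L) rfl
  have hn : ∀ L, 1 ≤ L → _ := fun L hL =>
    validationSizeVal_spec hL (hT L hL) hε hε' hδ hδ' (n := n L) rfl
  have hp : 0 ≤ targetError ε := by
    have := one_le_log_inv hε hε'
    unfold targetError
    positivity
  refine stream_listBad_le ν (measurableSet_ccfcBad v w₀ ε δ)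
    (ρ := fun L => T L * (ENNReal.ofReal (Real.exp (-(N L * ε ^ 2 / 120))) +
      ENNReal.ofReal (Real.exp (-(N L * d * 3 / 4)))) +
      (2 * T L : ℕ) * (ENNReal.ofReal (Real.exp (-(n L * targetError ε))) +
      ENNReal.ofReal (Real.exp (-(n L * targetError ε))))) (fun L k c hL => ?_) fun L hL => ?_
  · exact (measure_union_le _ _).trans (add_le_add
      (stream_descentBad_le hw₀ ε _ _ _ k
        (fun c w hw => pi_stepBad_le hD hv hw hε (by linarith) (hN L hL).1) c)
      (stream_selectBad_le _ w₀ _ _ _ k (fun c w => pi_validBad_le c w hp (hn L hL).1) c))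
  · rw [mul_add]
    refine (add_le_add (hN L hL).2 (hn L hL).2).trans ?_
    rw [← ENNReal.ofReal_add (by positivity) (by positivity)]
    exact ENNReal.ofReal_le_ofReal (by linarith)

/-- Conditional classification for sparse linear classifiers succeeds with high probability. -/
theorem stream_ccslc_fails_le (hD : D.map Prod.fst = stdNormal d) (hd : 1 ≤ d) (hsd : s ≤ d)
    {c v w₀ : Vec d} (hv : v ⬝ᵥ v = 1) (hc : c ∈ sparseClassifiers d s) {ε δ ν : ℝ} (hε : 0 < ε)
    (hε' : ε ≤ 1 / 100) (hδ : 0 < δ) (hδ' : δ < 1) (herr : condError D c v ≤ ε) (hν : 0 ≤ ν)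
    (hνε : ν ≤ ε / 2) (hw₀ : w₀ ⬝ᵥ w₀ = 1) {m : ℕ}
    (hm : m = listSampleSize (50 * (s + 1) ^ 2) s d ε δ) :
    Measure.infinitePi (fun _ : ℕ => D)
      {ω | ¬ ∃ c w : Vec d, ((ccslc s m ν w₀ ε δ).run ω).value = some (c, w) ∧
        c ∈ sparseClassifiers d s ∧ w ⬝ᵥ w = 1 ∧ condError D c w ≤ 12 * targetError ε} ≤
      ENNReal.ofReal δ := by
  obtain ⟨hm0, hmδ⟩ := listSampleSize_spec s d hε hε' hδ hδ' hm
  set F := {S : Fin m → LabeledPoint d |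
    ¬ ∃ c' ∈ sparseListVal s ν S, condError D c' v ≤ 3 * ε}
  have hF : Measure.pi (fun _ : Fin m => D) F ≤ ENNReal.ofReal (δ / 2) :=
    (pi_list_le hD hsd hm0 hc hε.le (by linarith) herr hν hνε).trans hmδ
  -- A measurable superset of equal measure makes the measurability of `F` itself irrelevant.
  set F' := toMeasurable (Measure.pi fun _ : Fin m => D) F
  have hF' : Measure.infinitePi (fun _ : ℕ => D) {ω | first m ω ∈ F'} ≤ ENNReal.ofReal (δ / 2) :=
    (stream_first_le (measurableSet_toMeasurable _ _)).trans
      ((measure_toMeasurable _).le.trans hF)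
  have hE := stream_listBad_ccfcBad_le (s := s) (m := m) hD hd hv hw₀ hε hε' hδ hδ' ν
  have hsub : {ω | ¬ ∃ c w : Vec d, ((ccslc s m ν w₀ ε δ).run ω).value = some (c, w) ∧
      c ∈ sparseClassifiers d s ∧ w ⬝ᵥ w = 1 ∧ condError D c w ≤ 12 * targetError ε} ⊆
      {ω | first m ω ∈ F'} ∪
        {ω | (first m ω, shift m ω) ∈ listBad s m ν (ccfcBad D v w₀ ε δ)} := by
    intro ω hω
    by_contra hno
    simp only [Set.mem_union, not_or] at hno
    obtain ⟨h1, h2⟩ := hno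
    have hlist : ∃ c' ∈ sparseListVal s ν (first m ω), condError D c' v ≤ 3 * ε := by
      by_contra h
      exact h1 (subset_toMeasurable _ _ h)
    have hL : 1 ≤ (sparseListVal s ν (first m ω)).length := by
      obtain ⟨c', hc', -⟩ := hlist
      exact List.length_pos_of_mem hc'
    obtain ⟨c', w, hval, hmem, hw, hcw⟩ := exists_ccfcVal_eq_of_not_bad hD hd hv hw₀ hε hε'
      (le_numIterationsVal hL hε hδ hδ') _ (shift m ω)
      (fun k hk h => h2 ⟨k, hk, Or.inl h⟩) (fun k hk h => h2 ⟨k, hk, Or.inr h⟩) hlist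
    exact hω ⟨c', w, (exec_ccslc s m ν w₀ ε δ ω rfl rfl rfl rfl).value.trans hval,
      mem_sparseClassifiers_of_mem_sparseListVal hmem, hw, hcw⟩
  refine (measure_mono hsub).trans ((measure_union_le _ _).trans ((add_le_add hF' hE).trans ?_))
  rw [← ENNReal.ofReal_add (by positivity) (by positivity), add_halves]

end

end CondClass

end

/-! ### The main theorem. -/

theorem mainTheorem4 (s : ℕ) :
    ∃ ε₀ : ℝ, 0 < ε₀ ∧ ε₀ ≤ Real.exp (-1) ∧ ∃ a : ℝ, 0 < a ∧ ∃ K : ℕ,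
      ∀ (d : ℕ) (ε δ : ℝ), 1 ≤ d → s ≤ d → 0 < ε → ε ≤ ε₀ → 0 < δ → δ < 1 →
        -- number of examples and running time, whatever the examples are
        (∀ (ν : ℝ) (w₀ : CondClass.Vec d) (ω : ℕ → CondClass.LabeledPoint d),
          ((((CondClass.Prog.ccslc s (CondClass.listSampleSize a s d ε δ) ν w₀ ε δ).run ω).samples
              : ℕ) : ℝ) ≤ K * (d * (1 / ε) * (1 / δ)) ^ K ∧
          ((((CondClass.Prog.ccslc s (CondClass.listSampleSize a s d ε δ) ν w₀ ε δ).run ω).steps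
              : ℕ) : ℝ) ≤ K * (d * (1 / ε) * (1 / δ)) ^ K) ∧
        -- correctness
        ∃ ν₀ : ℝ, 0 < ν₀ ∧ ∀ ν : ℝ, 0 ≤ ν → ν ≤ ν₀ →
          ∀ w₀ : CondClass.Vec d, w₀ ⬝ᵥ w₀ = 1 →
          ∀ (D : MeasureTheory.Measure (CondClass.LabeledPoint d))
            [MeasureTheory.IsProbabilityMeasure D],
            D.map Prod.fst = CondClass.stdNormal d →
            (∃ v : CondClass.Vec d, v ⬝ᵥ v = 1 ∧
              ∃ c ∈ CondClass.sparseClassifiers d s, CondClass.condError D c v ≤ ε) →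
            MeasureTheory.Measure.infinitePi (fun _ : ℕ => D)
              {ω | ¬ ∃ c w : CondClass.Vec d,
                ((CondClass.Prog.ccslc s (CondClass.listSampleSize a s d ε δ) ν w₀ ε δ).run
                    ω).value = some (c, w) ∧
                c ∈ CondClass.sparseClassifiers d s ∧ w ⬝ᵥ w = 1 ∧
                CondClass.condError D c w ≤ K * Real.sqrt ε * Real.log (1 / ε) ^ K}
              ≤ ENNReal.ofReal δ := by
  obtain ⟨K₀, hK₀⟩ := CondClass.exists_polynomial_cost (a := 50 * ((s : ℝ) + 1) ^ 2)
    (by positivity) s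
  -- 288 = 12 · 24 comes from the error bound and `K₀` from the cost; as ln(1/ε) ≥ 1, enlarging K
  -- only weakens the error bound.
  refine ⟨1 / 100, by norm_num, ?_, 50 * ((s : ℝ) + 1) ^ 2, by positivity, max K₀ 288, ?_⟩
  · rw [Real.exp_neg, one_div]
    exact inv_anti₀ (Real.exp_pos 1) (by linarith [Real.exp_one_lt_d9])
  intro d ε δ hd hsd hε hε' hδ hδ'
  refine ⟨hK₀ _ (le_max_left _ _) d ε δ hd hε (by linarith) hδ hδ', ε / 2, by positivity, ?_⟩
  rintro ν hν hνε w₀ hw₀ D _ hD ⟨v, hv, c, hc, herr⟩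
  refine (MeasureTheory.measure_mono fun ω hω => ?_).trans (CondClass.stream_ccslc_fails_le hD hd
    hsd hv hc hε hε' hδ hδ' herr hν hνε hw₀ rfl)
  rintro ⟨c', w, hval, hc', hw, hcw⟩
  refine hω ⟨c', w, hval, hc', hw, hcw.trans ?_⟩
  have hΛ := CondClass.one_le_log_inv hε hε'
  have hK : (288 : ℝ) ≤ (max K₀ 288 : ℕ) := by exact_mod_cast le_max_right K₀ 288
  calc 12 * CondClass.targetError ε = 288 * Real.sqrt ε * Real.log (1 / ε) := by
        unfold CondClass.targetError; ring
    _ ≤ (max K₀ 288 : ℕ) * Real.sqrt ε * Real.log (1 / ε) ^ (max K₀ 288) := by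
        gcongr
        exact le_self_pow₀ hΛ (by omega)
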